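/- Let $k$ be an algebraically closed field of characteristic zero, let $A$ be a commutative associative unital $k$-algebra, and let $\mathfrak g=\mathfrak g_{\bar 0}\oplus\mathfrak g_{\bar 1}$ be a reductive Lie algebra (finite dimensional, with $\mathfrak g_{\bar 1}=0$), a basic classical Lie superalgebra, or $\mathfrak{sl}(n,n)$ with $n\ge 1$. Fix a triangular decomposition $\mathfrak g=\mathfrak n^-\oplus\mathfrak h\oplus\mathfrak n^+$: $\mathfrak h$ is a Cartan subalgebra of $\mathfrak g_{\bar 0}$; if $\mathfrak g$ is a reductive Lie algebra the decomposition is the one given by any system of positive roots; otherwise $\mathfrak n^{+}$ (resp. $\mathfrak n^-$) is the sum of the parts of positive (resp. negative) degree of a distinguished $\mathbb Z$-grading of $\mathfrak g$, whose degree $0$ part contains $\mathfrak h$, and of the positive (resp. negative) root spaces of that degree $0$ part for a system of positive roots. Here a distinguished $\mathbb Z$-grading is one compatible with the $\mathbb Z_2$-grading such that: if $\mathfrak g$ is of type I (i.e. $\mathfrak g_{\bar 1}$ is the direct sum of two irreducible $\mathfrak g_{\bar 0}$-modules) or $\mathfrak{sl}(n,n)$, then $\mathfrak g_{\bar 0}$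 is the part of degree $0$ and $\mathfrak g_{\bar 1}$ is the sum of the parts of degree $\pm1$; if $\mathfrak g$ is of type II (i.e. $\mathfrak g_{\bar 1}$ is an irreducible $\mathfrak g_{\bar 0}$-module), then $\mathfrak g_{\bar 0}$ is the sum of the parts of degree $0,\pm2$ and $\mathfrak g_{\bar 1}$ is the sum of the parts of degree $\pm1$. Modules over Lie superalgebras are $\mathbb Z_2$-graded, submodules are graded, and tensor products carry the action $x(v\otimes w)=xv\otimes w+(-1)^{|x||v|}v\otimes xw$. A $(\mathfrak g\otimes A)$-module $V$ is a highest weight module if there is a nonzero $v\in V$ with $(\mathfrak n^+\otimes A)v=0$, $U(\mathfrak h\otimes A)v=kv$ and $U(\mathfrak g\otimes A)v=V$. The support of $V$ is the set of maximal ideals of $A$ containing $\operatorname{Ann}_A V$, the sum of all ideals $I$ of $A$ with $(\mathfrak g\otimes I)V=0$. For $\psi\in(\mathfrak h\otimes A)^*$, let $V(\psi)$ be the quotient of $U(\mathfrak g\otimes A)\otimes_{U((\mathfrak h\oplus\mathfrak n^+)\otimes A)}k_\psi$ by its unique maximal submodule, where $k_\psi=k$, in even degree, with $\mathfrak h\otimes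 A$ acting by $\psi$ and $\mathfrak n^+\otimes A$ by $0$. (a) If $V$ and $W$ are irreducible highest weight $(\mathfrak g\otimes A)$-modules with disjoint supports, then the $(\mathfrak g\otimes A)$-module $V\otimes W$ is irreducible. (b) If $n\ge 1$ and $\psi_1,\dots,\psi_n\in(\mathfrak h\otimes A)^*$ are such that $V(\psi_1),\dots,V(\psi_n)$ have pairwise disjoint supports, then $V\left(\sum_{i=1}^n\psi_i\right)\cong\bigotimes_{i=1}^n V(\psi_i)$ as $(\mathfrak g\otimes A)$-modules. -/

import Mathlib

open scoped TensorProduct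

/-! ### Super vector spaces -/

/-- A `ℤ/2`-graded vector space `V = V₀ ⊕ V₁`. -/
class SuperSpace (k V : Type*) [Field k] [AddCommGroup V] [Module k V] where
  par : ZMod 2 → Submodule k V
  isCompl : IsCompl (par 0) (par 1)

/-- The homogeneous part of parity `i` of a super vector space. -/
abbrev homog (k V : Type*) [Field k] [AddCommGroup V] [Module k V] [SuperSpace k V]
    (i : ZMod 2) : Submodule k V :=
  SuperSpace.par i

/-- The sign `(-1)^{ij}`. -/
def superSign (i j : ZMod 2) : ℤ := if i = 1 ∧ j = 1 then -1 else 1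

namespace SuperSpace

variable (k V : Type*) [Field k] [AddCommGroup V] [Module k V] [SuperSpace k V]

/-- The projection onto the even part. -/
noncomputable def evenProj : V →ₗ[k] V :=
  (homog k V 0).projection (homog k V 1) SuperSpace.isCompl

/-- The projection onto the odd part. -/
noncomputable def oddProj : V →ₗ[k] V := LinearMap.id - evenProj k V

/-- The parity involution: `v ↦ (-1)^{|v|} v` on homogeneous `v`. -/
noncomputable def parity : V →ₗ[k] V := evenProj k V - oddProj k V

variable {k V}

theorem evenProj_even {v : V} (hv : v ∈ homog k V 0) : evenProj k V v = v :=
  Submodule.projection_apply_of_mem_left _ hv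

theorem evenProj_odd {v : V} (hv : v ∈ homog k V 1) : evenProj k V v = 0 := by
  unfold evenProj
  rw [Submodule.projection_apply, Submodule.projectionOnto_apply_of_mem_right _ hv]
  rfl

theorem oddProj_even {v : V} (hv : v ∈ homog k V 0) : oddProj k V v = 0 := by
  simp [oddProj, evenProj_even hv]

theorem oddProj_odd {v : V} (hv : v ∈ homog k V 1) : oddProj k V v = v := by
  simp [oddProj, evenProj_odd hv]

theorem parity_even {v : V} (hv : v ∈ homog k V 0) : parity k V v = v := by
  simp [parity, evenProj_even hv, oddProj_even hv]

theorem parity_odd {v : V} (hv : v ∈ homog k V 1) : parity k V v = -v := by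
  simp [parity, evenProj_odd hv, oddProj_odd hv]

theorem exists_eq_add (v : V) : ∃ a ∈ homog k V 0, ∃ b ∈ homog k V 1, v = a + b := by
  have h : v ∈ homog k V 0 ⊔ homog k V 1 := by
    rw [(SuperSpace.isCompl (k := k) (V := V)).sup_eq_top]; trivial
  obtain ⟨a, ha, b, hb, rfl⟩ := Submodule.mem_sup.1 h
  exact ⟨a, ha, b, hb, rfl⟩

theorem parity_parity (v : V) : parity k V (parity k V v) = v := by
  obtain ⟨a, ha, b, hb, rfl⟩ := exists_eq_add (k := k) v
  simp [parity_even ha, parity_odd hb]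

end SuperSpace

section Involution

variable {k V : Type*} [Field k] [AddCommGroup V] [Module k V]

/-- The eigenspace of `T` for the eigenvalue `(-1)^i`. -/
def involutionPart (T : V →ₗ[k] V) (i : ZMod 2) : Submodule k V :=
  LinearMap.ker (T - (if i = 1 then (-1 : ℤ) else 1) • LinearMap.id)

theorem mem_involutionPart_zero {T : V →ₗ[k] V} {v : V} :
    v ∈ involutionPart T 0 ↔ T v = v := by
  simp [involutionPart, sub_eq_zero]

theorem mem_involutionPart_one {T : V →ₗ[k] V} {v : V} :
    v ∈ involutionPart T 1 ↔ T v = -v := by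
  simp [involutionPart, add_eq_zero_iff_eq_neg]

theorem le_sup_involutionPart [CharZero k] (T : V →ₗ[k] V) (hT : ∀ v, T (T v) = v)
    (N : Submodule k V) (hN : ∀ v ∈ N, T v ∈ N) :
    N ≤ (N ⊓ involutionPart T 0) ⊔ (N ⊓ involutionPart T 1) := by
  have h2 : (2 : k) ≠ 0 := two_ne_zero
  intro v hv
  refine Submodule.mem_sup.2 ⟨(2 : k)⁻¹ • (v + T v), ⟨?_, ?_⟩, (2 : k)⁻¹ • (v - T v), ⟨?_, ?_⟩, ?_⟩
  · exact N.smul_mem _ (add_mem hv (hN v hv))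
  · change _ ∈ involutionPart T 0
    rw [mem_involutionPart_zero, map_smul, map_add, hT, add_comm]
  · exact N.smul_mem _ (sub_mem hv (hN v hv))
  · change _ ∈ involutionPart T 1
    rw [mem_involutionPart_one, map_smul, map_sub, hT, ← smul_neg, neg_sub]
  · rw [← smul_add, add_add_sub_cancel, ← two_smul k v, smul_smul, inv_mul_cancel₀ h2, one_smul]

/-- In characteristic zero, a linear involution `T` of `V` is the same as a `ℤ/2`-grading of `V`:
the part of parity `i` is the eigenspace of `T` for the eigenvalue `(-1)^i`. -/
@[reducible] def SuperSpace.ofInvolution [CharZero k] (T : V →ₗ[k] V) (hT : ∀ v, T (T v) = v) :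
    SuperSpace k V where
  par := involutionPart T
  isCompl := by
    have h2 : (2 : k) ≠ 0 := two_ne_zero
    constructor
    · rw [Submodule.disjoint_def]
      intro v h0 h1
      rw [mem_involutionPart_zero] at h0
      rw [mem_involutionPart_one, h0] at h1
      have h : (2 : k) • v = 0 := by
        rw [two_smul]; nth_rewrite 1 [h1]; simp
      exact (smul_eq_zero.1 h).resolve_left h2
    · rw [codisjoint_iff, eq_top_iff]
      simpa using le_sup_involutionPart T hT ⊤ (fun _ _ => trivial)

end Involution

/-! ### Lie superalgebras -/

/-- A Lie superalgebra `L = L₀ ⊕ L₁`. -/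
class LieSuperalgebra (k L : Type*) [Field k] [AddCommGroup L] [Module k L]
    extends SuperSpace k L where
  br : L →ₗ[k] L →ₗ[k] L
  br_mem : ∀ {i j : ZMod 2} {x y : L}, x ∈ par i → y ∈ par j → br x y ∈ par (i + j)
  br_skew : ∀ {i j : ZMod 2} {x y : L}, x ∈ par i → y ∈ par j →
    br x y = -(superSign i j • br y x)
  br_jacobi : ∀ {i j : ZMod 2} {x y : L} (z : L), x ∈ par i → y ∈ par j →
    br x (br y z) = br (br x y) z + superSign i j • br y (br x z)

/-- The bracket of a Lie superalgebra. -/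
abbrev sbr (k : Type*) {L : Type*} [Field k] [AddCommGroup L] [Module k L] [LieSuperalgebra k L]
    (x y : L) : L :=
  LieSuperalgebra.br (k := k) x y

section EvenPart

variable {k L : Type*} [Field k] [CharZero k] [AddCommGroup L] [Module k L] [LieSuperalgebra k L]

/-- The even part of a Lie superalgebra is a Lie algebra. -/
noncomputable instance evenLieRing : LieRing (homog k L 0) where
  bracket x y := ⟨sbr k (x : L) (y : L), by
    simpa using LieSuperalgebra.br_mem (k := k) x.2 y.2⟩
  add_lie x y z := by ext; simp [sbr]
  lie_add x y z := by ext; simp [sbr]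
  lie_self x := by
    ext
    have h := LieSuperalgebra.br_skew (k := k) x.2 x.2
    have h2 : (2 : k) • sbr k (x : L) (x : L) = 0 := by
      rw [two_smul]; nth_rewrite 1 [sbr, h]; simp [superSign, sbr]
    exact (smul_eq_zero.1 h2).resolve_left two_ne_zero
  leibniz_lie x y z := by
    ext
    have h := LieSuperalgebra.br_jacobi (k := k) (z : L) x.2 y.2
    simpa [superSign] using h

noncomputable instance evenLieAlgebra : LieAlgebra k (homog k L 0) where
  lie_smul t x y := by
    ext
    exact map_smul (LieSuperalgebra.br (k := k) (x : L)) t (y : L)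

end EvenPart

/-! ### The Lie superalgebras under consideration -/

section Types

variable (k g : Type*) [Field k] [AddCommGroup g] [Module k g] [LieSuperalgebra k g]

/-- The subspace `W` is stable under the adjoint action of the even part. -/
def EvenStable (W : Submodule k g) : Prop :=
  ∀ x ∈ homog k g 0, ∀ w ∈ W, sbr k x w ∈ W

/-- `W` is an irreducible `g₀`-submodule of the odd part `g₁`. -/
def IrreducibleOdd (W : Submodule k g) : Prop :=
  W ≤ homog k g 1 ∧ EvenStable k g W ∧ W ≠ ⊥ ∧
    ∀ W' : Submodule k g, W' ≤ W → EvenStable k g W' → W' = ⊥ ∨ W' = W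

/-- The representation of `g₀` on `g₁` is irreducible. -/
def OddIsIrreducible : Prop := IrreducibleOdd k g (homog k g 1)

/-- The representation of `g₀` on `g₁` is a direct sum of two irreducible representations. -/
def OddIsSumOfTwo : Prop :=
  ∃ W₁ W₂ : Submodule k g, IrreducibleOdd k g W₁ ∧ IrreducibleOdd k g W₂ ∧
    W₁ ⊓ W₂ = ⊥ ∧ W₁ ⊔ W₂ = homog k g 1

/-- The representation of `g₀` on `g₁` is completely reducible. -/
def OddIsCompletelyReducible : Prop :=
  ∀ W : Submodule k g, W ≤ homog k g 1 → EvenStable k g W →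
    ∃ W' : Submodule k g, W' ≤ homog k g 1 ∧ EvenStable k g W' ∧
      W ⊓ W' = ⊥ ∧ W ⊔ W' = homog k g 1

/-- `W` is a `ℤ/2`-graded subspace. -/
def IsGradedSubspace {V : Type*} [AddCommGroup V] [Module k V] [SuperSpace k V]
    (W : Submodule k V) : Prop :=
  W ≤ (W ⊓ homog k V 0) ⊔ (W ⊓ homog k V 1)

/-- `g` is a simple Lie superalgebra: it is not abelian and has no nontrivial graded ideals. -/
def IsSimpleSuper : Prop :=
  (∃ x y : g, sbr k x y ≠ 0) ∧
    ∀ I : Submodule k g, IsGradedSubspace k I → (∀ x : g, ∀ y ∈ I, sbr k x y ∈ I) → I = ⊥ ∨ I = ⊤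

/-- `g` carries a nondegenerate invariant (even, supersymmetric) bilinear form. -/
def HasInvariantForm : Prop :=
  ∃ B : g →ₗ[k] g →ₗ[k] k,
    (∀ x, (∀ y, B x y = 0) → x = 0) ∧
    (∀ x y z, B (sbr k x y) z = B x (sbr k y z)) ∧
    (∀ x ∈ homog k g 0, ∀ y ∈ homog k g 1, B x y = 0) ∧
    (∀ i j : ZMod 2, ∀ x ∈ homog k g i, ∀ y ∈ homog k g j, B x y = superSign i j • B y x)

/-- Basic classical Lie superalgebras. -/
def IsBasicClassical : Prop :=
  FiniteDimensional k g ∧ IsSimpleSuper k g ∧ OddIsCompletelyReducible k g ∧ HasInvariantForm k g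

/-- `g` is a reductive Lie algebra, considered as a Lie superalgebra with zero odd part. -/
def IsReductiveLie [CharZero k] : Prop :=
  FiniteDimensional k g ∧ homog k g 1 = ⊥ ∧
    LieAlgebra.radical k (homog k g 0) = LieAlgebra.center k (homog k g 0)

/-- `g` is isomorphic to `𝔰𝔩(n,n)`, the Lie superalgebra of `(n|n) × (n|n)` block matrices
`X = (a b; c d)` of supertrace `tr a - tr d = 0`. The even part consists of the block diagonal
matrices, the odd part of the block off-diagonal ones, and the bracket is the supercommutator
`XY - (-1)^{|X||Y|} YX`. -/
def IsSl (n : ℕ) : Prop :=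
  ∃ φ : g →ₗ[k] Matrix (Fin n ⊕ Fin n) (Fin n ⊕ Fin n) k,
    Function.Injective φ ∧
    (∀ X, X ∈ LinearMap.range φ ↔ X.toBlocks₁₁.trace - X.toBlocks₂₂.trace = 0) ∧
    (∀ x, x ∈ homog k g 0 ↔ (φ x).toBlocks₁₂ = 0 ∧ (φ x).toBlocks₂₁ = 0) ∧
    (∀ x, x ∈ homog k g 1 ↔ (φ x).toBlocks₁₁ = 0 ∧ (φ x).toBlocks₂₂ = 0) ∧
    (∀ i j : ZMod 2, ∀ x ∈ homog k g i, ∀ y ∈ homog k g j,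
      φ (sbr k x y) = φ x * φ y - superSign i j • (φ y * φ x))

/-- `g` is a reductive Lie algebra, a basic classical Lie superalgebra, or `𝔰𝔩(n,n)`, `n ≥ 1`. -/
def IsAdmissible [CharZero k] : Prop :=
  IsReductiveLie k g ∨ IsBasicClassical k g ∨ ∃ n : ℕ, 1 ≤ n ∧ IsSl k g n

end Types

/-! ### Triangular decompositions -/

section Triangular

variable {k g : Type*} [Field k] [CharZero k] [AddCommGroup g] [Module k g] [LieSuperalgebra k g]

/-- A distinguished `ℤ`-grading of `g`: a grading compatible with the `ℤ/2`-grading such that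
* if `g` is a Lie algebra, the grading is trivial;
* if the odd part is the sum of two irreducible modules over the even part (type I and `𝔰𝔩(n,n)`),
  then the even part is the part of degree `0` and the odd part is the sum of the parts of
  degree `±1`;
* if the odd part is irreducible over the even part (type II), then the even part is the sum of the
  parts of degree `-2, 0, 2` and the odd part is the sum of the parts of degree `±1`. -/
structure IsDistinguished (gr : ℤ → Submodule k g) : Prop where
  isInternal : DirectSum.IsInternal gr
  br_mem : ∀ i j : ℤ, ∀ x ∈ gr i, ∀ y ∈ gr j, sbr k x y ∈ gr (i + j)
  compatible : ∀ i, IsGradedSubspace k (gr i)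
  shape :
    (homog k g 1 = ⊥ ∧ gr 0 = ⊤) ∨
    (OddIsSumOfTwo k g ∧ gr 0 = homog k g 0 ∧ gr (-1) ⊔ gr 1 = homog k g 1 ∧
      ∀ i : ℤ, 1 < |i| → gr i = ⊥) ∨
    (OddIsIrreducible k g ∧ gr (-2) ⊔ gr 0 ⊔ gr 2 = homog k g 0 ∧
      gr (-1) ⊔ gr 1 = homog k g 1 ∧ ∀ i : ℤ, 2 < |i| → gr i = ⊥)

/-- A subalgebra of the even part, as a subspace of `g`. -/
def cartanSubspace (h : LieSubalgebra k (homog k g 0)) : Submodule k g :=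
  h.toSubmodule.map (homog k g 0).subtype

/-- The subspace `{x ∈ g | [t, x] = α(t) x for all t ∈ h}`. -/
def rootSubspace (h : LieSubalgebra k (homog k g 0)) (α : Module.Dual k h) : Submodule k g where
  carrier := {x | ∀ t : h, sbr k ((t : homog k g 0) : g) x = α t • x}
  add_mem' := by
    intro a b ha hb t
    have h1 := ha t
    have h2 := hb t
    simp only [sbr] at *
    rw [map_add, h1, h2, smul_add]
  zero_mem' := by intro t; simp [sbr]
  smul_mem' := by
    intro c a ha t
    have h1 := ha t
    simp only [sbr] at *
    rw [map_smul, h1, smul_comm]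

/-- The span of the root vectors in `g_d`, `d > 0`, and of those in `g_0` of a root `α` with
`ht α > 0` (for `ε = 1`); the same with `<` for `ε = -1`. -/
def nilSubspace (gr : ℤ → Submodule k g) (h : LieSubalgebra k (homog k g 0))
    (ht : Module.Dual k h →+ ℚ) (ε : ℤ) : Submodule k g :=
  Submodule.span k {x | ∃ (p : ZMod 2) (d : ℤ) (α : Module.Dual k h),
    x ∈ homog k g p ∧ x ∈ gr d ∧ x ∈ rootSubspace h α ∧
      (0 < ε * d ∨ (d = 0 ∧ 0 < ε * ht α))}

variable (k g) in
/-- A triangular decomposition `g = n⁻ ⊕ h ⊕ n⁺`. It is given by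
* a distinguished `ℤ`-grading of `g` (trivial if `g` is a Lie algebra);
* a Cartan subalgebra `h` of the even part, contained in the part of degree `0`;
* a positive system of roots of the degree `0` part, given as the set of the roots on which an
  additive functional `ht` on `h*` is positive (every positive system is of this form; that `ht`
  does not vanish on any root follows from the decomposition).
Then `n⁺` (resp. `n⁻`) is the sum of the parts of positive (resp. negative) degree and the positive
(resp. negative) root spaces of the part of degree `0`. So the Borel subalgebra `h ⊕ n⁺` contains
`h` and all the parts of positive degree. -/
structure TriangularDecomposition where
  gr : ℤ → Submodule k g
  distinguished : IsDistinguished gr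
  h : LieSubalgebra k (homog k g 0)
  isCartan : h.IsCartanSubalgebra
  h_le : cartanSubspace h ≤ gr 0
  ht : Module.Dual k h →+ ℚ
  isCompl : IsCompl (nilSubspace gr h ht (-1)) (cartanSubspace h ⊔ nilSubspace gr h ht 1)
  disjoint : Disjoint (cartanSubspace h) (nilSubspace gr h ht 1)

/-- The subspace `n⁺`. -/
def TriangularDecomposition.nPos (T : TriangularDecomposition k g) : Submodule k g :=
  nilSubspace T.gr T.h T.ht 1

/-- The subspace `n⁻`. -/
def TriangularDecomposition.nNeg (T : TriangularDecomposition k g) : Submodule k g :=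
  nilSubspace T.gr T.h T.ht (-1)

end Triangular

/-! ### Map superalgebras -/

section MapAlgebra

variable {k g A : Type*} [Field k] [AddCommGroup g] [Module k g] [LieSuperalgebra k g]
  [CommRing A] [Algebra k A]

variable (k g A) in
/-- The homogeneous part `(g ⊗ A)_i = g_i ⊗ A`. -/
def mapPart (i : ZMod 2) : Submodule k (g ⊗[k] A) :=
  LinearMap.range (LinearMap.rTensor A (homog k g i).subtype)

theorem tmul_mem_mapPart {i : ZMod 2} {x : g} (hx : x ∈ homog k g i) (a : A) :
    x ⊗ₜ[k] a ∈ mapPart k g A i :=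
  ⟨(⟨x, hx⟩ : homog k g i) ⊗ₜ[k] a, by simp⟩

theorem mapPart_induction {i : ZMod 2} {P : g ⊗[k] A → Prop} (h0 : P 0)
    (hadd : ∀ x y, P x → P y → P (x + y)) (ht : ∀ x ∈ homog k g i, ∀ a : A, P (x ⊗ₜ[k] a))
    {z : g ⊗[k] A} (hz : z ∈ mapPart k g A i) : P z := by
  obtain ⟨w, rfl⟩ := hz
  induction w with
  | zero => simpa using h0
  | tmul x a => simpa using ht x x.2 a
  | add x y hx hy => rw [map_add]; exact hadd _ _ hx hy

variable (k g A) in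
/-- The bracket `[u ⊗ f, v ⊗ f'] = [u, v] ⊗ f f'`. -/
noncomputable def mapBr : g ⊗[k] A →ₗ[k] g ⊗[k] A →ₗ[k] g ⊗[k] A :=
  TensorProduct.map₂ (LieSuperalgebra.br (k := k) (L := g)) (LinearMap.mul k A)

@[simp]
theorem mapBr_tmul (x y : g) (a b : A) :
    mapBr k g A (x ⊗ₜ a) (y ⊗ₜ b) = (sbr k x y) ⊗ₜ (a * b) := by
  simp [mapBr, TensorProduct.map₂]

/-- The map superalgebra `g ⊗ A`. -/
noncomputable instance mapSuperalgebra : LieSuperalgebra k (g ⊗[k] A) where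
  par := mapPart k g A
  isCompl := by
    constructor
    · rw [Submodule.disjoint_def]
      intro v h0 h1
      have e0 : LinearMap.rTensor A (SuperSpace.evenProj k g) v = v :=
        mapPart_induction (P := fun v => LinearMap.rTensor A (SuperSpace.evenProj k g) v = v)
          (by simp) (fun x y hx hy => by rw [map_add, hx, hy])
          (fun x hx a => by simp [SuperSpace.evenProj_even hx]) h0
      have e1 : LinearMap.rTensor A (SuperSpace.evenProj k g) v = 0 :=
        mapPart_induction (P := fun v => LinearMap.rTensor A (SuperSpace.evenProj k g) v = 0)
          (by simp) (fun x y hx hy => by rw [map_add, hx, hy, add_zero])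
          (fun x hx a => by simp [SuperSpace.evenProj_odd hx]) h1
      rw [← e0, e1]
    · rw [codisjoint_iff, eq_top_iff]
      intro v _
      induction v with
      | zero => exact zero_mem _
      | add x y hx hy => exact add_mem (hx trivial) (hy trivial)
      | tmul x a =>
        obtain ⟨b, hb, c, hc, rfl⟩ := SuperSpace.exists_eq_add (k := k) x
        rw [TensorProduct.add_tmul]
        exact Submodule.add_mem_sup (tmul_mem_mapPart hb a) (tmul_mem_mapPart hc a)
  br := mapBr k g A
  br_mem := by
    intro i j x y hx hy
    refine mapPart_induction (P := fun x => mapBr k g A x y ∈ mapPart k g A (i + j))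
      (by simp) (fun a b ha hb => by rw [map_add]; exact add_mem ha hb) (fun u hu a => ?_) hx
    refine mapPart_induction (P := fun y => mapBr k g A (u ⊗ₜ a) y ∈ mapPart k g A (i + j))
      (by simp) (fun a b ha hb => by rw [map_add]; exact add_mem ha hb) (fun v hv b => ?_) hy
    rw [mapBr_tmul]
    exact tmul_mem_mapPart (LieSuperalgebra.br_mem hu hv) _
  br_skew := by
    intro i j x y hx hy
    refine mapPart_induction
      (P := fun x => mapBr k g A x y = -(superSign i j • mapBr k g A y x))
      (by simp) (fun a b ha hb => by simp only [map_add, LinearMap.add_apply, ha, hb]; module)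
      (fun u hu a => ?_) hx
    refine mapPart_induction
      (P := fun y => mapBr k g A (u ⊗ₜ a) y = -(superSign i j • mapBr k g A y (u ⊗ₜ a)))
      (by simp) (fun a b ha hb => by simp only [map_add, LinearMap.add_apply, ha, hb]; module)
      (fun v hv b => ?_) hy
    rw [mapBr_tmul, mapBr_tmul, sbr, LieSuperalgebra.br_skew hu hv, TensorProduct.neg_tmul,
      TensorProduct.smul_tmul', mul_comm]
  br_jacobi := by
    intro i j x y z hx hy
    refine mapPart_induction
      (P := fun x => mapBr k g A x (mapBr k g A y z) =
        mapBr k g A (mapBr k g A x y) z + superSign i j • mapBr k g A y (mapBr k g A x z))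
      (by simp) (fun a b ha hb => by simp only [map_add, LinearMap.add_apply, ha, hb]; module)
      (fun u hu a => ?_) hx
    refine mapPart_induction
      (P := fun y => mapBr k g A (u ⊗ₜ a) (mapBr k g A y z) =
        mapBr k g A (mapBr k g A (u ⊗ₜ a) y) z +
          superSign i j • mapBr k g A y (mapBr k g A (u ⊗ₜ a) z))
      (by simp) (fun a b ha hb => by simp only [map_add, LinearMap.add_apply, ha, hb]; module)
      (fun v hv b => ?_) hy
    induction z with
    | zero => simp
    | add z w hz hw => simp only [map_add, hz, hw]; module
    | tmul w c =>
      simp only [mapBr_tmul, sbr]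
      rw [LieSuperalgebra.br_jacobi w hu hv, TensorProduct.add_tmul, TensorProduct.smul_tmul',
        mul_assoc, mul_left_comm]

theorem parity_tmul (x : g) (a : A) :
    SuperSpace.parity k (g ⊗[k] A) (x ⊗ₜ a) = SuperSpace.parity k g x ⊗ₜ a := by
  obtain ⟨b, hb, c, hc, rfl⟩ := SuperSpace.exists_eq_add (k := k) x
  have h0 : b ⊗ₜ[k] a ∈ homog k (g ⊗[k] A) 0 := tmul_mem_mapPart hb a
  have h1 : c ⊗ₜ[k] a ∈ homog k (g ⊗[k] A) 1 := tmul_mem_mapPart hc a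
  rw [TensorProduct.add_tmul, map_add, map_add, SuperSpace.parity_even hb, SuperSpace.parity_odd hc,
    SuperSpace.parity_even h0, SuperSpace.parity_odd h1, TensorProduct.add_tmul,
    TensorProduct.neg_tmul]

end MapAlgebra

/-! ### Modules over Lie superalgebras -/

universe u v w w' w₁ w₂

/-- A module `V = V₀ ⊕ V₁` over a Lie superalgebra. -/
structure SuperRep (k : Type u) (L : Type v) [Field k] [AddCommGroup L] [Module k L]
    [LieSuperalgebra k L] where
  carrier : Type w
  [addCommGroup : AddCommGroup carrier]
  [module : Module k carrier]
  [superSpace : SuperSpace k carrier]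
  ρ : L →ₗ[k] Module.End k carrier
  ρ_mem : ∀ {i j : ZMod 2} {x : L} {v : carrier},
    x ∈ homog k L i → v ∈ homog k carrier j → ρ x v ∈ homog k carrier (i + j)
  ρ_br : ∀ {i j : ZMod 2} {x y : L} (v : carrier), x ∈ homog k L i → y ∈ homog k L j →
    ρ (sbr k x y) v = ρ x (ρ y v) - superSign i j • ρ y (ρ x v)

attribute [instance] SuperRep.addCommGroup SuperRep.module SuperRep.superSpace

namespace SuperRep

variable {k : Type u} {L : Type v} [Field k] [AddCommGroup L] [Module k L] [LieSuperalgebra k L]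

/-- A subspace stable under the action. -/
def IsStable (V : SuperRep.{u, v, w} k L) (N : Submodule k V.carrier) : Prop :=
  ∀ x : L, ∀ v ∈ N, V.ρ x v ∈ N

/-- A (`ℤ/2`-graded) submodule. -/
def IsSubrep (V : SuperRep.{u, v, w} k L) (N : Submodule k V.carrier) : Prop :=
  V.IsStable N ∧ IsGradedSubspace k N

/-- A module is irreducible if it is nonzero and has no nontrivial submodules. -/
def IsIrreducible (V : SuperRep.{u, v, w} k L) : Prop :=
  Nontrivial V.carrier ∧ ∀ N : Submodule k V.carrier, V.IsSubrep N → N = ⊥ ∨ N = ⊤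

/-- Isomorphism of modules (by a parity preserving map). -/
def Iso (V : SuperRep.{u, v, w} k L) (W : SuperRep.{u, v, w'} k L) : Prop :=
  ∃ e : V.carrier ≃ₗ[k] W.carrier,
    (∀ i : ZMod 2, ∀ v ∈ homog k V.carrier i, e v ∈ homog k W.carrier i) ∧
    ∀ (x : L) (v : V.carrier), e (V.ρ x v) = W.ρ x (e v)

theorem parity_ρ_even (V : SuperRep.{u, v, w} k L) {x : L} (hx : x ∈ homog k L 0)
    (v : V.carrier) :
    SuperSpace.parity k V.carrier (V.ρ x v) = V.ρ x (SuperSpace.parity k V.carrier v) := by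
  obtain ⟨a, ha, b, hb, rfl⟩ := SuperSpace.exists_eq_add (k := k) v
  have h1 := V.ρ_mem hx ha
  have h2 := V.ρ_mem hx hb
  rw [zero_add] at h1 h2
  simp [SuperSpace.parity_even ha, SuperSpace.parity_odd hb, SuperSpace.parity_even h1,
    SuperSpace.parity_odd h2]

theorem parity_ρ_odd (V : SuperRep.{u, v, w} k L) {x : L} (hx : x ∈ homog k L 1)
    (v : V.carrier) :
    SuperSpace.parity k V.carrier (V.ρ x v) = -V.ρ x (SuperSpace.parity k V.carrier v) := by
  obtain ⟨a, ha, b, hb, rfl⟩ := SuperSpace.exists_eq_add (k := k) v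
  have h1 := V.ρ_mem hx ha
  have h2 := V.ρ_mem hx hb
  rw [add_zero] at h1
  rw [show (1 + 1 : ZMod 2) = 0 from rfl] at h2
  simp [SuperSpace.parity_even ha, SuperSpace.parity_odd hb, SuperSpace.parity_even h2,
    SuperSpace.parity_odd h1, add_comm]

/-- The quotient of a module by a submodule. -/
noncomputable def quotient (V : SuperRep.{u, v, w} k L) (N : Submodule k V.carrier)
    (hN : V.IsSubrep N) : SuperRep.{u, v, w} k L where
  carrier := V.carrier ⧸ N
  superSpace :=
    { par := fun i => (homog k V.carrier i).map N.mkQ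
      isCompl := by
        constructor
        · rw [Submodule.disjoint_def]
          rintro _ ⟨a, ha, rfl⟩ ⟨b, hb, hab⟩
          have h : a - b ∈ N := by
            rw [← Submodule.Quotient.mk_eq_zero, Submodule.Quotient.mk_sub, sub_eq_zero]
            exact hab.symm
          obtain ⟨c, ⟨hcN, hc⟩, d, ⟨_, hd⟩, hcd⟩ := Submodule.mem_sup.1 (hN.2 h)
          have e : a = c := by
            have h3 := congrArg (SuperSpace.evenProj k V.carrier) hcd
            simpa [SuperSpace.evenProj_even ha, SuperSpace.evenProj_odd hb,
              SuperSpace.evenProj_even hc, SuperSpace.evenProj_odd hd] using h3.symm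
          rw [Submodule.mkQ_apply, Submodule.Quotient.mk_eq_zero, e]
          exact hcN
        · rw [codisjoint_iff, eq_top_iff, ← Submodule.map_sup,
            (SuperSpace.isCompl (k := k) (V := V.carrier)).sup_eq_top]
          simp }
  ρ :=
    { toFun := fun x => N.mapQ N (V.ρ x) (fun v hv => hN.1 x v hv)
      map_add' := by intro x y; ext v; simp
      map_smul' := by intro c x; ext v; simp }
  ρ_mem := by
    rintro i j x _ hx ⟨v, hv, rfl⟩
    exact ⟨V.ρ x v, V.ρ_mem hx hv, rfl⟩
  ρ_br := by
    intro i j x y v hx hy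
    obtain ⟨v, rfl⟩ := N.mkQ_surjective v
    simp [V.ρ_br v hx hy]

/-- The sum of a family of submodules is a submodule. -/
theorem isSubrep_sSup (V : SuperRep.{u, v, w} k L) (S : Set (Submodule k V.carrier))
    (hS : ∀ N ∈ S, V.IsSubrep N) : V.IsSubrep (sSup S) := by
  constructor
  · intro x v hv
    have h : sSup S ≤ (sSup S).comap (V.ρ x) :=
      sSup_le fun N hN v hv => le_sSup hN ((hS N hN).1 x v hv)
    exact h hv
  · exact sSup_le fun N hN => ((hS N hN).2).trans
      (sup_le_sup (inf_le_inf_right _ (le_sSup hN)) (inf_le_inf_right _ (le_sSup hN)))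

section Tensor

/-- The action on a tensor product: `x (v ⊗ w) = x v ⊗ w + (-1)^{|x||v|} v ⊗ x w`. -/
noncomputable def tensorρ (V : SuperRep.{u, v, w} k L) (W : SuperRep.{u, v, w'} k L) :
    L →ₗ[k] Module.End k (V.carrier ⊗[k] W.carrier) :=
  (TensorProduct.mapBilinear (RingHom.id k) _ _ _ _).flip LinearMap.id ∘ₗ V.ρ +
  TensorProduct.mapBilinear (RingHom.id k) _ _ _ _ LinearMap.id ∘ₗ W.ρ ∘ₗ SuperSpace.evenProj k L +
  TensorProduct.mapBilinear (RingHom.id k) _ _ _ _ (SuperSpace.parity k V.carrier) ∘ₗ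
    W.ρ ∘ₗ SuperSpace.oddProj k L

theorem tensorρ_even (V : SuperRep.{u, v, w} k L) (W : SuperRep.{u, v, w'} k L) {x : L}
    (hx : x ∈ homog k L 0) (a : V.carrier) (b : W.carrier) :
    tensorρ V W x (a ⊗ₜ b) = V.ρ x a ⊗ₜ b + a ⊗ₜ W.ρ x b := by
  simp [tensorρ, SuperSpace.evenProj_even hx, SuperSpace.oddProj_even hx]

theorem tensorρ_odd (V : SuperRep.{u, v, w} k L) (W : SuperRep.{u, v, w'} k L) {x : L}
    (hx : x ∈ homog k L 1) (a : V.carrier) (b : W.carrier) :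
    tensorρ V W x (a ⊗ₜ b) = V.ρ x a ⊗ₜ b + SuperSpace.parity k V.carrier a ⊗ₜ W.ρ x b := by
  simp [tensorρ, SuperSpace.evenProj_odd hx, SuperSpace.oddProj_odd hx]

/-- The tensor product of the parity involutions. -/
noncomputable def tensorParity (V : SuperRep.{u, v, w} k L) (W : SuperRep.{u, v, w'} k L) :
    V.carrier ⊗[k] W.carrier →ₗ[k] V.carrier ⊗[k] W.carrier :=
  TensorProduct.map (SuperSpace.parity k V.carrier) (SuperSpace.parity k W.carrier)

theorem tensorParity_tensorParity (V : SuperRep.{u, v, w} k L) (W : SuperRep.{u, v, w'} k L)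
    (z : V.carrier ⊗[k] W.carrier) : tensorParity V W (tensorParity V W z) = z := by
  induction z with
  | zero => simp
  | add x y hx hy => simp only [map_add, hx, hy]
  | tmul x y => simp [tensorParity, SuperSpace.parity_parity]

theorem tensorParity_even (V : SuperRep.{u, v, w} k L) (W : SuperRep.{u, v, w'} k L) {x : L}
    (hx : x ∈ homog k L 0) (z : V.carrier ⊗[k] W.carrier) :
    tensorParity V W (tensorρ V W x z) = tensorρ V W x (tensorParity V W z) := by
  induction z with
  | zero => simp
  | add x y hx hy => simp only [map_add, hx, hy]
  | tmul a b =>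
    rw [tensorρ_even V W hx, map_add]
    simp only [tensorParity, TensorProduct.map_tmul]
    rw [tensorρ_even V W hx, parity_ρ_even V hx, parity_ρ_even W hx]

theorem tensorParity_odd (V : SuperRep.{u, v, w} k L) (W : SuperRep.{u, v, w'} k L) {x : L}
    (hx : x ∈ homog k L 1) (z : V.carrier ⊗[k] W.carrier) :
    tensorParity V W (tensorρ V W x z) = -tensorρ V W x (tensorParity V W z) := by
  induction z with
  | zero => simp
  | add x y hx hy => simp only [map_add, hx, hy, neg_add]
  | tmul a b =>
    rw [tensorρ_odd V W hx, map_add]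
    simp only [tensorParity, TensorProduct.map_tmul]
    rw [tensorρ_odd V W hx, parity_ρ_odd V hx, parity_ρ_odd W hx, TensorProduct.neg_tmul,
      TensorProduct.tmul_neg, neg_add]

theorem zmod2_cases (i : ZMod 2) : i = 0 ∨ i = 1 := by
  fin_cases i
  · exact Or.inl rfl
  · exact Or.inr rfl

/-- The tensor product `V ⊗ W`. It is graded by total parity: the part of parity `i` is the
eigenspace of the tensor product of the parity involutions for the eigenvalue `(-1)^i`. -/
noncomputable def tensor [CharZero k] (V : SuperRep.{u, v, w} k L) (W : SuperRep.{u, v, w'} k L) :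
    SuperRep.{u, v, max w w'} k L where
  carrier := V.carrier ⊗[k] W.carrier
  superSpace := SuperSpace.ofInvolution (tensorParity V W) (tensorParity_tensorParity V W)
  ρ := tensorρ V W
  ρ_mem := by
    intro i j x z hx hz
    change z ∈ involutionPart (tensorParity V W) j at hz
    change tensorρ V W x z ∈ involutionPart (tensorParity V W) (i + j)
    rcases zmod2_cases i with rfl | rfl <;> rcases zmod2_cases j with rfl | rfl
    · rw [mem_involutionPart_zero] at hz
      rw [add_zero, mem_involutionPart_zero, tensorParity_even V W hx, hz]
    · rw [mem_involutionPart_one] at hz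
      rw [zero_add, mem_involutionPart_one, tensorParity_even V W hx, hz, map_neg]
    · rw [mem_involutionPart_zero] at hz
      rw [add_zero, mem_involutionPart_one, tensorParity_odd V W hx, hz]
    · rw [mem_involutionPart_one] at hz
      rw [show (1 + 1 : ZMod 2) = 0 from rfl, mem_involutionPart_zero, tensorParity_odd V W hx, hz,
        map_neg, neg_neg]
  ρ_br := by
    intro i j x y z hx hy
    have hxy := LieSuperalgebra.br_mem (k := k) hx hy
    induction z with
    | zero => simp
    | add a b ha hb => simp only [map_add, ha, hb]; module
    | tmul a b =>
      rcases zmod2_cases i with rfl | rfl <;> rcases zmod2_cases j with rfl | rfl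
      · rw [add_zero] at hxy
        rw [tensorρ_even V W hxy, tensorρ_even V W hy, tensorρ_even V W hx, map_add, map_add]
        simp only [tensorρ_even V W hx, tensorρ_even V W hy, V.ρ_br a hx hy, W.ρ_br b hx hy,
          TensorProduct.sub_tmul, TensorProduct.tmul_sub, superSign]
        simp
        abel
      · rw [zero_add] at hxy
        rw [tensorρ_odd V W hxy, tensorρ_odd V W hy, tensorρ_even V W hx, map_add, map_add]
        simp only [tensorρ_even V W hx, tensorρ_odd V W hy, V.ρ_br a hx hy, W.ρ_br b hx hy,
          TensorProduct.sub_tmul, TensorProduct.tmul_sub, superSign, parity_ρ_even V hx]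
        simp
        abel
      · rw [add_zero] at hxy
        rw [tensorρ_odd V W hxy, tensorρ_even V W hy, tensorρ_odd V W hx, map_add, map_add]
        simp only [tensorρ_odd V W hx, tensorρ_even V W hy, V.ρ_br a hx hy, W.ρ_br b hx hy,
          TensorProduct.sub_tmul, TensorProduct.tmul_sub, superSign, parity_ρ_even V hy]
        simp
        abel
      · rw [show (1 + 1 : ZMod 2) = 0 from rfl] at hxy
        rw [tensorρ_even V W hxy, tensorρ_odd V W hy, tensorρ_odd V W hx, map_add, map_add]
        simp only [tensorρ_odd V W hx, tensorρ_odd V W hy, V.ρ_br a hx hy, W.ρ_br b hx hy,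
          superSign, parity_ρ_odd V hx, parity_ρ_odd V hy, SuperSpace.parity_parity]
        simp [TensorProduct.add_tmul, TensorProduct.tmul_add, TensorProduct.neg_tmul]
        abel

/-- The tensor product `V 0 ⊗ ⋯ ⊗ V n`, formed as `((V 0 ⊗ V 1) ⊗ ⋯) ⊗ V n`. -/
noncomputable def tensorFamily [CharZero k] :
    (n : ℕ) → (Fin (n + 1) → SuperRep.{u, v, w} k L) → SuperRep.{u, v, w} k L
  | 0, V => V 0
  | n + 1, V => (tensorFamily n fun i => V i.castSucc).tensor (V (Fin.last (n + 1)))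

end Tensor

end SuperRep

/-! ### The universal enveloping superalgebra -/

section Enveloping

/-- The relations `x y = (-1)^{|x||y|} y x + [x, y]` of the universal enveloping superalgebra. -/
inductive SuperEnvRel (k : Type u) (L : Type v) [Field k] [AddCommGroup L] [Module k L]
    [LieSuperalgebra k L] : TensorAlgebra k L → TensorAlgebra k L → Prop
  | rel (i j : ZMod 2) (x y : L) (hx : x ∈ homog k L i) (hy : y ∈ homog k L j) :
      SuperEnvRel k L (TensorAlgebra.ι k x * TensorAlgebra.ι k y)
        (superSign i j • (TensorAlgebra.ι k y * TensorAlgebra.ι k x) +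
          TensorAlgebra.ι k (sbr k x y))

/-- The universal enveloping superalgebra `U(L)`: the quotient of the tensor algebra by the ideal
generated by the relations above. -/
def SuperEnv (k : Type u) (L : Type v) [Field k] [AddCommGroup L] [Module k L]
    [LieSuperalgebra k L] : Type (max u v) :=
  (ringConGen (SuperEnvRel k L)).Quotient

namespace SuperEnv

noncomputable instance instRing (k : Type u) (L : Type v) [Field k] [AddCommGroup L] [Module k L]
    [LieSuperalgebra k L] : Ring (SuperEnv k L) :=
  inferInstanceAs (Ring (ringConGen (SuperEnvRel k L)).Quotient)

noncomputable instance instAlgebra (k : Type u) (L : Type v) [Field k] [AddCommGroup L]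
    [Module k L] [LieSuperalgebra k L] : Algebra k (SuperEnv k L) :=
  inferInstanceAs (Algebra k (ringConGen (SuperEnvRel k L)).Quotient)

/-- The quotient map from the tensor algebra. -/
noncomputable def mk (k : Type u) (L : Type v) [Field k] [AddCommGroup L] [Module k L]
    [LieSuperalgebra k L] : TensorAlgebra k L →ₐ[k] SuperEnv k L :=
  RingCon.mkₐ k _

variable (k : Type u) {L : Type v} [Field k] [AddCommGroup L] [Module k L] [LieSuperalgebra k L]

/-- The canonical map `L → U(L)`. -/
noncomputable def ι : L →ₗ[k] SuperEnv k L :=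
  (mk k L).toLinearMap ∘ₗ TensorAlgebra.ι k

theorem ι_rel {i j : ZMod 2} {x y : L} (hx : x ∈ homog k L i) (hy : y ∈ homog k L j) :
    ι k x * ι k y = superSign i j • (ι k y * ι k x) + ι k (sbr k x y) := by
  have h : mk k L _ = mk k L _ :=
    Quotient.sound (RingCon.le_ringConGen _ _ (SuperEnvRel.rel i j x y hx hy))
  rw [map_mul, map_add, map_zsmul, map_mul] at h
  exact h

theorem hom_ext {B : Type*} [Semiring B] [Algebra k B] {f f' : SuperEnv k L →ₐ[k] B}
    (h : ∀ x, f (ι k x) = f' (ι k x)) : f = f' := by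
  apply RingCon.Quotient.hom_extₐ
  apply TensorAlgebra.hom_ext
  ext x
  exact h x

/-- The involution of `U(L)` induced by the parity involution of `L`. -/
noncomputable def parity : SuperEnv k L →ₐ[k] SuperEnv k L :=
  RingCon.liftₐ _ (TensorAlgebra.lift k (ι k ∘ₗ SuperSpace.parity k L)) <| by
      grw [RingCon.ringConGen_le]
      rintro _ _ ⟨i, j, x, y, hx, hy⟩
      have hxy := LieSuperalgebra.br_mem (k := k) hx hy
      change TensorAlgebra.lift k (ι k ∘ₗ SuperSpace.parity k L) _ =
        TensorAlgebra.lift k (ι k ∘ₗ SuperSpace.parity k L) _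
      rw [map_mul, map_add, map_zsmul, map_mul]
      simp only [TensorAlgebra.lift_ι_apply, LinearMap.comp_apply]
      change ι k _ * ι k _ = superSign i j • (ι k _ * ι k _) + ι k _
      rcases SuperRep.zmod2_cases i with rfl | rfl <;>
        rcases SuperRep.zmod2_cases j with rfl | rfl
      · rw [add_zero] at hxy
        rw [SuperSpace.parity_even hx, SuperSpace.parity_even hy, SuperSpace.parity_even hxy]
        exact ι_rel k hx hy
      · rw [zero_add] at hxy
        rw [SuperSpace.parity_even hx, SuperSpace.parity_odd hy, SuperSpace.parity_odd hxy,
          map_neg, map_neg, mul_neg, neg_mul, ι_rel k hx hy, smul_neg, neg_add]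
      · rw [add_zero] at hxy
        rw [SuperSpace.parity_odd hx, SuperSpace.parity_even hy, SuperSpace.parity_odd hxy,
          map_neg, map_neg, mul_neg, neg_mul, ι_rel k hx hy, smul_neg, neg_add]
      · rw [show (1 + 1 : ZMod 2) = 0 from rfl] at hxy
        rw [SuperSpace.parity_odd hx, SuperSpace.parity_odd hy, SuperSpace.parity_even hxy,
          map_neg, map_neg, neg_mul_neg, neg_mul_neg, ι_rel k hx hy]

theorem parity_ι (x : L) : parity k (ι k x) = ι k (SuperSpace.parity k L x) := by
  have h : parity k (mk k L (TensorAlgebra.ι k x)) =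
      TensorAlgebra.lift k (ι k ∘ₗ SuperSpace.parity k L) (TensorAlgebra.ι k x) :=
    rfl
  rwa [TensorAlgebra.lift_ι_apply] at h

theorem parity_parity (z : SuperEnv k L) : parity k (parity k z) = z := by
  have h : (parity k).comp (parity k) = AlgHom.id k (SuperEnv k L) := by
    apply hom_ext
    intro x
    simp [parity_ι, SuperSpace.parity_parity]
  exact DFunLike.congr_fun h z

variable [CharZero k]

variable (L) in
/-- The left regular module `U(L)`; the part of parity `i` is the `(-1)^i`-eigenspace of the
parity involution, i.e. the span of the products of homogeneous elements of `L` of total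
parity `i`. -/
noncomputable def regular : SuperRep.{u, v, max u v} k L where
  carrier := SuperEnv k L
  superSpace := SuperSpace.ofInvolution (parity k).toLinearMap (parity_parity k)
  ρ := LinearMap.mul k (SuperEnv k L) ∘ₗ ι k
  ρ_mem := by
    intro i j x z hx hz
    change z ∈ involutionPart (parity k).toLinearMap j at hz
    change ι k x * z ∈ involutionPart (parity k).toLinearMap (i + j)
    rcases SuperRep.zmod2_cases i with rfl | rfl <;> rcases SuperRep.zmod2_cases j with rfl | rfl
    · rw [mem_involutionPart_zero, AlgHom.toLinearMap_apply] at hz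
      rw [add_zero, mem_involutionPart_zero, AlgHom.toLinearMap_apply, map_mul, parity_ι,
        SuperSpace.parity_even hx, hz]
    · rw [mem_involutionPart_one, AlgHom.toLinearMap_apply] at hz
      rw [zero_add, mem_involutionPart_one, AlgHom.toLinearMap_apply, map_mul, parity_ι,
        SuperSpace.parity_even hx, hz, mul_neg]
    · rw [mem_involutionPart_zero, AlgHom.toLinearMap_apply] at hz
      rw [add_zero, mem_involutionPart_one, AlgHom.toLinearMap_apply, map_mul, parity_ι,
        SuperSpace.parity_odd hx, hz, map_neg, neg_mul]
    · rw [mem_involutionPart_one, AlgHom.toLinearMap_apply] at hz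
      rw [show (1 + 1 : ZMod 2) = 0 from rfl, mem_involutionPart_zero, AlgHom.toLinearMap_apply,
        map_mul, parity_ι, SuperSpace.parity_odd hx, hz, map_neg, neg_mul_neg]
  ρ_br := by
    intro i j x y z hx hy
    change ι k (sbr k x y) * z = ι k x * (ι k y * z) - superSign i j • (ι k y * (ι k x * z))
    rw [← mul_assoc, ι_rel k hx hy, add_mul, smul_mul_assoc, mul_assoc]
    abel

/-- A left ideal of `U(L)` generated by a set which is stable under the parity involution is a
submodule of the left regular module. -/
theorem isSubrep_span (S : Set (SuperEnv k L))
    (hS : ∀ s ∈ S, parity k s ∈ Submodule.span (SuperEnv k L) S) :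
    (regular k L).IsSubrep ((Submodule.span (SuperEnv k L) S).restrictScalars k) := by
  constructor
  · intro x z hz
    exact Submodule.smul_mem (Submodule.span (SuperEnv k L) S) (ι k x) hz
  · have hpar : ∀ z ∈ Submodule.span (SuperEnv k L) S,
        parity k z ∈ Submodule.span (SuperEnv k L) S := by
      intro z hz
      induction hz using Submodule.span_induction with
      | mem x hx => exact hS x hx
      | zero => simp
      | add x y _ _ hx hy => rw [map_add]; exact add_mem hx hy
      | smul a x _ hx =>
        rw [smul_eq_mul, map_mul]; exact Submodule.smul_mem _ _ hx
    exact le_sup_involutionPart (parity k).toLinearMap (parity_parity k)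
      ((Submodule.span (SuperEnv k L) S).restrictScalars k) hpar

end SuperEnv

end Enveloping

/-! ### Highest weight modules over map superalgebras -/

section HighestWeight

variable {k : Type u} {g : Type v} {A : Type w} [Field k] [CharZero k] [AddCommGroup g]
  [Module k g] [LieSuperalgebra k g] [CommRing A] [Algebra k A]

/-- The ideal `Ann_A V`: the sum of all ideals `I` of `A` such that `(g ⊗ I) V = 0`. -/
def annIdeal (V : SuperRep.{u, max v w, w'} k (g ⊗[k] A)) : Ideal A :=
  sSup {I | ∀ x : g, ∀ f ∈ I, V.ρ (x ⊗ₜ f) = 0}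

/-- The support of `V`: the set of the maximal ideals of `A` containing `Ann_A V`. -/
def support (V : SuperRep.{u, max v w, w'} k (g ⊗[k] A)) : Set (MaximalSpectrum A) :=
  {m | annIdeal V ≤ m.asIdeal}

namespace TriangularDecomposition

variable (T : TriangularDecomposition k g)

variable (A) in
/-- The inclusion `h ⊗ A → g ⊗ A`. -/
noncomputable def inclCartan : T.h ⊗[k] A →ₗ[k] g ⊗[k] A :=
  LinearMap.rTensor A ((homog k g 0).subtype ∘ₗ T.h.toSubmodule.subtype)

/-- `v` is a highest weight vector of `V`: it is nonzero, `(n⁺ ⊗ A) v = 0`, `h ⊗ A` acts on `v` by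
scalars (so that `U(h ⊗ A) v = k v`), and `U(g ⊗ A) v = V`. -/
def IsHighestWeightVector (V : SuperRep.{u, max v w, w'} k (g ⊗[k] A)) (v : V.carrier) : Prop :=
  v ≠ 0 ∧
    (∀ x ∈ T.nPos, ∀ a : A, V.ρ (x ⊗ₜ a) v = 0) ∧
    (∀ t : T.h ⊗[k] A, ∃ c : k, V.ρ (T.inclCartan A t) v = c • v) ∧
    ∀ N : Submodule k V.carrier, V.IsStable N → v ∈ N → N = ⊤

/-- `V` is a highest weight module. -/
def IsHighestWeight (V : SuperRep.{u, max v w, w'} k (g ⊗[k] A)) : Prop :=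
  ∃ v, T.IsHighestWeightVector V v

/-- The elements `x - χ(x)`, where `x` runs through `n⁺ ⊗ A` and `h ⊗ A` and `χ` is the character
of the Borel subalgebra which is `0` on `n⁺ ⊗ A` and `ψ` on `h ⊗ A`. -/
def vermaRelations (ψ : Module.Dual k (T.h ⊗[k] A)) : Set (SuperEnv k (g ⊗[k] A)) :=
  {z | ∃ x ∈ T.nPos, ∃ a : A, z = SuperEnv.ι k (x ⊗ₜ[k] a)} ∪
    {z | ∃ t : T.h ⊗[k] A,
      z = SuperEnv.ι k (T.inclCartan A t) - algebraMap k (SuperEnv k (g ⊗[k] A)) (ψ t)}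

theorem parity_nPos {x : g} (hx : x ∈ T.nPos) : SuperSpace.parity k g x ∈ T.nPos := by
  have h : T.nPos ≤ T.nPos.comap (SuperSpace.parity k g) := by
    refine Submodule.span_le.2 ?_
    rintro x ⟨p, d, α, hp, hx⟩
    have hmem : x ∈ T.nPos := Submodule.subset_span ⟨p, d, α, hp, hx⟩
    change SuperSpace.parity k g x ∈ T.nPos
    rcases SuperRep.zmod2_cases p with rfl | rfl
    · rwa [SuperSpace.parity_even hp]
    · rw [SuperSpace.parity_odd hp]; exact neg_mem hmem
  exact h hx

theorem parity_inclCartan (t : T.h ⊗[k] A) :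
    SuperSpace.parity k (g ⊗[k] A) (T.inclCartan A t) = T.inclCartan A t := by
  induction t with
  | zero => simp
  | add x y hx hy => rw [map_add, map_add, hx, hy]
  | tmul x a =>
    simp only [inclCartan, LinearMap.rTensor_tmul]
    rw [parity_tmul]
    congr 1
    exact SuperSpace.parity_even (x : homog k g 0).2

theorem isSubrep_verma (ψ : Module.Dual k (T.h ⊗[k] A)) :
    (SuperEnv.regular k (g ⊗[k] A)).IsSubrep
      ((Submodule.span (SuperEnv k (g ⊗[k] A)) (T.vermaRelations ψ)).restrictScalars k) := by
  refine SuperEnv.isSubrep_span k _ fun s hs => Submodule.subset_span ?_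
  rcases hs with ⟨x, hx, a, rfl⟩ | ⟨t, rfl⟩
  · rw [SuperEnv.parity_ι, parity_tmul]
    exact Or.inl ⟨_, T.parity_nPos hx, a, rfl⟩
  · rw [map_sub, SuperEnv.parity_ι, parity_inclCartan, AlgHom.commutes]
    exact Or.inr ⟨t, rfl⟩

/-- The induced module `U(g ⊗ A) ⊗_{U(b⁺ ⊗ A)} k_ψ`, realized as the quotient of `U(g ⊗ A)` by the
left ideal generated by the elements `x - χ(x)`, `x ∈ b⁺ ⊗ A`, where `b⁺ = h ⊕ n⁺` and `χ` is the
character by which `b⁺ ⊗ A` acts on `k_ψ`. -/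
noncomputable def verma (ψ : Module.Dual k (T.h ⊗[k] A)) :
    SuperRep.{u, max v w, max u v w} k (g ⊗[k] A) :=
  (SuperEnv.regular k (g ⊗[k] A)).quotient _ (T.isSubrep_verma ψ)

/-- The maximal submodule `N(ψ)` of the induced module: the sum of all its proper submodules. -/
noncomputable def maxSubrep (ψ : Module.Dual k (T.h ⊗[k] A)) :
    Submodule k (T.verma ψ).carrier :=
  sSup {N | (T.verma ψ).IsSubrep N ∧ N ≠ ⊤}

/-- The irreducible highest weight module `V(ψ)`. -/
noncomputable def irr (ψ : Module.Dual k (T.h ⊗[k] A)) :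
    SuperRep.{u, max v w, max u v w} k (g ⊗[k] A) :=
  (T.verma ψ).quotient (T.maxSubrep ψ) ((T.verma ψ).isSubrep_sSup _ fun _ h => h.1)

end TriangularDecomposition

end HighestWeight

/-! ### Elementary rules for the bracket of a Lie superalgebra. -/

section Bracket

variable {k L : Type*} [Field k] [AddCommGroup L] [Module k L] [LieSuperalgebra k L]

/-! A highest weight vector `v` generates its module under words in negative root vectors. So the
module is `k v`, plus the images of `v` under the span `negZero` of the words of weight zero, plus
the other weight spaces. If all words of weight zero vanished, the highest weight space would be a
line and the classical arguments would apply. They need not vanish: the roots `δᵢ - εᵢ` add up to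
zero on the Cartan subalgebra of `𝔰𝔩(n,n)`. What survives, and carries the proof, is that every `w`
in `negZero` is nilpotent, so that `c + w` is invertible for `c ≠ 0`. Consequently one proper
subspace contains all proper stable subspaces (`HWData.le_properBound`,
`HWData.not_mem_properBound`); a module which is irreducible in the graded sense has no ungraded
stable subspaces either (`SuperRep.IsIrreducible.eq_bot_or_eq_top_of_stable`); and its commutant is
`k`, whatever its dimension (`HWData.end_eq_smul`).

Nilpotency comes from a dichotomy (`TriangularDecomposition.isInner_or_isTypeI`). If the `ℤ`-degree
is given by an element of `h`, then weight zero forces degree zero, and a negative word cannot have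
both. This covers type II, where `g₀` is semisimple and the degree derivation is inner. Otherwise
the grading is of type I, and a word of weight zero contains a factor from `g₋₁ ⊗ A`. These factors
anticommute and have square zero, but `A` may be infinite dimensional. One therefore measures their
`A`-components by the powers of a finite dimensional subspace `F` containing `1`. The power `w ^ N`
is a combination of products containing `N` odd factors of total degree `O(N)`. At least a fixed
proportion of these factors lies in one finite dimensional space, and for large `N` they are
linearly dependent, so the product vanishes (`fermi_eq_bot`, `isNilpotent_of_lowers`).

For (a), disjoint supports give `i + j = 1` with `g ⊗ A i` acting by zero on `V` and `g ⊗ A j` by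
zero on `W`. Hence the operators of either factor alone are available on `V ⊗ W`. Jacobson density,
with scalar commutant, finds `V ⊗ f` inside any nonzero stable subspace, and the irreducibility of
`W` does the rest (`tensor_eq_bot_or_eq_top`).

For (b), `V(ψ)` is characterised as the irreducible module with an even highest weight vector of
weight `ψ` (`IsIrreducibleHW.iso`), and weights add under tensor products. It must be known that the
generator of the induced module is nonzero. This needs `ψ` to be a character, hence `h` abelian
(`TriangularDecomposition.cartan_abelian`), and an explicit action of `g ⊗ A` on the enveloping
superalgebra of `n⁻ ⊗ A`, which takes the place of the Poincaré–Birkhoff–Witt theorem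
(`exists_singular_vector`). -/

theorem sbr_add (x y z : L) : sbr k x (y + z) = sbr k x y + sbr k x z := map_add _ _ _

theorem add_sbr (x y z : L) : sbr k (x + y) z = sbr k x z + sbr k y z :=
  LinearMap.map_add₂ _ _ _ _

theorem sbr_smul (c : k) (x y : L) : sbr k x (c • y) = c • sbr k x y := map_smul _ _ _

theorem smul_sbr (c : k) (x y : L) : sbr k (c • x) y = c • sbr k x y :=
  LinearMap.map_smul₂ _ _ _ _

theorem sbr_zero (x : L) : sbr k x 0 = 0 := map_zero _

theorem zero_sbr (x : L) : sbr k 0 x = 0 := LinearMap.map_zero₂ _ _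

theorem sbr_sub (x y z : L) : sbr k x (y - z) = sbr k x y - sbr k x z := map_sub _ _ _

theorem sub_sbr (x y z : L) : sbr k (x - y) z = sbr k x z - sbr k y z :=
  LinearMap.map_sub₂ _ _ _ _

theorem sbr_even_right (x : L) {y : L} (hy : y ∈ homog k L 0) : sbr k x y = -sbr k y x := by
  obtain ⟨a, ha, b, hb, rfl⟩ := SuperSpace.exists_eq_add (k := k) x
  rw [add_sbr, sbr_add, sbr, LieSuperalgebra.br_skew ha hy, sbr, LieSuperalgebra.br_skew hb hy,
    neg_add]
  simp [superSign]

end Bracket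

/-! ### Homomorphisms from a Lie superalgebra to an associative algebra -/

section SuperHom

variable {k L R : Type*} [Field k] [AddCommGroup L] [Module k L] [LieSuperalgebra k L]
  [Ring R] [Algebra k R]

/-- A linear map from a Lie superalgebra to an associative algebra which satisfies the defining
relations of the enveloping superalgebra. -/
def IsSuperHom (ρ : L →ₗ[k] R) : Prop :=
  ∀ ⦃i j : ZMod 2⦄ ⦃x y : L⦄, x ∈ homog k L i → y ∈ homog k L j →
    ρ x * ρ y = superSign i j • (ρ y * ρ x) + ρ (sbr k x y)

theorem SuperRep.isSuperHom {k : Type u} {L : Type v} [Field k] [AddCommGroup L] [Module k L]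
    [LieSuperalgebra k L] (V : SuperRep.{u, v, w} k L) : IsSuperHom V.ρ := by
  intro i j x y hx hy
  ext m
  simp [V.ρ_br m hx hy]

/-- The universal property of the enveloping superalgebra. -/
noncomputable def SuperEnv.lift {k : Type u} {L : Type v} {R : Type w} [Field k] [AddCommGroup L]
    [Module k L] [LieSuperalgebra k L] [Ring R] [Algebra k R] (ρ : L →ₗ[k] R) (h : IsSuperHom ρ) :
    SuperEnv k L →ₐ[k] R :=
  RingCon.liftₐ _ (TensorAlgebra.lift k ρ) <| by
    grw [RingCon.ringConGen_le]
    rintro _ _ ⟨i, j, x, y, hx, hy⟩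
    change TensorAlgebra.lift k ρ _ = TensorAlgebra.lift k ρ _
    rw [map_mul, map_add, map_zsmul, map_mul]
    simp only [TensorAlgebra.lift_ι_apply]
    exact h hx hy

theorem SuperEnv.lift_ι {k : Type u} {L : Type v} {R : Type w} [Field k] [AddCommGroup L]
    [Module k L] [LieSuperalgebra k L] [Ring R] [Algebra k R] (ρ : L →ₗ[k] R) (h : IsSuperHom ρ)
    (x : L) : SuperEnv.lift ρ h (SuperEnv.ι k x) = ρ x := by
  have h' : SuperEnv.lift ρ h (mk k L (TensorAlgebra.ι k x)) =
      TensorAlgebra.lift k ρ (TensorAlgebra.ι k x) := rfl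
  rwa [TensorAlgebra.lift_ι_apply] at h'

end SuperHom

/-! ### Negative monomials -/

section Letters

variable {k g A : Type*} [Field k] [CharZero k] [AddCommGroup g] [Module k g] [LieSuperalgebra k g]
  [CommRing A] [Algebra k A] (T : TriangularDecomposition k g)

/-- `x` is a homogeneous root vector of degree `d` and of weight `α`. -/
structure TriangularDecomposition.IsRootVector (p : ZMod 2) (d : ℤ) (α : Module.Dual k T.h)
    (x : g) : Prop where
  mem_homog : x ∈ homog k g p
  degree : x ∈ T.gr d
  weight : x ∈ rootSubspace T.h α

/-- The pair of a degree and a weight is negative. -/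
def TriangularDecomposition.IsNegative (d : ℤ) (α : Module.Dual k T.h) : Prop :=
  d < 0 ∨ (d = 0 ∧ T.ht α < 0)

variable {T}

theorem TriangularDecomposition.IsNegative.add {d e : ℤ} {α β : Module.Dual k T.h}
    (h : T.IsNegative d α) (h' : T.IsNegative e β) : T.IsNegative (d + e) (α + β) := by
  rcases h with h | ⟨rfl, h⟩ <;> rcases h' with h' | ⟨rfl, h'⟩
  · left; omega
  · left; omega
  · left; omega
  · right; rw [map_add]; exact ⟨rfl, by linarith⟩

theorem TriangularDecomposition.nNeg_induction {P : g → Prop} (h0 : P 0)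
    (hadd : ∀ x y, P x → P y → P (x + y))
    (hs : ∀ (c : k) (x : g), P x → P (c • x))
    (hroot : ∀ p d α x, T.IsRootVector p d α x → T.IsNegative d α → P x) {x : g}
    (hx : x ∈ T.nNeg) : P x := by
  induction hx using Submodule.span_induction with
  | mem x hx =>
    obtain ⟨p, d, α, h1, h2, h3, h4⟩ := hx
    refine hroot p d α x ⟨h1, h2, h3⟩ ?_
    rcases h4 with h4 | ⟨h4, h5⟩
    · left; linarith
    · right; exact ⟨h4, by push_cast at h5; linarith⟩
  | zero => exact h0
  | add x y _ _ hx hy => exact hadd x y hx hy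
  | smul c x _ hx => exact hs c x hx

variable (T)

variable {R : Type*} [Ring R] [Algebra k R] (ρ : g ⊗[k] A →ₗ[k] R)

/-- Nonempty products of images of negative root vectors, with their total degree and weight. -/
inductive NegMono : R → ℤ → Module.Dual k T.h → Prop
  | single {p : ZMod 2} {d : ℤ} {α : Module.Dual k T.h} {x : g} (a : A)
      (hx : T.IsRootVector p d α x) (hn : T.IsNegative d α) : NegMono (ρ (x ⊗ₜ a)) d α
  | cons {p : ZMod 2} {d : ℤ} {α : Module.Dual k T.h} {x : g} (a : A)
      (hx : T.IsRootVector p d α x) (hn : T.IsNegative d α) {w : R} {e : ℤ}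
      {β : Module.Dual k T.h} (hw : NegMono w e β) : NegMono (ρ (x ⊗ₜ a) * w) (d + e) (α + β)

/-- The span of the negative monomials of weight zero. -/
def negZero : Submodule k R :=
  Submodule.span k {w | ∃ d, NegMono T ρ w d 0}

end Letters

/-! ### Highest weight vectors -/

section HW

variable {k g A : Type*} [Field k] [CharZero k] [AddCommGroup g] [Module k g] [LieSuperalgebra k g]
  [CommRing A] [Algebra k A] (T : TriangularDecomposition k g)
  {E : Type*} [AddCommGroup E] [Module k E]

/-- A subspace stable under a linear family of operators. -/
def StableUnder {L : Type*} [AddCommGroup L] [Module k L] (ρ : L →ₗ[k] Module.End k E)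
    (N : Submodule k E) : Prop :=
  ∀ x, ∀ m ∈ N, ρ x m ∈ N

/-- `v` is a generator killed by `n⁺ ⊗ A` on which `h ⊗ A` acts by `ψ`. -/
structure HWData (ρ : g ⊗[k] A →ₗ[k] Module.End k E) (v : E) (ψ : Module.Dual k (T.h ⊗[k] A)) :
    Prop where
  super : IsSuperHom ρ
  pos : ∀ x ∈ T.nPos, ∀ a : A, ρ (x ⊗ₜ a) v = 0
  cartan : ∀ t : T.h ⊗[k] A, ρ (T.inclCartan A t) v = ψ t • v
  gen : ∀ N : Submodule k E, StableUnder ρ N → v ∈ N → N = ⊤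

/-- The operator of an element of the Cartan subalgebra. -/
noncomputable def cartanOp (ρ : g ⊗[k] A →ₗ[k] Module.End k E) (t : T.h) : Module.End k E :=
  ρ (((t : homog k g 0) : g) ⊗ₜ 1)

/-- The weight spaces of a representation. -/
noncomputable def wtSpace (ρ : g ⊗[k] A →ₗ[k] Module.End k E) (μ : Module.Dual k T.h) : Submodule k E :=
  ⨅ t : T.h, LinearMap.ker (cartanOp T ρ t - μ t • LinearMap.id)

variable {T} {ρ : g ⊗[k] A →ₗ[k] Module.End k E} {v : E} {ψ : Module.Dual k (T.h ⊗[k] A)}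

theorem mem_wtSpace {μ : Module.Dual k T.h} {m : E} :
    m ∈ wtSpace T ρ μ ↔ ∀ t, cartanOp T ρ t m = μ t • m := by
  simp [wtSpace, sub_eq_zero]

theorem cartanOp_mul (hρ : IsSuperHom ρ) {p : ZMod 2} {d : ℤ} {α : Module.Dual k T.h} {x : g}
    (hx : T.IsRootVector p d α x) (a : A) (t : T.h) :
    cartanOp T ρ t * ρ (x ⊗ₜ a) = ρ (x ⊗ₜ a) * cartanOp T ρ t + α t • ρ (x ⊗ₜ a) := by
  have h := hρ (tmul_mem_mapPart (t : homog k g 0).2 (1 : A)) (tmul_mem_mapPart hx.mem_homog a)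
  have h2 : sbr k ((((t : homog k g 0) : g)) ⊗ₜ[k] (1 : A)) (x ⊗ₜ[k] a) =
      α t • (x ⊗ₜ[k] a) := by
    change mapBr k g A _ _ = _
    rw [mapBr_tmul, hx.weight t, one_mul, TensorProduct.smul_tmul']
  rw [h2, map_smul] at h
  simpa [superSign, cartanOp] using h

theorem NegMono.cartanOp_mul (hρ : IsSuperHom ρ) {w : Module.End k E} {d : ℤ}
    {μ : Module.Dual k T.h} (hw : NegMono T ρ w d μ) (t : T.h) :
    cartanOp T ρ t * w = w * cartanOp T ρ t + μ t • w := by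
  induction hw with
  | single a hx hn => exact _root_.cartanOp_mul hρ hx a t
  | cons a hx hn hw ih =>
    rw [← mul_assoc, _root_.cartanOp_mul hρ hx a t, add_mul, mul_assoc, ih, mul_add, mul_assoc,
      LinearMap.add_apply, add_smul, smul_mul_assoc, mul_smul_comm]
    abel

namespace HWData

/-- The highest weight. -/
noncomputable def weight (_ : HWData T ρ v ψ) : Module.Dual k T.h :=
  ψ ∘ₗ (TensorProduct.mk k T.h A).flip 1

theorem mem_wtSpace_weight (H : HWData T ρ v ψ) : v ∈ wtSpace T ρ H.weight := by
  rw [mem_wtSpace]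
  intro t
  have h := H.cartan (t ⊗ₜ 1)
  rw [TriangularDecomposition.inclCartan, LinearMap.rTensor_tmul] at h
  exact h

theorem negMono_mem_wtSpace (H : HWData T ρ v ψ) {w : Module.End k E} {d : ℤ}
    {μ : Module.Dual k T.h} (hw : NegMono T ρ w d μ) : w v ∈ wtSpace T ρ (H.weight + μ) := by
  rw [mem_wtSpace]
  intro t
  have h := LinearMap.congr_fun (hw.cartanOp_mul H.super t) v
  simp only [Module.End.mul_apply, LinearMap.add_apply, LinearMap.smul_apply] at h
  rw [h, mem_wtSpace.1 H.mem_wtSpace_weight t, map_smul, LinearMap.add_apply, add_smul]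

/-- The space spanned by the highest weight vector and its images under negative monomials. -/
def monoSpan (_ : HWData T ρ v ψ) : Submodule k E :=
  Submodule.span k ({v} ∪ {m | ∃ w d μ, NegMono T ρ w d μ ∧ m = w v})

theorem letter_mem_monoSpan (H : HWData T ρ v ψ) {p : ZMod 2} {d : ℤ} {α : Module.Dual k T.h}
    {x : g} (hx : T.IsRootVector p d α x) (hn : T.IsNegative d α) (a : A) {m : E}
    (hm : m ∈ H.monoSpan) : ρ (x ⊗ₜ a) m ∈ H.monoSpan := by
  induction hm using Submodule.span_induction with
  | mem m hm =>
    rcases hm with rfl | ⟨w, e, β, hw, rfl⟩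
    · exact Submodule.subset_span (Or.inr ⟨_, d, α, NegMono.single a hx hn, rfl⟩)
    · exact Submodule.subset_span (Or.inr ⟨_, _, _, NegMono.cons a hx hn hw, rfl⟩)
  | zero => simp
  | add x y _ _ hx hy => rw [map_add]; exact add_mem hx hy
  | smul c x _ hx => rw [map_smul]; exact Submodule.smul_mem _ _ hx

theorem apply_mem_monoSpan (H : HWData T ρ v ψ) (x : g ⊗[k] A) : ρ x v ∈ H.monoSpan := by
  have hv : v ∈ H.monoSpan := Submodule.subset_span (Or.inl rfl)
  induction x with
  | zero => simp
  | add x y hx hy => rw [map_add]; exact add_mem hx hy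
  | tmul x a =>
    have hx : x ∈ nilSubspace T.gr T.h T.ht (-1) ⊔
        (cartanSubspace T.h ⊔ nilSubspace T.gr T.h T.ht 1) := by
      rw [T.isCompl.sup_eq_top]; trivial
    obtain ⟨y, hy, _, hb, rfl⟩ := Submodule.mem_sup.1 hx
    obtain ⟨_, ⟨t, htm, rfl⟩, z, hz, rfl⟩ := Submodule.mem_sup.1 hb
    rw [TensorProduct.add_tmul, TensorProduct.add_tmul, map_add, map_add]
    refine add_mem ?_ (add_mem ?_ ?_)
    · refine TriangularDecomposition.nNeg_induction (T := T)
        (P := fun y => ρ (y ⊗ₜ a) v ∈ H.monoSpan) (by simp) ?_ ?_ ?_ hy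
      · intro x y hx hy; rw [TensorProduct.add_tmul, map_add]; exact add_mem hx hy
      · intro c x hx
        rw [← TensorProduct.smul_tmul', map_smul]; exact Submodule.smul_mem _ _ hx
      · intro p d α x hx hn
        exact H.letter_mem_monoSpan hx hn a hv
    · have h := H.cartan ((⟨t, htm⟩ : T.h) ⊗ₜ a)
      simp only [TriangularDecomposition.inclCartan, LinearMap.rTensor_tmul] at h
      change ρ _ v = _ at h
      have h' : ρ (((homog k g 0).subtype t) ⊗ₜ[k] a) v = ψ ((⟨t, htm⟩ : T.h) ⊗ₜ a) • v := h
      rw [h']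
      exact Submodule.smul_mem _ _ hv
    · rw [H.pos z hz a]
      exact zero_mem _

/-- Induction on the word: `x` is moved past the first letter `y`, giving `± y x m + [x, y] m`. Both
terms are covered because the induction hypothesis holds for all `x` at once. -/
theorem apply_negMono_mem_monoSpan (H : HWData T ρ v ψ) {w : Module.End k E} {d : ℤ}
    {μ : Module.Dual k T.h} (hw : NegMono T ρ w d μ) (x : g ⊗[k] A) :
    ρ x (w v) ∈ H.monoSpan := by
  have key : ∀ {p : ZMod 2} {d : ℤ} {α : Module.Dual k T.h} {y : g} (a : A) (m : E),
      T.IsRootVector p d α y → T.IsNegative d α → (∀ x, ρ x m ∈ H.monoSpan) →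
      ∀ x, ρ x (ρ (y ⊗ₜ a) m) ∈ H.monoSpan := by
    intro p d α y a m hy hn hm x
    obtain ⟨x0, h0, x1, h1, rfl⟩ := SuperSpace.exists_eq_add (k := k) x
    have h : ∀ i, ∀ x ∈ homog k (g ⊗[k] A) i, ρ x (ρ (y ⊗ₜ a) m) ∈ H.monoSpan := by
      intro i x hx
      have e := LinearMap.congr_fun (H.super hx (tmul_mem_mapPart hy.mem_homog a)) m
      simp only [Module.End.mul_apply, LinearMap.add_apply, LinearMap.smul_apply] at e
      rw [e]
      exact add_mem (zsmul_mem (H.letter_mem_monoSpan hy hn a (hm x)) _) (hm _)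
    rw [map_add]
    exact add_mem (h 0 x0 h0) (h 1 x1 h1)
  induction hw generalizing x with
  | single a hy hn => exact key a v hy hn H.apply_mem_monoSpan x
  | cons a hy hn hw ih => exact key a _ hy hn ih x

theorem monoSpan_eq_top (H : HWData T ρ v ψ) : H.monoSpan = ⊤ := by
  refine H.gen _ (fun x m hm => ?_) (Submodule.subset_span (Or.inl rfl))
  induction hm using Submodule.span_induction with
  | mem m hm =>
    rcases hm with rfl | ⟨w, e, β, hw, rfl⟩
    · exact H.apply_mem_monoSpan x
    · exact H.apply_negMono_mem_monoSpan hw x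
  | zero => simp
  | add x y _ _ hx hy => rw [map_add]; exact add_mem hx hy
  | smul c x _ hx => rw [map_smul]; exact Submodule.smul_mem _ _ hx

/-- The images of `v` under `negZero`. -/
noncomputable def lowZero (_ : HWData T ρ v ψ) : Submodule k E :=
  (negZero T ρ).map (LinearMap.applyₗ v)

/-- The sum of the other weight spaces. -/
noncomputable def others (H : HWData T ρ v ψ) : Submodule k E :=
  ⨆ μ : {μ // μ ≠ H.weight}, wtSpace T ρ μ.1

/-- Words of nonzero weight move `v` into another weight space; only those of weight zero remain.
Nothing is claimed about uniqueness of `c` and `w`: that is where nilpotency enters later. -/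
theorem exists_decomp (H : HWData T ρ v ψ) (m : E) :
    ∃ c : k, ∃ w ∈ negZero T ρ, ∃ q ∈ H.others, m = c • v + w v + q := by
  have hm : m ∈ H.monoSpan := by rw [H.monoSpan_eq_top]; trivial
  induction hm using Submodule.span_induction with
  | mem m hm =>
    rcases hm with rfl | ⟨w, d, μ, hw, rfl⟩
    · exact ⟨1, 0, zero_mem _, 0, zero_mem _, by simp⟩
    · by_cases hμ : μ = 0
      · subst hμ
        exact ⟨0, w, Submodule.subset_span ⟨d, hw⟩, 0, zero_mem _, by simp⟩
      · refine ⟨0, 0, zero_mem _, w v, ?_, by simp⟩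
        exact Submodule.mem_iSup_of_mem (⟨H.weight + μ, by simpa using hμ⟩ : {μ // μ ≠ H.weight})
          (H.negMono_mem_wtSpace hw)
  | zero => exact ⟨0, 0, zero_mem _, 0, zero_mem _, by simp⟩
  | add x y _ _ hx hy =>
    obtain ⟨c, w, hw, q, hq, rfl⟩ := hx
    obtain ⟨c', w', hw', q', hq', rfl⟩ := hy
    exact ⟨c + c', w + w', add_mem hw hw', q + q', add_mem hq hq', by
      rw [add_smul, LinearMap.add_apply]; abel⟩
  | smul a x _ hx =>
    obtain ⟨c, w, hw, q, hq, rfl⟩ := hx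
    exact ⟨a * c, a • w, Submodule.smul_mem _ _ hw, a • q, Submodule.smul_mem _ _ hq, by
      rw [smul_add, smul_add, mul_smul, LinearMap.smul_apply]⟩

theorem negZero_apply_mem_wtSpace (H : HWData T ρ v ψ) {w : Module.End k E}
    (hw : w ∈ negZero T ρ) : w v ∈ wtSpace T ρ H.weight := by
  induction hw using Submodule.span_induction with
  | mem w hw =>
    obtain ⟨d, hw⟩ := hw
    simpa using H.negMono_mem_wtSpace hw
  | zero => simp
  | add x y _ _ hx hy => rw [LinearMap.add_apply]; exact add_mem hx hy
  | smul c x _ hx => rw [LinearMap.smul_apply]; exact Submodule.smul_mem _ _ hx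

/-- Weight components of elements of a stable subspace lie in the subspace. -/
theorem mem_of_add_others_mem (H : HWData T ρ v ψ) {N : Submodule k E} (hN : StableUnder ρ N)
    {y q : E} (hy : y ∈ wtSpace T ρ H.weight) (hq : q ∈ H.others) (h : y + q ∈ N) : y ∈ N := by
  classical
  obtain ⟨f, hf, rfl⟩ := (Submodule.mem_iSup_iff_exists_finsupp _ _).1 hq
  have key : ∀ (s : Finset {μ // μ ≠ H.weight}) (y : E) (f : {μ // μ ≠ H.weight} → E),
      y ∈ wtSpace T ρ H.weight → (∀ μ, f μ ∈ wtSpace T ρ μ.1) → y + ∑ μ ∈ s, f μ ∈ N →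
      y ∈ N := by
    intro s
    induction s using Finset.induction_on with
    | empty => intro y f _ _ h; simpa using h
    | insert μ s hμ ih =>
      intro y f hy hf h
      -- The operator `t - μ(t)` kills the component of weight `μ` and rescales `y` by a nonzero
      -- scalar, so one component is removed at a time.
      obtain ⟨t, ht⟩ : ∃ t, μ.1 t ≠ H.weight t := by
        by_contra! hcon
        exact μ.2 (LinearMap.ext hcon)
      have h1 : cartanOp T ρ t (y + ∑ ν ∈ insert μ s, f ν) -
          μ.1 t • (y + ∑ ν ∈ insert μ s, f ν) ∈ N :=
        sub_mem (hN _ _ h) (Submodule.smul_mem _ _ h)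
      have h2 : cartanOp T ρ t (y + ∑ ν ∈ insert μ s, f ν) -
          μ.1 t • (y + ∑ ν ∈ insert μ s, f ν) =
          (H.weight t - μ.1 t) • y + ∑ ν ∈ s, (ν.1 t - μ.1 t) • f ν := by
        rw [map_add, map_sum, mem_wtSpace.1 hy t, smul_add, Finset.smul_sum, add_sub_add_comm,
          ← Finset.sum_sub_distrib, Finset.sum_insert hμ, mem_wtSpace.1 (hf μ) t, sub_self,
          zero_add, sub_smul]
        congr 1
        exact Finset.sum_congr rfl fun ν _ => by rw [mem_wtSpace.1 (hf ν) t, sub_smul]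
      rw [h2] at h1
      have h3 := ih ((H.weight t - μ.1 t) • y) (fun ν => (ν.1 t - μ.1 t) • f ν)
        (Submodule.smul_mem _ _ hy) (fun ν => Submodule.smul_mem _ _ (hf ν)) h1
      exact (Submodule.smul_mem_iff _ (sub_ne_zero.2 ht.symm)).1 h3
  exact key f.support y f hy hf h

end HWData

end HW

/-! ### Stable subspaces and the algebra generated by the operators. -/

section StableUnder

variable {k E : Type*} [Field k] [AddCommGroup E] [Module k E]

theorem stableUnder_ker {L : Type*} [AddCommGroup L] [Module k L] {ρ : L →ₗ[k] Module.End k E}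
    {f : Module.End k E} (hf : ∀ x, ρ x * f = f * ρ x) : StableUnder ρ (LinearMap.ker f) := by
  intro x m hm
  have h := LinearMap.congr_fun (hf x) m
  rw [LinearMap.mem_ker] at hm ⊢
  simpa [hm] using h.symm

/-- Every subspace stable under `ρ` is stable under the algebra generated by the image of `ρ`. -/
theorem StableUnder.adjoin {L : Type*} [AddCommGroup L] [Module k L] {ρ : L →ₗ[k] Module.End k E}
    {N : Submodule k E} (hN : StableUnder ρ N) {r : Module.End k E}
    (hr : r ∈ Algebra.adjoin k (Set.range ρ)) : ∀ m ∈ N, r m ∈ N := by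
  induction hr using Algebra.adjoin_induction with
  | mem x hx => obtain ⟨x, rfl⟩ := hx; exact hN x
  | algebraMap c => intro m hm; simpa using N.smul_mem c hm
  | add x y _ _ hx hy => intro m hm; exact add_mem (hx m hm) (hy m hm)
  | mul x y _ _ hx hy => intro m hm; exact hx _ (hy m hm)

end StableUnder

/-! ### Consequences of the nilpotency of the negative operators of weight zero. -/

section HW

variable {k g A : Type*} [Field k] [CharZero k] [AddCommGroup g] [Module k g] [LieSuperalgebra k g]
  [CommRing A] [Algebra k A] {T : TriangularDecomposition k g}
  {E : Type*} [AddCommGroup E] [Module k E]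
  {ρ : g ⊗[k] A →ₗ[k] Module.End k E} {v : E} {ψ : Module.Dual k (T.h ⊗[k] A)}

theorem NegMono.mem_adjoin {w : Module.End k E} {d : ℤ} {μ : Module.Dual k T.h}
    (hw : NegMono T ρ w d μ) : w ∈ Algebra.adjoin k (Set.range ρ) := by
  induction hw with
  | single a hx hn => exact Algebra.subset_adjoin ⟨_, rfl⟩
  | cons a hx hn hw ih => exact mul_mem (Algebra.subset_adjoin ⟨_, rfl⟩) ih

theorem negZero_le_adjoin :
    negZero T ρ ≤ (Algebra.adjoin k (Set.range ρ)).toSubmodule :=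
  Submodule.span_le.2 fun _ ⟨_, hw⟩ => hw.mem_adjoin

namespace HWData

theorem exists_of_mem_wtSpace (H : HWData T ρ v ψ) {m : E} (hm : m ∈ wtSpace T ρ H.weight) :
    ∃ c : k, ∃ w ∈ negZero T ρ, m = c • v + w v := by
  obtain ⟨c, w, hw, q, hq, rfl⟩ := H.exists_decomp m
  refine ⟨c, w, hw, ?_⟩
  -- With `N = ⊥` this is the independence of the highest weight space from the others.
  have h := H.mem_of_add_others_mem (N := ⊥) (fun x m hm => by simp_all)
    (y := c • v + w v - (c • v + w v + q)) (q := q)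
    (sub_mem (add_mem (Submodule.smul_mem _ _ H.mem_wtSpace_weight)
      (H.negZero_apply_mem_wtSpace hw)) hm) hq (by simp)
  rw [Submodule.mem_bot, sub_eq_zero] at h
  exact h.symm

/-- A proper subspace containing all the proper stable subspaces. -/
noncomputable def properBound (H : HWData T ρ v ψ) : Submodule k E :=
  H.lowZero ⊔ H.others

variable (hnil : ∀ w ∈ negZero T ρ, IsNilpotent w)
include hnil

/-- Comparing weights in `v = w v + q` gives `w v = v`, which a nilpotent `w` allows only for `v =
0`. -/
theorem not_mem_properBound (H : HWData T ρ v ψ) (hv : v ≠ 0) : v ∉ H.properBound := by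
  intro hmem
  obtain ⟨_, ⟨w, hw, rfl⟩, q, hq, h⟩ := Submodule.mem_sup.1 hmem
  replace h : w v + q = v := h
  have h1 := H.mem_of_add_others_mem (N := ⊥) (fun x m hm => by simp_all)
    (y := w v - v) (q := q)
    (sub_mem (H.negZero_apply_mem_wtSpace hw) H.mem_wtSpace_weight) hq
    (by rw [Submodule.mem_bot, sub_add_eq_add_sub, h, sub_self])
  rw [Submodule.mem_bot, sub_eq_zero] at h1
  obtain ⟨n, hn⟩ := hnil w hw
  have h2 : ∀ n : ℕ, (w ^ n) v = v := by
    intro n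
    induction n with
    | zero => simp
    | succ n ih => rw [pow_succ, Module.End.mul_apply, h1, ih]
  exact hv (by rw [← h2 n, hn, LinearMap.zero_apply])

/-- An element with a nonzero coefficient `c` at `v` has the weight component `(c + w) v` in `N`.
The inverse of `c + w` is a polynomial in `w`, so it preserves `N` and brings back `v`, which
generates everything. -/
theorem le_properBound (H : HWData T ρ v ψ) {N : Submodule k E} (hN : StableUnder ρ N)
    (hne : N ≠ ⊤) : N ≤ H.properBound := by
  intro m hm
  obtain ⟨c, w, hw, q, hq, rfl⟩ := H.exists_decomp m
  have hc : c = 0 := by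
    by_contra hc
    have h1 : c • v + w v ∈ N := H.mem_of_add_others_mem hN
      (add_mem (Submodule.smul_mem _ _ H.mem_wtSpace_weight) (H.negZero_apply_mem_wtSpace hw)) hq hm
    obtain ⟨n, hn⟩ := hnil w hw
    -- The inverse of `c + w` as a geometric series, finite because `w ^ n = 0`.
    set r : Module.End k E := c⁻¹ • ∑ i ∈ Finset.range n, (-(c⁻¹ • w)) ^ i with hr
    have hadj : ∀ x ∈ N, r x ∈ N := by
      refine hN.adjoin ?_
      exact Subalgebra.smul_mem _ (sum_mem fun i _ => pow_mem (neg_mem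
        (Subalgebra.smul_mem _ (negZero_le_adjoin hw) _)) _) _
    have h2 : r * (algebraMap k (Module.End k E) c + w) = 1 := by
      have h3 := geom_sum_mul_neg (-(c⁻¹ • w)) n
      have h4 : (-(c⁻¹ • w)) ^ n = 0 := by
        rw [← neg_smul, smul_pow, hn, smul_zero]
      rw [h4, sub_zero, sub_neg_eq_add] at h3
      rw [hr, ← h3, smul_mul_assoc, ← mul_smul_comm, smul_add, Algebra.algebraMap_eq_smul_one,
        smul_smul, inv_mul_cancel₀ hc, one_smul]
    have h5 := hadj _ h1
    have h6 : r (c • v + w v) = v := by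
      have := LinearMap.congr_fun h2 v
      simpa [Module.algebraMap_end_apply] using this
    rw [h6] at h5
    exact hne (H.gen N hN h5)
  subst hc
  rw [zero_smul, zero_add]
  exact Submodule.add_mem_sup ⟨w, hw, rfl⟩ hq

/-- Endomorphisms of a module all of whose proper stable subspaces are zero are scalars. -/
theorem end_eq_smul (H : HWData T ρ v ψ)
    (hs : ∀ N : Submodule k E, StableUnder ρ N → N = ⊥ ∨ N = ⊤) {f : Module.End k E}
    (hf : ∀ x, ρ x * f = f * ρ x) : ∃ c : k, ∀ m, f m = c • m := by
  have hfw : f v ∈ wtSpace T ρ H.weight := by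
    rw [mem_wtSpace]
    intro t
    have h := LinearMap.congr_fun (hf (((t : homog k g 0) : g) ⊗ₜ 1)) v
    simp only [Module.End.mul_apply] at h
    have h2 := mem_wtSpace.1 H.mem_wtSpace_weight t
    unfold cartanOp at h2 ⊢
    rw [h, h2, map_smul]
  -- The highest weight space may be larger than `k v`, so `f v` is a multiple of `v` only up to the
  -- nilpotent correction `w v`.
  obtain ⟨c, w, hw, h⟩ := H.exists_of_mem_wtSpace hfw
  refine ⟨c, ?_⟩
  set f' : Module.End k E := f - algebraMap k _ c with hf'
  have hcomm : ∀ x, ρ x * f' = f' * ρ x := by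
    intro x
    rw [hf', mul_sub, sub_mul, hf, Algebra.commutes c (ρ x)]
  have hv : f' v = w v := by
    simp [hf', h, Module.algebraMap_end_apply]
  have hcommw : Commute f' w := by
    have hle : Algebra.adjoin k (Set.range ρ) ≤ Subalgebra.centralizer k {f'} := by
      refine Algebra.adjoin_le ?_
      rintro _ ⟨x, rfl⟩
      rw [SetLike.mem_coe, Subalgebra.mem_centralizer_iff]
      rintro _ rfl
      exact (hcomm x).symm
    exact (Subalgebra.mem_centralizer_iff k).1 (hle (negZero_le_adjoin hw)) f' rfl
  -- Since `f'` agrees with `w` at `v` and commutes with it, the powers agree at `v` too. Thus `f'`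
  -- is not injective unless `v = 0`, and its kernel, being stable, is everything.
  have hpow : ∀ n : ℕ, (f' ^ n) v = (w ^ n) v := by
    intro n
    induction n with
    | zero => simp
    | succ n ih =>
      rw [pow_succ, Module.End.mul_apply, hv, ← Module.End.mul_apply,
        (hcommw.pow_left n).eq, Module.End.mul_apply, ih, ← Module.End.mul_apply, ← pow_succ']
  rcases hs _ (stableUnder_ker hcomm) with hb | ht
  · obtain ⟨n, hn⟩ := hnil w hw
    have hinj : Function.Injective f' := LinearMap.ker_eq_bot.1 hb
    have hv0 : v = 0 := by
      have h1 := hpow n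
      rw [hn, LinearMap.zero_apply] at h1
      have h2 : Function.Injective (f' ^ n) := by
        rw [Module.End.coe_pow]; exact hinj.iterate n
      exact h2 (by rw [h1, map_zero])
    have hbt := H.gen ⊥ (fun x m hm => by simp_all) (by simp [hv0])
    intro m
    have hm : m ∈ (⊥ : Submodule k E) := by rw [hbt]; trivial
    rw [Submodule.mem_bot] at hm
    simp [hm]
  · intro m
    have hm : m ∈ LinearMap.ker f' := by rw [ht]; trivial
    rw [LinearMap.mem_ker, hf', LinearMap.sub_apply, sub_eq_zero] at hm
    simpa [Module.algebraMap_end_apply] using hm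

end HWData

end HW

/-! ### Irreducible highest weight modules -/

section Irreducible

variable {k : Type u} {L : Type v} [Field k] [AddCommGroup L] [Module k L] [LieSuperalgebra k L]

theorem SuperSpace.parity_mem_of_isGraded {V : Type*} [AddCommGroup V] [Module k V]
    [SuperSpace k V] {N : Submodule k V} (hN : IsGradedSubspace k N) {m : V} (hm : m ∈ N) :
    SuperSpace.parity k V m ∈ N := by
  obtain ⟨a, ⟨haN, ha⟩, b, ⟨hbN, hb⟩, rfl⟩ := Submodule.mem_sup.1 (hN hm)
  rw [map_add, SuperSpace.parity_even ha, SuperSpace.parity_odd hb]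
  exact add_mem haN (neg_mem hbN)

theorem SuperSpace.isGraded_of_parity_mem [CharZero k] {V : Type*} [AddCommGroup V] [Module k V]
    [SuperSpace k V] {N : Submodule k V} (h : ∀ m ∈ N, SuperSpace.parity k V m ∈ N) :
    IsGradedSubspace k N := by
  intro m hm
  obtain ⟨a, ha, b, hb, rfl⟩ := SuperSpace.exists_eq_add (k := k) m
  have h1 := h _ hm
  rw [map_add, SuperSpace.parity_even ha, SuperSpace.parity_odd hb] at h1
  have ha2 : (2 : k) • a ∈ N := by
    have := add_mem hm h1
    rw [two_smul]; convert this using 1; abel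
  have hb2 : (2 : k) • b ∈ N := by
    have := sub_mem hm h1
    rw [two_smul]; convert this using 1; abel
  exact Submodule.add_mem_sup ⟨(Submodule.smul_mem_iff _ two_ne_zero).1 ha2, ha⟩
    ⟨(Submodule.smul_mem_iff _ two_ne_zero).1 hb2, hb⟩

theorem SuperRep.stableUnder_map_parity (V : SuperRep.{u, v, w} k L) {N : Submodule k V.carrier}
    (hN : StableUnder V.ρ N) :
    StableUnder V.ρ (N.map (SuperSpace.parity k V.carrier)) := by
  rintro x _ ⟨m, hm, rfl⟩
  obtain ⟨a, ha, b, hb, rfl⟩ := SuperSpace.exists_eq_add (k := k) x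
  rw [map_add, LinearMap.add_apply, ← V.parity_ρ_even ha]
  have h : V.ρ b (SuperSpace.parity k V.carrier m) = SuperSpace.parity k V.carrier (-V.ρ b m) := by
    rw [map_neg, V.parity_ρ_odd hb, neg_neg]
  rw [h, ← map_add]
  exact ⟨_, add_mem (hN a m hm) (neg_mem (hN b m hm)), rfl⟩

end Irreducible

section IrreducibleHW

variable {k : Type u} {g : Type v} {A : Type w} [Field k] [CharZero k] [AddCommGroup g]
  [Module k g] [LieSuperalgebra k g] [CommRing A] [Algebra k A] {T : TriangularDecomposition k g}

/-- If `N` is proper and `P` is the parity involution, then `N + P N` is a graded submodule. Both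
summands lie in the same proper subspace `properBound`, so the sum is still proper, and graded
irreducibility makes it zero. -/
theorem SuperRep.IsIrreducible.eq_bot_or_eq_top_of_stable
    {V : SuperRep.{u, max v w, w'} k (g ⊗[k] A)} (hV : V.IsIrreducible) {x : V.carrier}
    {ψ : Module.Dual k (T.h ⊗[k] A)} (hx : x ≠ 0) (H : HWData T V.ρ x ψ)
    (hnil : ∀ w ∈ negZero T V.ρ, IsNilpotent w) {N : Submodule k V.carrier}
    (hN : StableUnder V.ρ N) : N = ⊥ ∨ N = ⊤ := by
  by_cases hne : N = ⊤
  · exact Or.inr hne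
  left
  set P := SuperSpace.parity k V.carrier with hP
  have hPP : ∀ m, P (P m) = m := SuperSpace.parity_parity
  have hN' := V.stableUnder_map_parity hN
  have hne' : N.map P ≠ ⊤ := by
    intro h
    refine hne ?_
    rw [eq_top_iff]
    intro m _
    have : P m ∈ N.map P := by rw [h]; trivial
    obtain ⟨y, hy, hyy⟩ := this
    rw [← hPP m, ← hyy, hPP]
    exact hy
  have hle : N ⊔ N.map P ≤ H.properBound :=
    sup_le (H.le_properBound hnil hN hne) (H.le_properBound hnil hN' hne')
  have hsub : V.IsSubrep (N ⊔ N.map P) := by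
    constructor
    · intro y m hm
      obtain ⟨a, ha, b, hb, rfl⟩ := Submodule.mem_sup.1 hm
      rw [map_add]
      exact Submodule.add_mem_sup (hN y a ha) (hN' y b hb)
    · refine SuperSpace.isGraded_of_parity_mem fun m hm => ?_
      obtain ⟨a, ha, _, ⟨b, hb, rfl⟩, rfl⟩ := Submodule.mem_sup.1 hm
      rw [map_add, add_comm]
      refine Submodule.add_mem_sup ?_ ⟨a, ha, rfl⟩
      change P (P b) ∈ N
      rw [hPP]; exact hb
  rcases hV.2 _ hsub with h | h
  · exact le_bot_iff.1 (h ▸ le_sup_left)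
  · rw [h] at hle
    exact absurd (hle trivial) (H.not_mem_properBound hnil hx)

end IrreducibleHW

/-! ### Nilpotency of the negative operators of weight zero -/

theorem Submodule.map₂_mk_induction {k M N : Type*} [CommRing k] [AddCommGroup M] [Module k M]
    [AddCommGroup N] [Module k N] {p : Submodule k M} {q : Submodule k N} {P : M ⊗[k] N → Prop}
    (ht : ∀ m ∈ p, ∀ n ∈ q, P (m ⊗ₜ n)) (hadd : ∀ x y, P x → P y → P (x + y))
    {z : M ⊗[k] N} (hz : z ∈ Submodule.map₂ (TensorProduct.mk k M N) p q) : P z := by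
  have hle : Submodule.map₂ (TensorProduct.mk k M N) p q ≤
      LinearMap.range (TensorProduct.mapIncl p q) := by
    rw [Submodule.map₂_le]
    intro m hm n hn
    exact ⟨(⟨m, hm⟩ : p) ⊗ₜ (⟨n, hn⟩ : q), rfl⟩
  obtain ⟨w, rfl⟩ := hle hz
  clear hz
  induction w with
  | zero => simpa using ht 0 (zero_mem _) 0 (zero_mem _)
  | tmul m n => exact ht m m.2 n n.2
  | add x y hx hy => rw [map_add]; exact hadd _ _ hx hy

/-- Products of linearly dependent families of elements with square zero vanish. -/
theorem prod_ofFn_eq_zero {k L R : Type*} [Field k] [AddCommGroup L]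
    [Module k L] [Ring R] [Algebra k R] {ρ : L →ₗ[k] R}
    {Y : Submodule k L} (hsq : ∀ y ∈ Y, ρ y * ρ y = 0) {q : ℕ} {y : Fin q → L} (hy : ∀ i, y i ∈ Y)
    (hdep : ¬ LinearIndependent k y) : (List.ofFn fun i => ρ (y i)).prod = 0 := by
  -- Square zero on all of `Y` means that `ρ` factors through the exterior algebra, where products
  -- of dependent vectors vanish.
  let f : ExteriorAlgebra k Y →ₐ[k] R :=
    ExteriorAlgebra.lift k ⟨ρ ∘ₗ Y.subtype, fun m => hsq m m.2⟩
  let y' : Fin q → Y := fun i => ⟨y i, hy i⟩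
  have hdep' : ¬ LinearIndependent k y' := fun h =>
    hdep (h.map' Y.subtype (Submodule.ker_subtype Y))
  have h0 : ExteriorAlgebra.ιMulti k q y' = 0 :=
    AlternatingMap.map_linearDependent _ _ hdep'
  have h1 : f (ExteriorAlgebra.ιMulti k q y') = (List.ofFn fun i => ρ (y i)).prod := by
    rw [ExteriorAlgebra.ιMulti_apply, map_list_prod, List.map_ofFn]
    congr 2
    funext i
    exact ExteriorAlgebra.lift_ι_apply k _ _ _
  rw [← h1, h0, map_zero]

/-! ### Inner gradings, and counting odd factors for gradings of type I. -/

section Nil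

variable {k g A : Type*} [Field k] [CharZero k] [AddCommGroup g] [Module k g] [LieSuperalgebra k g]
  [CommRing A] [Algebra k A] (T : TriangularDecomposition k g)

/-- The degree is given by an element of the Cartan subalgebra. -/
def TriangularDecomposition.IsInner : Prop :=
  ∃ z : T.h, ∀ (d : ℤ) (α : Module.Dual k T.h) (x : g), x ∈ T.gr d → x ∈ rootSubspace T.h α →
    x ≠ 0 → α z = d

/-- The degree zero part is the even part, and the other nonzero degrees are `±1`. -/
structure TriangularDecomposition.IsTypeI : Prop where
  zero : T.gr 0 = homog k g 0
  neg_one : T.gr (-1) ≤ homog k g 1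
  eq_bot : ∀ i : ℤ, 1 < |i| → T.gr i = ⊥

variable {T} {R : Type*} [Ring R] [Algebra k R] {ρ : g ⊗[k] A →ₗ[k] R}

/-- The zero vector is a root vector of every degree and weight; a word containing it carries no
information about `z`, whence the alternative `w = 0`. -/
theorem NegMono.eq_zero_or (hT : ∃ z : T.h, ∀ (d : ℤ) (α : Module.Dual k T.h) (x : g), x ∈ T.gr d →
    x ∈ rootSubspace T.h α → x ≠ 0 → α z = d) :
    ∃ z : T.h, ∀ {w : R} {d : ℤ} {μ : Module.Dual k T.h}, NegMono T ρ w d μ →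
      w = 0 ∨ (μ z = d ∧ T.IsNegative d μ) := by
  obtain ⟨z, hz⟩ := hT
  refine ⟨z, fun hw => ?_⟩
  induction hw with
  | @single p d α x a hx hn =>
    by_cases h : x = 0
    · left; simp [h]
    · exact Or.inr ⟨hz _ _ _ hx.degree hx.weight h, hn⟩
  | @cons p d α x a hx hn w e β hw ih =>
    by_cases h : x = 0
    · left; simp [h]
    · rcases ih with rfl | ⟨ih, ih'⟩
      · left; simp
      · right
        exact ⟨by simp [hz _ _ _ hx.degree hx.weight h, ih], hn.add ih'⟩

/-- Evaluating the weight zero at `z` gives degree zero, by characteristic zero. A negative word of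
degree zero has `ht < 0`, while `ht 0 = 0`. -/
theorem negZero_eq_bot_of_isInner (hT : T.IsInner) : negZero T ρ = ⊥ := by
  obtain ⟨z, hz⟩ := NegMono.eq_zero_or (ρ := ρ) hT
  refine Submodule.span_eq_bot.2 ?_
  rintro w ⟨d, hw⟩
  rcases hz hw with h | ⟨h1, h2⟩
  · exact h
  · have hd : d = 0 := by
      rw [LinearMap.zero_apply] at h1
      exact_mod_cast h1.symm
    rcases h2 with h2 | ⟨_, h2⟩
    · omega
    · simp at h2

variable (T) in
/-- The subspace `g₋₁ ⊗ Fᵉ`. -/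
def oddPart (F : Submodule k A) (e : ℕ) : Submodule k (g ⊗[k] A) :=
  Submodule.map₂ (TensorProduct.mk k g A) (T.gr (-1)) (F ^ e)

variable (T ρ) in
/-- The span of the products beginning with `q` factors in `g₋₁ ⊗ A`, the sum of whose degrees with
respect to the filtration of `A` by the powers of `F` is at most `n`. -/
def fermi (F : Submodule k A) : ℕ → ℕ → Submodule k R
  | 0, _ => ⊤
  | q + 1, n => Submodule.span k
      {r | ∃ e ≤ n, ∃ y ∈ oddPart T F e, ∃ s ∈ fermi F q (n - e), r = ρ y * s}

theorem fermi_mono (F : Submodule k A) (q : ℕ) {n m : ℕ} (h : n ≤ m) :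
    fermi T ρ F q n ≤ fermi T ρ F q m := by
  induction q generalizing n m with
  | zero => exact le_rfl
  | succ q ih =>
    refine Submodule.span_le.2 ?_
    rintro _ ⟨e, he, y, hy, s, hs, rfl⟩
    exact Submodule.subset_span ⟨e, he.trans h, y, hy, s, ih (Nat.sub_le_sub_right h e) hs, rfl⟩

theorem fermi_succ_le (F : Submodule k A) (q n : ℕ) :
    fermi T ρ F (q + 1) n ≤ fermi T ρ F q n := by
  induction q generalizing n with
  | zero => exact le_top
  | succ q ih =>
    refine Submodule.span_le.2 ?_
    rintro _ ⟨e, he, y, hy, s, hs, rfl⟩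
    exact Submodule.subset_span ⟨e, he, y, hy, s, ih _ hs, rfl⟩

theorem fermi_le_of_le (F : Submodule k A) {q q' : ℕ} (n : ℕ) (h : q ≤ q') :
    fermi T ρ F q' n ≤ fermi T ρ F q n := by
  induction h with
  | refl => exact le_rfl
  | step _ ih => exact (fermi_succ_le F _ n).trans ih

theorem mul_mem_fermi_of_odd {F : Submodule k A} {x : g} (hx : x ∈ T.gr (-1)) {a : A} (ha : a ∈ F)
    {q n : ℕ} {s : R} (hs : s ∈ fermi T ρ F q n) :
    ρ (x ⊗ₜ a) * s ∈ fermi T ρ F (q + 1) (n + 1) :=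
  Submodule.subset_span ⟨1, by omega, _,
    Submodule.apply_mem_map₂ _ hx (by simpa using ha), s, by simpa using hs, rfl⟩

/-- The even letter is pushed to the right through the odd factors. At each factor `y` the
commutator stays in `g₋₁ ⊗ A`, since the even part has degree zero, and its `A`-degree grows by one.
Each resulting term pays this extra unit exactly once or leaves it to the tail. -/
theorem mul_mem_fermi_of_even (hρ : IsSuperHom ρ) (hT : T.IsTypeI) {F : Submodule k A} {x : g}
    (hx : x ∈ homog k g 0) {a : A} (ha : a ∈ F) {q n : ℕ} {s : R} (hs : s ∈ fermi T ρ F q n) :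
    ρ (x ⊗ₜ a) * s ∈ fermi T ρ F q (n + 1) := by
  induction q generalizing n s with
  | zero => trivial
  | succ q ih =>
    induction hs using Submodule.span_induction with
    | mem r hr =>
      obtain ⟨e, he, y, hy, s, hs, rfl⟩ := hr
      have hy' : sbr k (x ⊗ₜ[k] a) y ∈ oddPart T F (e + 1) ∧ y ∈ homog k (g ⊗[k] A) 1 := by
        refine Submodule.map₂_mk_induction (P := fun y => sbr k (x ⊗ₜ[k] a) y ∈ oddPart T F (e + 1) ∧
          y ∈ homog k (g ⊗[k] A) 1) (fun m hm n hn => ⟨?_, tmul_mem_mapPart (hT.neg_one hm) n⟩)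
          (fun x y hx hy => ⟨by rw [sbr_add]; exact add_mem hx.1 hy.1, add_mem hx.2 hy.2⟩) hy
        change mapBr k g A (x ⊗ₜ[k] a) (m ⊗ₜ n) ∈ _
        rw [mapBr_tmul]
        refine Submodule.apply_mem_map₂ _ ?_ ?_
        · have := T.distinguished.br_mem 0 (-1) x (by rwa [hT.zero]) m hm
          simpa using this
        · rw [pow_succ']
          exact Submodule.mul_mem_mul ha hn
      have h := hρ (tmul_mem_mapPart hx a) hy'.2
      rw [← mul_assoc, h, add_mul]
      refine add_mem ?_ ?_
      · simp only [superSign]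
        simp only [zero_ne_one, false_and, if_false, one_smul]
        rw [mul_assoc]
        exact Submodule.subset_span ⟨e, by omega, y, hy, _, by
          have := ih hs
          rwa [← Nat.sub_add_comm he] at this, rfl⟩
      · exact Submodule.subset_span ⟨e + 1, by omega, _, hy'.1, s, by
          rwa [Nat.add_sub_add_right], rfl⟩
    | zero => simp
    | add x y _ _ hx hy => rw [mul_add]; exact add_mem hx hy
    | smul c x _ hx => rw [mul_smul_comm]; exact Submodule.smul_mem _ _ hx

theorem fermi_le_span (F : Submodule k A) (q n : ℕ) :
    fermi T ρ F q n ≤ Submodule.span k {r | ∃ (e : Fin q → ℕ) (y : Fin q → g ⊗[k] A) (w : R),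
      ∑ i, e i ≤ n ∧ (∀ i, y i ∈ oddPart T F (e i)) ∧
        r = (List.ofFn fun i => ρ (y i)).prod * w} := by
  induction q generalizing n with
  | zero =>
    intro r _
    exact Submodule.subset_span ⟨Fin.elim0, Fin.elim0, r, by simp, fun i => i.elim0, by simp⟩
  | succ q ih =>
    refine Submodule.span_le.2 ?_
    rintro _ ⟨e, he, y, hy, s, hs, rfl⟩
    replace hs := ih _ hs
    rw [SetLike.mem_coe]
    induction hs using Submodule.span_induction with
    | mem r hr =>
      obtain ⟨es, ys, w, h1, h2, rfl⟩ := hr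
      refine Submodule.subset_span ⟨Fin.cons e es, Fin.cons y ys, w, ?_, ?_, ?_⟩
      · rw [Fin.sum_cons]; omega
      · intro i
        refine Fin.cases ?_ (fun i => ?_) i
        · simpa using hy
        · simpa using h2 i
      · simp [List.ofFn_succ, mul_assoc]
    | zero => simp
    | add x y _ _ hx hy => rw [mul_add]; exact add_mem hx hy
    | smul c x _ hx => rw [mul_smul_comm]; exact Submodule.smul_mem _ _ hx

theorem oddPart_mono {F : Submodule k A} (h1 : 1 ≤ F) {e e' : ℕ} (h : e ≤ e') :
    oddPart T F e ≤ oddPart T F e' :=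
  Submodule.map₂_le_map₂_right (pow_le_pow_right₀ h1 h)

/-- The bracket of two elements of `g₋₁` has degree `-2`, where the grading vanishes. So the images
of odd elements anticommute, and `2 (ρ y)² = 0`. -/
theorem sq_zero_of_mem (hρ : IsSuperHom ρ) (hT : T.IsTypeI) {y : g ⊗[k] A}
    (hy : y ∈ Submodule.map₂ (TensorProduct.mk k g A) (T.gr (-1)) ⊤) : ρ y * ρ y = 0 := by
  have key : ∀ y ∈ Submodule.map₂ (TensorProduct.mk k g A) (T.gr (-1)) ⊤,
      ∀ z ∈ Submodule.map₂ (TensorProduct.mk k g A) (T.gr (-1)) ⊤,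
      sbr k y z = 0 ∧ y ∈ homog k (g ⊗[k] A) 1 := by
    intro y hy z hz
    refine Submodule.map₂_mk_induction (P := fun y => sbr k y z = 0 ∧ y ∈ homog k (g ⊗[k] A) 1)
      (fun m hm a _ => ⟨?_, tmul_mem_mapPart (hT.neg_one hm) a⟩)
      (fun x y hx hy => ⟨?_, add_mem hx.2 hy.2⟩) hy
    · refine Submodule.map₂_mk_induction (P := fun z => sbr k (m ⊗ₜ[k] a) z = 0)
        (fun n hn b _ => ?_) (fun x y hx hy => by rw [sbr_add, hx, hy, add_zero]) hz
      change mapBr k g A (m ⊗ₜ[k] a) (n ⊗ₜ b) = _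
      have h := T.distinguished.br_mem (-1) (-1) m hm n hn
      rw [hT.eq_bot _ (by norm_num), Submodule.mem_bot] at h
      rw [mapBr_tmul, h, TensorProduct.zero_tmul]
    · rw [add_sbr, hx.1, hy.1, add_zero]
  obtain ⟨h1, h2⟩ := key y hy y hy
  have h := hρ h2 h2
  rw [h1, map_zero, add_zero] at h
  have h3 : (2 : k) • (ρ y * ρ y) = 0 := by
    rw [two_smul]; nth_rewrite 1 [h]; simp [superSign]
  exact (smul_eq_zero.1 h3).resolve_left two_ne_zero

/-- A pigeonhole argument: a product of `q` odd factors of average degree at most `m` has many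
factors of degree at most `2 m`. These lie in one finite dimensional space, so for large `q` they
are linearly dependent. -/
theorem fermi_eq_bot [FiniteDimensional k g] (hρ : IsSuperHom ρ) (hT : T.IsTypeI)
    {F : Submodule k A} (h1 : 1 ≤ F) (hF : F.FG) (m : ℕ) : ∃ q, fermi T ρ F q (q * m) = ⊥ := by
  have hfg : (oddPart T F (2 * m)).FG :=
    Submodule.FG.map₂ _ (IsNoetherian.noetherian _) (hF.pow _)
  have : FiniteDimensional k (oddPart T F (2 * m)) := Module.Finite.iff_fg.2 hfg
  set D := Module.finrank k (oddPart T F (2 * m)) with hD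
  -- In an independent family at most `D` factors have degree at most `2 m`. The remaining `D + 1`
  -- or more would cost at least `(D + 1) (2 m + 1)`, which exceeds the budget `(2 D + 1) m`.
  refine ⟨2 * D + 1, eq_bot_iff.2 ((fermi_le_span F _ _).trans (Submodule.span_le.2 ?_))⟩
  rintro _ ⟨e, y, w, hsum, hy, rfl⟩
  rw [SetLike.mem_coe, Submodule.mem_bot,
    prod_ofFn_eq_zero (Y := Submodule.map₂ (TensorProduct.mk k g A) (T.gr (-1)) ⊤)
      (fun y hy => sq_zero_of_mem hρ hT hy)
      (fun i => Submodule.map₂_le_map₂_right le_top (hy i)), zero_mul]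
  intro hli
  classical
  let B : Finset (Fin (2 * D + 1)) := Finset.univ.filter fun i => e i ≤ 2 * m
  have hB : B.card ≤ D := by
    have hli' : LinearIndependent k
        (fun i : B => (⟨y i, oddPart_mono h1 (by
          have := i.2; simp only [B, Finset.mem_filter] at this; exact this.2) (hy i)⟩ :
            oddPart T F (2 * m))) := by
      refine LinearIndependent.of_comp (oddPart T F (2 * m)).subtype ?_
      exact hli.comp (fun i : B => (i : Fin (2 * D + 1))) Subtype.val_injective
    simpa using hli'.fintype_card_le_finrank
  have hC : (Finset.univ.filter fun i => ¬ e i ≤ 2 * m).card * (2 * m + 1) ≤ ∑ i, e i := by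
    rw [← smul_eq_mul]
    refine (Finset.card_nsmul_le_sum _ e _ ?_).trans
      (Finset.sum_le_sum_of_subset (Finset.filter_subset _ _))
    intro i hi
    have := (Finset.mem_filter.1 hi).2
    omega
  have hcard : B.card + (Finset.univ.filter fun i => ¬ e i ≤ 2 * m).card = 2 * D + 1 := by
    simpa using Finset.card_filter_add_card_filter_not (s := Finset.univ)
      (fun i : Fin (2 * D + 1) => e i ≤ 2 * m)
  have h5 : D + 1 ≤ (Finset.univ.filter fun i => ¬ e i ≤ 2 * m).card := by omega
  have h6 : (D + 1) * (2 * m + 1) ≤ (2 * D + 1) * m :=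
    (Nat.mul_le_mul_right _ h5).trans (hC.trans hsum)
  nlinarith

variable (T ρ) in
/-- Multiplication by `r` adds `j` factors in `g₋₁ ⊗ A`, at a bounded cost. -/
def Lowers (j : ℕ) (r : R) : Prop :=
  ∃ F₀ : Submodule k A, F₀.FG ∧ ∃ m₀ : ℕ, ∀ F, F₀ ≤ F → ∀ m ≥ m₀, ∀ q n, ∀ s ∈ fermi T ρ F q n,
    r * s ∈ fermi T ρ F (q + j) (n + m)

/-- Costs add. The uniformity over all larger `F` and all larger budgets in `Lowers` allows passing
to a common `F` and splitting the budget `l` as `m + (l - m)`. -/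
theorem Lowers.mul {i j : ℕ} {r s : R} (hr : Lowers T ρ i r) (hs : Lowers T ρ j s) :
    Lowers T ρ (i + j) (r * s) := by
  obtain ⟨F, hF, m, h⟩ := hr
  obtain ⟨F', hF', m', h'⟩ := hs
  refine ⟨F ⊔ F', hF.sup hF', m + m', fun G hG l hl q n t ht => ?_⟩
  have h2 := h G (le_sup_left.trans hG) m le_rfl _ _ _
    (h' G (le_sup_right.trans hG) (l - m) (by omega) q n t ht)
  rw [mul_assoc]
  convert h2 using 2
  · omega
  · omega

theorem Lowers.add {j : ℕ} {r s : R} (hr : Lowers T ρ j r) (hs : Lowers T ρ j s) :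
    Lowers T ρ j (r + s) := by
  obtain ⟨F, hF, m, h⟩ := hr
  obtain ⟨F', hF', m', h'⟩ := hs
  refine ⟨F ⊔ F', hF.sup hF', m + m', fun G hG l hl q n t ht => ?_⟩
  rw [add_mul]
  exact add_mem (h G (le_sup_left.trans hG) l (by omega) q n t ht)
    (h' G (le_sup_right.trans hG) l (by omega) q n t ht)

theorem Lowers.smul {j : ℕ} {r : R} (c : k) (hr : Lowers T ρ j r) : Lowers T ρ j (c • r) := by
  obtain ⟨F, hF, m, h⟩ := hr
  refine ⟨F, hF, m, fun G hG l hl q n t ht => ?_⟩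
  rw [smul_mul_assoc]
  exact Submodule.smul_mem _ _ (h G hG l hl q n t ht)

theorem Lowers.zero (j : ℕ) : Lowers T ρ j 0 :=
  ⟨⊥, Submodule.fg_bot, 0, fun G _ l _ q n t _ => by rw [zero_mul]; exact zero_mem _⟩

theorem Lowers.of_le {i j : ℕ} {r : R} (h : i ≤ j) (hr : Lowers T ρ j r) : Lowers T ρ i r := by
  obtain ⟨F, hF, m, h'⟩ := hr
  exact ⟨F, hF, m, fun G hG l hl q n t ht => fermi_le_of_le _ _ (by omega) (h' G hG l hl q n t ht)⟩

/-- A letter of degree `-1` is itself an odd factor, and letters of lower degree are zero. The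
remaining negative letters are even of degree zero, hence of negative height; they preserve the
number of odd factors. -/
theorem lowers_letter (hρ : IsSuperHom ρ) (hT : T.IsTypeI) {p : ZMod 2} {d : ℤ}
    {α : Module.Dual k T.h} {x : g} (a : A) (hx : T.IsRootVector p d α x)
    (hn : T.IsNegative d α) :
    Lowers T ρ 1 (ρ (x ⊗ₜ a)) ∨ (Lowers T ρ 0 (ρ (x ⊗ₜ a)) ∧ T.ht α < 0) := by
  rcases hn with hd | ⟨rfl, hα⟩
  · left
    rcases eq_or_ne d (-1) with rfl | hd1
    · refine ⟨k ∙ a, Submodule.fg_span_singleton a, 1, fun F hF m hm q n s hs => ?_⟩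
      exact fermi_mono _ _ (by omega) (mul_mem_fermi_of_odd hx.degree
        (hF (Submodule.mem_span_singleton_self a)) hs)
    · have h0 := hx.degree
      rw [hT.eq_bot d (by rw [abs_of_neg hd]; omega), Submodule.mem_bot] at h0
      rw [h0, TensorProduct.zero_tmul, map_zero]
      exact Lowers.zero 1
  · right
    refine ⟨⟨k ∙ a, Submodule.fg_span_singleton a, 1, fun F hF m hm q n s hs => ?_⟩, hα⟩
    exact fermi_mono _ _ (by omega) (mul_mem_fermi_of_even hρ hT (hT.zero ▸ hx.degree)
        (hF (Submodule.mem_span_singleton_self a)) hs)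

/-- Heights add along a word, so a word with no odd letter has negative height. In particular a word
of weight zero must contribute an odd factor. -/
theorem NegMono.lowers (hρ : IsSuperHom ρ) (hT : T.IsTypeI) {w : R} {d : ℤ}
    {μ : Module.Dual k T.h} (hw : NegMono T ρ w d μ) :
    Lowers T ρ 1 w ∨ (Lowers T ρ 0 w ∧ T.ht μ < 0) := by
  induction hw with
  | single a hx hn => exact lowers_letter hρ hT a hx hn
  | cons a hx hn hw ih =>
    rcases lowers_letter hρ hT a hx hn with h | ⟨h, hα⟩ <;> rcases ih with h' | ⟨h', hβ⟩
    · exact Or.inl ((h.mul h').of_le (by omega))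
    · exact Or.inl (h.mul h')
    · exact Or.inl (by simpa using h.mul h')
    · exact Or.inr ⟨h.mul h', by rw [map_add]; linarith⟩

/-- The power `r ^ N` has at least `N` odd factors at a total cost of `N m`, which is the linear
growth that `fermi_eq_bot` excludes. -/
theorem isNilpotent_of_lowers [FiniteDimensional k g] (hρ : IsSuperHom ρ) (hT : T.IsTypeI) {r : R}
    (hr : Lowers T ρ 1 r) : IsNilpotent r := by
  obtain ⟨F, hF, m, h⟩ := hr
  -- Adjoining `1` makes the powers of the filtering subspace increase, as the count requires.
  have h1 : (1 : Submodule k A) ≤ F ⊔ 1 := le_sup_right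
  obtain ⟨q, hq⟩ := fermi_eq_bot hρ hT h1 (hF.sup (by
    rw [Submodule.one_eq_span]; exact Submodule.fg_span_singleton _)) m
  refine ⟨q, ?_⟩
  have key : ∀ N : ℕ, r ^ N ∈ fermi T ρ (F ⊔ 1) N (N * m) := by
    intro N
    induction N with
    | zero => trivial
    | succ N ih =>
      rw [pow_succ', Nat.succ_mul]
      exact h _ le_sup_left m le_rfl _ _ _ ih
  have := key q
  rwa [hq, Submodule.mem_bot] at this

theorem isNilpotent_of_mem_negZero [FiniteDimensional k g] (hT : T.IsInner ∨ T.IsTypeI)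
    (hρ : IsSuperHom ρ) {r : R} (hr : r ∈ negZero T ρ) : IsNilpotent r := by
  rcases hT with hT | hT
  · rw [negZero_eq_bot_of_isInner hT, Submodule.mem_bot] at hr
    rw [hr]; exact IsNilpotent.zero
  · refine isNilpotent_of_lowers hρ hT ?_
    induction hr using Submodule.span_induction with
    | mem w hw =>
      obtain ⟨d, hw⟩ := hw
      rcases hw.lowers hρ hT with h | ⟨_, h⟩
      · exact h
      · simp at h
    | zero => exact Lowers.zero 1
    | add x y _ _ hx hy => exact hx.add hy
    | smul c x _ hx => exact hx.smul c

end Nil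

/-! ### Tensor products -/

section Density

variable {k L E F : Type*} [Field k] [AddCommGroup L] [Module k L] [AddCommGroup E] [Module k E]
  [AddCommGroup F] [Module k F]

theorem rTensor_adjoin_mem {ρ : L →ₗ[k] Module.End k E} {N : Submodule k (E ⊗[k] F)}
    (hN : ∀ x, ∀ m ∈ N, LinearMap.rTensor F (ρ x) m ∈ N) {r : Module.End k E}
    (hr : r ∈ Algebra.adjoin k (Set.range ρ)) : ∀ m ∈ N, LinearMap.rTensor F r m ∈ N := by
  induction hr using Algebra.adjoin_induction with
  | mem x hx => obtain ⟨x, rfl⟩ := hx; exact hN x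
  | algebraMap c =>
    intro m hm
    rw [Algebra.algebraMap_eq_smul_one, LinearMap.rTensor_smul, LinearMap.smul_apply]
    exact N.smul_mem c (by rwa [Module.End.one_eq_id, LinearMap.rTensor_id])
  | add x y _ _ hx hy =>
    intro m hm; rw [LinearMap.rTensor_add]; exact add_mem (hx m hm) (hy m hm)
  | mul x y _ _ hx hy =>
    intro m hm
    rw [LinearMap.rTensor_mul]
    exact hx _ (hy m hm)

/-- A nonzero subspace of `E ⊗ F` stable under an irreducible family of operators on `E` with
scalar commutant contains `E ⊗ f` for some nonzero `f`. -/
theorem exists_forall_tmul_mem {ρ : L →ₗ[k] Module.End k E}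
    (hs : ∀ N : Submodule k E, StableUnder ρ N → N = ⊥ ∨ N = ⊤)
    (hend : ∀ f : Module.End k E, (∀ x, ρ x * f = f * ρ x) → ∃ c : k, ∀ m, f m = c • m)
    {N : Submodule k (E ⊗[k] F)} (hN : ∀ x, ∀ m ∈ N, LinearMap.rTensor F (ρ x) m ∈ N)
    (hne : N ≠ ⊥) : ∃ f : F, f ≠ 0 ∧ ∀ e : E, e ⊗ₜ f ∈ N := by
  classical
  obtain ⟨n, hn, hn0⟩ := Submodule.exists_mem_ne_zero_of_ne_bot hne
  have hnt : Nontrivial E := by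
    by_contra hcon
    rw [not_nontrivial_iff_subsingleton] at hcon
    exact hn0 (Subsingleton.elim _ _)
  let S : Subalgebra k (Module.End k E) := Algebra.adjoin k (Set.range ρ)
  have hsimple : IsSimpleModule S E := by
    rw [isSimpleModule_iff]
    refine { eq_bot_or_eq_top := fun M => ?_ }
    have hst : StableUnder ρ (M.restrictScalars k) := fun x m hm =>
      M.smul_mem (⟨ρ x, Algebra.subset_adjoin ⟨x, rfl⟩⟩ : S) hm
    rcases hs _ hst with h | h
    · left
      rwa [Submodule.restrictScalars_eq_bot_iff] at h
    · right
      rwa [Submodule.restrictScalars_eq_top_iff] at h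
  let b := Module.Basis.ofVectorSpace k E
  obtain ⟨c, rfl⟩ := TensorProduct.eq_repr_basis_left b n
  obtain ⟨i₀, hi₀⟩ : ∃ i, c i ≠ 0 := by
    by_contra! hcon
    refine hn0 ?_
    have : c = 0 := Finsupp.ext hcon
    simp [this]
  -- The projection onto the line of `b i₀` commutes with the commutant, which is scalar. By density
  -- some element of the generated algebra agrees with it on the finitely many basis vectors
  -- occurring in the tensor, and so isolates the term `b i₀ ⊗ c i₀`.
  let f₀ : E →ₗ[k] E := (b.coord i₀).smulRight (b i₀)
  let f : Module.End (Module.End S E) E :=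
    { toFun := f₀
      map_add' := map_add f₀
      map_smul' := by
        intro φ m
        obtain ⟨a, ha⟩ := hend (φ.restrictScalars k) (by
          intro x
          ext m
          exact (φ.map_smul (⟨ρ x, Algebra.subset_adjoin ⟨x, rfl⟩⟩ : S) m).symm)
        have ha' : ∀ m, φ m = a • m := ha
        simp only [Module.End.smul_def, RingHom.id_apply]
        rw [ha', map_smul, ha'] }
  obtain ⟨r, hr⟩ := jacobson_density f (c.support.image b)
  have hr' : ∀ i ∈ c.support, (r : Module.End k E) (b i) = if i = i₀ then b i₀ else 0 := by
    intro i hi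
    have h := hr (b i) (Finset.mem_image_of_mem _ hi)
    have h2 : f (b i) = f₀ (b i) := rfl
    rw [h2] at h
    have h3 : (r : Module.End k E) (b i) = r • b i := rfl
    rw [h3, ← h]
    simp only [f₀, LinearMap.smulRight_apply, Module.Basis.coord_apply, Module.Basis.repr_self,
      Finsupp.single_apply, ite_smul, one_smul, zero_smul]
  have h1 : b i₀ ⊗ₜ[k] c i₀ ∈ N := by
    have h := rTensor_adjoin_mem hN r.2 _ hn
    rw [Finsupp.sum, map_sum] at h
    rw [Finset.sum_eq_single i₀] at h
    · rwa [LinearMap.rTensor_tmul, hr' i₀ (Finsupp.mem_support_iff.2 hi₀), if_pos rfl] at h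
    · intro i hi hne
      rw [LinearMap.rTensor_tmul, hr' i hi, if_neg hne, TensorProduct.zero_tmul]
    · intro h
      exact absurd (Finsupp.mem_support_iff.2 hi₀) h
  refine ⟨c i₀, hi₀, fun e => ?_⟩
  -- The vectors `e` with `e ⊗ c i₀ ∈ N` form a stable subspace, nonzero because it contains `b i₀`.
  have hst : StableUnder ρ (N.comap ((TensorProduct.mk k E F).flip (c i₀))) :=
    fun x m hm => hN x _ hm
  rcases hs _ hst with h | h
  · have : b i₀ ∈ N.comap ((TensorProduct.mk k E F).flip (c i₀)) := h1
    rw [h, Submodule.mem_bot] at this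
    exact absurd this (b.ne_zero i₀)
  · have : e ∈ N.comap ((TensorProduct.mk k E F).flip (c i₀)) := by rw [h]; trivial
    exact this

end Density

/-! ### Comaximal annihilators and the irreducibility of the tensor product. -/

section TensorIrreducible

variable {k : Type u} {g : Type v} {A : Type w} [Field k] [AddCommGroup g]
  [Module k g] [LieSuperalgebra k g] [CommRing A] [Algebra k A]

/-- The elements all of whose multiples act by zero form an ideal `J`. It contains every ideal in
the supremum that defines `annIdeal`, hence the supremum itself. -/
theorem ρ_tmul_eq_zero_of_mem_annIdeal {V : SuperRep.{u, max v w, w'} k (g ⊗[k] A)} {f : A}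
    (hf : f ∈ annIdeal V) (x : g) : V.ρ (x ⊗ₜ f) = 0 := by
  let J : Ideal A :=
    { carrier := {f | ∀ (a : A) (x : g), V.ρ (x ⊗ₜ (a * f)) = 0}
      add_mem' := by
        intro f f' hf hf' a x
        rw [mul_add, TensorProduct.tmul_add, map_add, hf, hf', add_zero]
      zero_mem' := by intro a x; simp
      smul_mem' := by
        intro c f hf a x
        rw [smul_eq_mul, ← mul_assoc]
        exact hf _ _ }
  have hle : annIdeal V ≤ J := sSup_le fun I hI f hf a x => hI x _ (I.mul_mem_left a hf)
  simpa using hle hf 1 x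

/-- A proper sum of the two annihilators would lie in a maximal ideal, which would then belong to
both supports. -/
theorem exists_add_eq_one_of_disjoint {V : SuperRep.{u, max v w, w₁} k (g ⊗[k] A)}
    {W : SuperRep.{u, max v w, w₂} k (g ⊗[k] A)} (h : Disjoint (support V) (support W)) :
    ∃ i ∈ annIdeal V, ∃ j ∈ annIdeal W, i + j = 1 := by
  have htop : annIdeal V ⊔ annIdeal W = ⊤ := by
    by_contra hne
    obtain ⟨m, hm, hle⟩ := Ideal.exists_le_maximal _ hne
    have hV : (⟨m, hm⟩ : MaximalSpectrum A) ∈ support V := le_sup_left.trans hle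
    have hW : (⟨m, hm⟩ : MaximalSpectrum A) ∈ support W := le_sup_right.trans hle
    exact Set.disjoint_left.1 h hV hW
  exact Submodule.mem_sup.1 (by rw [htop]; trivial)

/-- The tensor product of two irreducible modules with disjoint supports has no nontrivial stable
subspaces if the commutant of the first module consists of the scalars. -/
theorem tensor_eq_bot_or_eq_top {V : SuperRep.{u, max v w, w₁} k (g ⊗[k] A)}
    {W : SuperRep.{u, max v w, w₂} k (g ⊗[k] A)}
    (hV : ∀ N : Submodule k V.carrier, StableUnder V.ρ N → N = ⊥ ∨ N = ⊤)
    (hend : ∀ f : Module.End k V.carrier, (∀ x, V.ρ x * f = f * V.ρ x) →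
      ∃ c : k, ∀ m, f m = c • m)
    (hW : ∀ N : Submodule k W.carrier, StableUnder W.ρ N → N = ⊥ ∨ N = ⊤)
    (hd : Disjoint (support V) (support W)) {N : Submodule k (V.carrier ⊗[k] W.carrier)}
    (hN : StableUnder (SuperRep.tensorρ V W) N) : N = ⊥ ∨ N = ⊤ := by
  by_cases hne : N = ⊥
  · exact Or.inl hne
  right
  obtain ⟨i, hi, j, hj, hij⟩ := exists_add_eq_one_of_disjoint hd
  have hVi := ρ_tmul_eq_zero_of_mem_annIdeal hi
  have hWj := ρ_tmul_eq_zero_of_mem_annIdeal hj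
  have hVi' : ∀ (x : g) (a : A), V.ρ (x ⊗ₜ (a * i)) = 0 := fun x a =>
    ρ_tmul_eq_zero_of_mem_annIdeal (Ideal.mul_mem_left _ a hi) x
  have hWj' : ∀ (x : g) (a : A), W.ρ (x ⊗ₜ (a * j)) = 0 := fun x a =>
    ρ_tmul_eq_zero_of_mem_annIdeal (Ideal.mul_mem_left _ a hj) x
  have hsplit : ∀ (x : g) (a : A), x ⊗ₜ[k] a = x ⊗ₜ (a * i) + x ⊗ₜ (a * j) := by
    intro x a
    rw [← TensorProduct.tmul_add, ← mul_add, hij, mul_one]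
  have hV1 : ∀ (x : g) (a : A), V.ρ (x ⊗ₜ a) = V.ρ (x ⊗ₜ (a * j)) := by
    intro x a; rw [hsplit x a, map_add, hVi', zero_add]
  have hW1 : ∀ (x : g) (a : A), W.ρ (x ⊗ₜ a) = W.ρ (x ⊗ₜ (a * i)) := by
    intro x a; rw [hsplit x a, map_add, hWj', add_zero]
  have hN1 : ∀ x, ∀ m ∈ N, LinearMap.rTensor W.carrier (V.ρ x) m ∈ N := by
    intro x
    induction x with
    | zero => simp
    | add x y hx hy =>
      intro m hm
      rw [map_add, LinearMap.rTensor_add]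
      exact add_mem (hx m hm) (hy m hm)
    | tmul x a =>
      intro m hm
      obtain ⟨b, hb, c, hc, rfl⟩ := SuperSpace.exists_eq_add (k := k) x
      rw [TensorProduct.add_tmul, map_add, LinearMap.rTensor_add]
      -- Multiplication by `j` does not change the action on `V`, since `a j = a - a i`, and kills
      -- the action on `W`. The sign sits on the vanishing summand, so the odd case is no different.
      have h0 : LinearMap.rTensor W.carrier (V.ρ (b ⊗ₜ a)) =
          SuperRep.tensorρ V W (b ⊗ₜ (a * j)) := by
        refine TensorProduct.ext' fun m n => ?_
        rw [SuperRep.tensorρ_even V W (tmul_mem_mapPart hb _), hWj', ← hV1]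
        simp
      have h1 : LinearMap.rTensor W.carrier (V.ρ (c ⊗ₜ a)) =
          SuperRep.tensorρ V W (c ⊗ₜ (a * j)) := by
        refine TensorProduct.ext' fun m n => ?_
        rw [SuperRep.tensorρ_odd V W (tmul_mem_mapPart hc _), hWj', ← hV1]
        simp
      rw [h0, h1]
      exact add_mem (hN _ m hm) (hN _ m hm)
  obtain ⟨f, hf, hfN⟩ := exists_forall_tmul_mem hV hend hN1 hne
  -- All `n` with `V ⊗ n ⊆ N`; it contains the `f` just found and is stable because `N` is stable
  -- under `g ⊗ A i`, which acts through `W` only.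
  let W' : Submodule k W.carrier := ⨅ e : V.carrier, N.comap (TensorProduct.mk k _ _ e)
  have hmem : ∀ n, n ∈ W' ↔ ∀ e : V.carrier, e ⊗ₜ n ∈ N := by
    intro n; simp [W', Submodule.mem_iInf]
  have hst : StableUnder W.ρ W' := by
    intro x
    induction x with
    | zero => simp
    | add x y hx hy =>
      intro m hm
      rw [map_add]
      exact add_mem (hx m hm) (hy m hm)
    | tmul x a =>
      intro m hm
      obtain ⟨b, hb, c, hc, rfl⟩ := SuperSpace.exists_eq_add (k := k) x
      rw [hmem] at hm
      rw [TensorProduct.add_tmul, map_add, hmem]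
      intro e
      rw [LinearMap.add_apply, TensorProduct.tmul_add]
      refine add_mem ?_ ?_
      · have h := hN (b ⊗ₜ (a * i)) _ (hm e)
        rw [SuperRep.tensorρ_even V W (tmul_mem_mapPart hb _), hVi', ← hW1] at h
        simpa using h
      -- Starting from the parity image of `e` compensates the sign of the odd action.
      · have h := hN (c ⊗ₜ (a * i)) _ (hm (SuperSpace.parity k _ e))
        rw [SuperRep.tensorρ_odd V W (tmul_mem_mapPart hc _), hVi', ← hW1,
          SuperSpace.parity_parity] at h
        simpa using h
  have hW' : W' = ⊤ := by
    refine (hW _ hst).resolve_left fun h => hf ?_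
    rw [← Submodule.mem_bot k, ← h, hmem]
    exact hfN
  rw [eq_top_iff]
  intro z _
  induction z with
  | zero => exact zero_mem _
  | add x y hx hy => exact add_mem (hx trivial) (hy trivial)
  | tmul e n => exact (hmem n).1 (by rw [hW']; trivial) e

variable [CharZero k]

theorem mem_annIdeal_tensor {V : SuperRep.{u, max v w, w₁} k (g ⊗[k] A)}
    {W : SuperRep.{u, max v w, w₂} k (g ⊗[k] A)} :
    annIdeal V ⊓ annIdeal W ≤ annIdeal (V.tensor W) := by
  refine le_sSup ?_
  intro x f hf
  have hV := ρ_tmul_eq_zero_of_mem_annIdeal hf.1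
  have hW := ρ_tmul_eq_zero_of_mem_annIdeal hf.2
  obtain ⟨a, ha, b, hb, rfl⟩ := SuperSpace.exists_eq_add (k := k) x
  rw [TensorProduct.add_tmul, map_add]
  have h0 : (V.tensor W).ρ (a ⊗ₜ f) = 0 := by
    refine TensorProduct.ext' fun m n => ?_
    refine (SuperRep.tensorρ_even V W (tmul_mem_mapPart ha f) m n).trans ?_
    simp only [hV, hW, LinearMap.zero_apply, TensorProduct.zero_tmul, TensorProduct.tmul_zero,
      add_zero]
    rfl
  have h1 : (V.tensor W).ρ (b ⊗ₜ f) = 0 := by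
    refine TensorProduct.ext' fun m n => ?_
    refine (SuperRep.tensorρ_odd V W (tmul_mem_mapPart hb f) m n).trans ?_
    simp only [hV, hW, LinearMap.zero_apply, TensorProduct.zero_tmul, TensorProduct.tmul_zero,
      add_zero]
    rfl
  rw [h0, h1, add_zero]

/-- A maximal ideal is prime, so it contains one of two ideals whose intersection it contains. -/
theorem support_tensor_subset (V : SuperRep.{u, max v w, w₁} k (g ⊗[k] A))
    (W : SuperRep.{u, max v w, w₂} k (g ⊗[k] A)) :
    support (V.tensor W) ⊆ support V ∪ support W := by
  intro m hm
  have h : annIdeal V ⊓ annIdeal W ≤ m.asIdeal := mem_annIdeal_tensor.trans hm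
  exact (m.isMaximal.isPrime.inf_le).1 h

end TensorIrreducible

/-! ### Induced modules -/

section Signs

theorem superSign_add_right : ∀ i j l : ZMod 2,
    superSign i (j + l) = superSign i j * superSign i l := by decide

theorem superSign_add_left : ∀ i j l : ZMod 2,
    superSign (i + j) l = superSign i l * superSign j l := by decide

theorem superSign_comm : ∀ i j : ZMod 2, superSign i j = superSign j i := by decide

theorem superSign_eq (i j : ZMod 2) : superSign i j = 1 ∨ superSign i j = -1 := by
  unfold superSign; split_ifs <;> simp

end Signs

/-! ### An action of `L` on the enveloping superalgebra of a complementary subalgebra. -/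

section Induced

variable {k L : Type*} [Field k] [AddCommGroup L] [Module k L] [LieSuperalgebra k L]

/-- `p` is an even projection onto the subalgebra `n`, its kernel is a subalgebra, and `χ` restricts
to a character of the kernel. -/
structure IsTriangularPair (n : Submodule k L) (p : L →ₗ[k] n) (χ : L →ₗ[k] k) : Prop where
  proj : ∀ y : n, p y = y
  map_homog : ∀ {i : ZMod 2} {x : L}, x ∈ homog k L i → (p x : L) ∈ homog k L i
  br_mem : ∀ x ∈ n, ∀ y ∈ n, sbr k x y ∈ n
  ker_br : ∀ x y : L, p x = 0 → p y = 0 → p (sbr k x y) = 0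
  char_br : ∀ x y : L, p x = 0 → p y = 0 → χ (sbr k x y) = 0
  char_odd : ∀ x ∈ homog k L 1, χ x = 0

variable {n : Submodule k L} (p : L →ₗ[k] n) (χ : L →ₗ[k] k)

/-- The projection onto the kernel of `p`. -/
def kerProj : L →ₗ[k] L := LinearMap.id - n.subtype ∘ₗ p

omit [LieSuperalgebra k L] in
theorem kerProj_apply (x : L) : kerProj p x = x - p x := rfl

/-- The step of the recursion which defines the action on the tensor algebra. A pair `(t, F)`
records an element `t` and the function `x ↦ x t`. -/
noncomputable def stepFun (y : n) (s : TensorAlgebra k n × (L →ₗ[k] TensorAlgebra k n)) :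
    L →ₗ[k] TensorAlgebra k n :=
  LinearMap.mulRight k (TensorAlgebra.ι k y * s.1) ∘ₗ TensorAlgebra.ι k ∘ₗ p +
  s.2 ∘ₗ LieSuperalgebra.br.flip (y : L) ∘ₗ kerProj p +
  LinearMap.mulLeft k (TensorAlgebra.ι k y) ∘ₗ s.2 ∘ₗ SuperSpace.evenProj k L ∘ₗ kerProj p +
  LinearMap.mulLeft k (TensorAlgebra.ι k (p (SuperSpace.parity k L y))) ∘ₗ s.2 ∘ₗ
    SuperSpace.oddProj k L ∘ₗ kerProj p

theorem stepFun_apply (y : n) (s : TensorAlgebra k n × (L →ₗ[k] TensorAlgebra k n)) (x : L) :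
    stepFun p y s x = TensorAlgebra.ι k (p x) * (TensorAlgebra.ι k y * s.1) +
      s.2 (sbr k (kerProj p x) y) +
      TensorAlgebra.ι k y * s.2 (SuperSpace.evenProj k L (kerProj p x)) +
      TensorAlgebra.ι k (p (SuperSpace.parity k L y)) *
        s.2 (SuperSpace.oddProj k L (kerProj p x)) := rfl

/-- The operator of left multiplication by `y` on pairs `(t, x ↦ x t)`. -/
noncomputable def stepOp :
    n →ₗ[k] Module.End k (TensorAlgebra k n × (L →ₗ[k] TensorAlgebra k n)) :=
  LinearMap.mk₂ k (fun y s => (TensorAlgebra.ι k y * s.1, stepFun p y s))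
    (by
      intro y y' s
      refine Prod.ext (by simp [add_mul]) (LinearMap.ext fun x => ?_)
      simp only [Prod.snd_add, LinearMap.add_apply, stepFun_apply, Submodule.coe_add, map_add,
        add_mul, mul_add]
      abel)
    (by
      intro c y s
      refine Prod.ext (by simp) (LinearMap.ext fun x => ?_)
      simp only [Prod.smul_snd, LinearMap.smul_apply, stepFun_apply, Submodule.coe_smul, map_smul,
        smul_mul_assoc, mul_smul_comm, smul_add])
    (by
      intro y s s'
      refine Prod.ext (by simp [mul_add]) (LinearMap.ext fun x => ?_)
      simp only [Prod.snd_add, Prod.fst_add, LinearMap.add_apply, stepFun_apply, mul_add]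
      abel)
    (by
      intro c y s
      refine Prod.ext (by simp) (LinearMap.ext fun x => ?_)
      simp only [Prod.smul_snd, Prod.smul_fst, LinearMap.smul_apply, stepFun_apply,
        mul_smul_comm, smul_add])

/-- The pair `(1, x ↦ x 1)`. -/
noncomputable def initState : TensorAlgebra k n × (L →ₗ[k] TensorAlgebra k n) :=
  (1, TensorAlgebra.ι k ∘ₗ p + Algebra.linearMap k (TensorAlgebra k n) ∘ₗ χ ∘ₗ kerProj p)

/-- The pair `(t, x ↦ x t)`. -/
noncomputable def actState :
    TensorAlgebra k n →ₗ[k] TensorAlgebra k n × (L →ₗ[k] TensorAlgebra k n) :=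
  LinearMap.applyₗ (initState p χ) ∘ₗ (TensorAlgebra.lift k (stepOp p)).toLinearMap

/-- The operators on the tensor algebra of `n` which induce the action on the induced module. -/
noncomputable def preAct : L →ₗ[k] Module.End k (TensorAlgebra k n) :=
  (LinearMap.snd k _ _ ∘ₗ actState p χ).flip

theorem actState_one : actState p χ 1 = initState p χ := by
  simp [actState]

theorem actState_ι_mul (y : n) (t : TensorAlgebra k n) :
    actState p χ (TensorAlgebra.ι k y * t) = stepOp p y (actState p χ t) := by
  simp [actState]

omit [LieSuperalgebra k L] in
theorem tensorAlgebra_induction_left {P : TensorAlgebra k n → Prop} (h1 : P 1)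
    (hadd : ∀ s t, P s → P t → P (s + t)) (hsmul : ∀ (c : k) t, P t → P (c • t))
    (hι : ∀ y t, P t → P (TensorAlgebra.ι k y * t)) (t : TensorAlgebra k n) : P t := by
  have key : ∀ a : TensorAlgebra k n, ∀ t, P t → P (a * t) := by
    intro a
    induction a using TensorAlgebra.induction with
    | algebraMap c => intro t ht; rw [← Algebra.smul_def]; exact hsmul c t ht
    | ι y => exact hι y
    | mul a b ha hb => intro t ht; rw [mul_assoc]; exact ha _ (hb t ht)
    | add a b ha hb => intro t ht; rw [add_mul]; exact hadd _ _ (ha t ht) (hb t ht)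
  simpa using key t 1 h1

theorem actState_fst (t : TensorAlgebra k n) : (actState p χ t).1 = t := by
  induction t using tensorAlgebra_induction_left with
  | h1 => rw [actState_one]; rfl
  | hadd s t hs ht => rw [map_add, Prod.fst_add, hs, ht]
  | hsmul c t ht => rw [map_smul, Prod.smul_fst, ht]
  | hι y t ht =>
    rw [actState_ι_mul]
    change TensorAlgebra.ι k y * (actState p χ t).1 = _
    rw [ht]

/-- The recursion behind the action: the `n`-part of `x` multiplies on the left, and its kernel part
is commuted past `y`. The parity involution of `y` encodes the sign without asking `y` to be
homogeneous. -/
theorem preAct_ι_mul (x : L) (y : n) (t : TensorAlgebra k n) :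
    preAct p χ x (TensorAlgebra.ι k y * t) =
      TensorAlgebra.ι k (p x) * (TensorAlgebra.ι k y * t) +
      preAct p χ (sbr k (kerProj p x) y) t +
      TensorAlgebra.ι k y * preAct p χ (SuperSpace.evenProj k L (kerProj p x)) t +
      TensorAlgebra.ι k (p (SuperSpace.parity k L y)) *
        preAct p χ (SuperSpace.oddProj k L (kerProj p x)) t := by
  change (actState p χ (TensorAlgebra.ι k y * t)).2 x = _
  rw [actState_ι_mul]
  change stepFun p y (actState p χ t) x = _
  rw [stepFun_apply, actState_fst]
  rfl

theorem preAct_one (x : L) : preAct p χ x 1 =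
    TensorAlgebra.ι k (p x) + algebraMap k _ (χ (kerProj p x)) := by
  change (actState p χ 1).2 x = _
  rw [actState_one]
  rfl

/-- The span of the two-sided ideal generated by the defining relations of the enveloping
superalgebra of `n`. -/
def relIdeal (n : Submodule k L) : Submodule k (TensorAlgebra k n) :=
  Submodule.span k {r | ∃ (i j : ZMod 2) (x y z : n) (s t : TensorAlgebra k n),
    (x : L) ∈ homog k L i ∧ (y : L) ∈ homog k L j ∧ (z : L) = sbr k (x : L) y ∧
    r = s * (TensorAlgebra.ι k x * TensorAlgebra.ι k y -
      superSign i j • (TensorAlgebra.ι k y * TensorAlgebra.ι k x) - TensorAlgebra.ι k z) * t}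

theorem mul_mem_relIdeal (a : TensorAlgebra k n) {r : TensorAlgebra k n} (hr : r ∈ relIdeal n) :
    a * r ∈ relIdeal n := by
  induction hr using Submodule.span_induction with
  | mem r hr =>
    obtain ⟨i, j, x, y, z, s, t, hx, hy, hz, rfl⟩ := hr
    exact Submodule.subset_span ⟨i, j, x, y, z, a * s, t, hx, hy, hz, by simp only [mul_assoc]⟩
  | zero => simp
  | add x y _ _ hx hy => rw [mul_add]; exact add_mem hx hy
  | smul c x _ hx => rw [mul_smul_comm]; exact Submodule.smul_mem _ _ hx

/-- The augmentation of the tensor algebra kills all letters, hence all relations, but not `1`. -/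
theorem one_not_mem_relIdeal : (1 : TensorAlgebra k n) ∉ relIdeal n := by
  intro h
  have hle : relIdeal n ≤ LinearMap.ker (TensorAlgebra.algebraMapInv (R := k) (M := n)).toLinearMap := by
    refine Submodule.span_le.2 ?_
    rintro _ ⟨i, j, x, y, z, s, t, hx, hy, hz, rfl⟩
    simp [TensorAlgebra.algebraMapInv]
  have := hle h
  simp at this

variable {p χ}

namespace IsTriangularPair

variable (hp : IsTriangularPair n p χ)
include hp

theorem preAct_coe (y : n) (t : TensorAlgebra k n) :
    preAct p χ (y : L) t = TensorAlgebra.ι k y * t := by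
  have h0 : kerProj p (y : L) = 0 := by rw [kerProj_apply, hp.proj, sub_self]
  induction t using tensorAlgebra_induction_left with
  | h1 => rw [preAct_one, h0, hp.proj, map_zero, map_zero, add_zero, mul_one]
  | hadd s t hs ht => rw [map_add, hs, ht, mul_add]
  | hsmul c t ht => rw [map_smul, ht, mul_smul_comm]
  | hι z t ht =>
    rw [preAct_ι_mul, h0, hp.proj, zero_sbr]
    simp

omit hp in
theorem preAct_one_of_ker {x : L} (hx : p x = 0) : preAct p χ x 1 = χ x • 1 := by
  rw [preAct_one, hx, kerProj_apply, hx]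
  simp [Algebra.algebraMap_eq_smul_one]

theorem preAct_ι_mul_of_ker {i j : ZMod 2} {x : L} {y : n} (hx : p x = 0) (hi : x ∈ homog k L i)
    (hj : (y : L) ∈ homog k L j) (t : TensorAlgebra k n) :
    preAct p χ x (TensorAlgebra.ι k y * t) = preAct p χ (sbr k x y) t +
      superSign i j • (TensorAlgebra.ι k y * preAct p χ x t) := by
  have h0 : kerProj p x = x := by rw [kerProj_apply, hx]; simp
  rw [preAct_ι_mul, hx, h0]
  rcases SuperRep.zmod2_cases i with rfl | rfl
  · rw [SuperSpace.evenProj_even hi, SuperSpace.oddProj_even hi]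
    simp [superSign]
  · rw [SuperSpace.evenProj_odd hi, SuperSpace.oddProj_odd hi]
    rcases SuperRep.zmod2_cases j with rfl | rfl
    · rw [SuperSpace.parity_even hj, hp.proj]
      simp [superSign]
    · rw [SuperSpace.parity_odd hj, map_neg, hp.proj]
      simp [superSign]

theorem exists_homog (y : n) : ∃ a b : n, (a : L) ∈ homog k L 0 ∧
    (b : L) ∈ homog k L 1 ∧ y = a + b := by
  obtain ⟨a, ha, b, hb, hab⟩ := SuperSpace.exists_eq_add (k := k) (y : L)
  exact ⟨p a, p b, hp.map_homog ha, hp.map_homog hb, by rw [← map_add, ← hab, hp.proj]⟩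

/-- The failure of the operators to be an action. -/
noncomputable def defect (_ : IsTriangularPair n p χ) (i j : ZMod 2) (x y : L)
    (t : TensorAlgebra k n) : TensorAlgebra k n :=
  preAct p χ x (preAct p χ y t) - superSign i j • preAct p χ y (preAct p χ x t) -
    preAct p χ (sbr k x y) t

theorem defect_coe {i j : ZMod 2} {x y : n} (hx : (x : L) ∈ homog k L i)
    (hy : (y : L) ∈ homog k L j) (t : TensorAlgebra k n) :
    hp.defect i j x y t ∈ relIdeal n := by
  have h := hp.preAct_coe ⟨_, hp.br_mem _ x.2 _ y.2⟩ t
  simp only at h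
  refine Submodule.subset_span ⟨i, j, x, y, ⟨_, hp.br_mem _ x.2 _ y.2⟩, 1, t, hx, hy, rfl, ?_⟩
  rw [defect, h, hp.preAct_coe, hp.preAct_coe, hp.preAct_coe, hp.preAct_coe, one_mul, sub_mul,
    sub_mul, smul_mul_assoc, mul_assoc, mul_assoc]

theorem defect_ker_coe {i j : ZMod 2} {x : L} {y : n} (h : p x = 0) (hx : x ∈ homog k L i)
    (hy : (y : L) ∈ homog k L j) (t : TensorAlgebra k n) :
    hp.defect i j x y t = 0 := by
  rw [defect, hp.preAct_coe, hp.preAct_coe, hp.preAct_ι_mul_of_ker h hx hy]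
  abel

theorem defect_swap {i j : ZMod 2} {x y : L} (hx : x ∈ homog k L i)
    (hy : y ∈ homog k L j) (t : TensorAlgebra k n) :
    hp.defect j i y x t = -(superSign i j • hp.defect i j x y t) := by
  have h := LieSuperalgebra.br_skew (k := k) hy hx
  rw [defect, defect, sbr, h, map_neg, map_zsmul, superSign_comm j i]
  rcases superSign_eq i j with e | e <;> rw [e] <;> simp <;> abel

theorem defect_add (i j : ZMod 2) (x y z : L) (t : TensorAlgebra k n) :
    hp.defect i j x (y + z) t = hp.defect i j x y t + hp.defect i j x z t := by
  simp only [defect, map_add, LinearMap.add_apply, smul_add]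
  abel

theorem add_defect (i j : ZMod 2) (x y z : L) (t : TensorAlgebra k n) :
    hp.defect i j (x + y) z t = hp.defect i j x z t + hp.defect i j y z t := by
  simp only [defect, map_add, LinearMap.add_apply, add_sbr, smul_add]
  abel

/-- By the super Jacobi identity, commuting `x` and `x'` past the letter `y` leaves only defects
evaluated at the shorter `t`. This makes an induction on `t` possible. -/
theorem defect_ι_mul {i j l : ZMod 2} {x x' : L} {y : n} (h : p x = 0) (h' : p x' = 0)
    (hx : x ∈ homog k L i) (hx' : x' ∈ homog k L j)
    (hy : (y : L) ∈ homog k L l) (t : TensorAlgebra k n) :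
    hp.defect i j x x' (TensorAlgebra.ι k y * t) =
      hp.defect i (j + l) x (sbr k x' y) t - superSign i j • hp.defect j (i + l) x' (sbr k x y) t +
      (superSign j l * superSign i l) • (TensorAlgebra.ι k y * hp.defect i j x x' t) := by
  have hJ := LieSuperalgebra.br_jacobi (k := k) (y : L) hx hx'
  have hb := LieSuperalgebra.br_mem (k := k) hx hx'
  have hk := hp.ker_br x x' h h'
  simp only [defect]
  rw [hp.preAct_ι_mul_of_ker h' hx' hy, hp.preAct_ι_mul_of_ker h hx hy,
    hp.preAct_ι_mul_of_ker hk hb hy, map_add, map_add, map_zsmul, map_zsmul,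
    hp.preAct_ι_mul_of_ker h hx hy, hp.preAct_ι_mul_of_ker h' hx' hy]
  simp only [sbr] at hJ ⊢
  rw [hJ, map_add, map_zsmul, superSign_add_right, superSign_add_right, superSign_add_left,
    superSign_comm j i]
  simp only [LinearMap.add_apply, LinearMap.smul_apply, mul_sub, mul_smul_comm]
  rcases superSign_eq i j with e | e <;> rcases superSign_eq i l with e' | e' <;>
    rcases superSign_eq j l with e'' | e'' <;> rw [e, e', e''] <;> simp <;> abel

theorem defect_mem_of_ker {i j : ZMod 2} {x x' : L} (h : p x = 0) (h' : p x' = 0)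
    (hx : x ∈ homog k L i) (hx' : x' ∈ homog k L j) (t : TensorAlgebra k n) :
    hp.defect i j x x' t ∈ relIdeal n := by
  induction t using tensorAlgebra_induction_left generalizing i j x x' with
  | h1 =>
    -- On `1` the kernel acts by the scalars `χ`, which commute. The sign is harmless because `χ`
    -- vanishes on odd elements.
    have : hp.defect i j x x' 1 = 0 := by
      rw [defect, preAct_one_of_ker h, preAct_one_of_ker h', map_smul, map_smul,
        preAct_one_of_ker h, preAct_one_of_ker h', preAct_one_of_ker (hp.ker_br _ _ h h'),
        hp.char_br _ _ h h']
      rcases SuperRep.zmod2_cases i with rfl | rfl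
      · simp [superSign, smul_smul, mul_comm]
      · rw [hp.char_odd x hx]; simp
    rw [this]; exact zero_mem _
  | hadd s t hs ht =>
    have : hp.defect i j x x' (s + t) = hp.defect i j x x' s + hp.defect i j x x' t := by
      simp only [defect, map_add, smul_add]; abel
    rw [this]; exact add_mem (hs h h' hx hx') (ht h h' hx hx')
  | hsmul c t ht =>
    have : hp.defect i j x x' (c • t) = c • hp.defect i j x x' t := by
      simp only [defect, map_smul, smul_sub]
      rw [smul_comm c]
    rw [this]; exact Submodule.smul_mem _ _ (ht h h' hx hx')
  | hι y t ht =>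
    -- Brackets such as `[x', y]` leave the kernel of `p`. Their `n`-part has no defect against a
    -- kernel element, and their kernel part is covered by the induction hypothesis, which is stated
    -- for all pairs.
    have gen : ∀ {i j : ZMod 2} {x z : L}, p x = 0 → x ∈ homog k L i →
        z ∈ homog k L j → hp.defect i j x z t ∈ relIdeal n := by
      intro i j x z h hx hz
      have e : z = (p z : L) + kerProj p z := by rw [kerProj_apply]; abel
      rw [e, hp.defect_add, hp.defect_ker_coe h hx (hp.map_homog hz), zero_add]
      exact ht h (by rw [kerProj_apply, map_sub, hp.proj, sub_self]) hx
        (sub_mem hz (hp.map_homog hz))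
    have step : ∀ {l : ZMod 2} {y : n}, (y : L) ∈ homog k L l →
        hp.defect i j x x' (TensorAlgebra.ι k y * t) ∈ relIdeal n := by
      intro l y hy
      rw [hp.defect_ι_mul h h' hx hx' hy]
      exact add_mem (sub_mem (gen h hx (LieSuperalgebra.br_mem hx' hy))
        (zsmul_mem (gen h' hx' (LieSuperalgebra.br_mem hx hy)) _))
        (zsmul_mem (mul_mem_relIdeal _ (ht h h' hx hx')) _)
    obtain ⟨a, b, ha, hb, rfl⟩ := hp.exists_homog y
    have : hp.defect i j x x' (TensorAlgebra.ι k (a + b) * t) =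
        hp.defect i j x x' (TensorAlgebra.ι k a * t) +
        hp.defect i j x x' (TensorAlgebra.ι k b * t) := by
      simp only [defect, map_add, add_mul, smul_add]; abel
    rw [this]
    exact add_mem (step ha) (step hb)

theorem defect_mem {i j : ZMod 2} {x y : L} (hx : x ∈ homog k L i)
    (hy : y ∈ homog k L j) (t : TensorAlgebra k n) : hp.defect i j x y t ∈ relIdeal n := by
  have hk : ∀ x, p (kerProj p x) = 0 := fun x => by
    rw [kerProj_apply, map_sub, hp.proj, sub_self]
  have e : ∀ x, x = (p x : L) + kerProj p x := fun x => by rw [kerProj_apply]; abel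
  have hm : ∀ {i x}, x ∈ homog k L i → kerProj p x ∈ homog k L i :=
    fun hx => sub_mem hx (hp.map_homog hx)
  rw [e x, e y, hp.defect_add, hp.add_defect, hp.add_defect]
  refine add_mem (add_mem ?_ ?_) (add_mem ?_ ?_)
  · exact hp.defect_coe (hp.map_homog hx) (hp.map_homog hy) t
  · rw [hp.defect_ker_coe (hk x) (hm hx) (hp.map_homog hy)]; exact zero_mem _
  · rw [hp.defect_swap (hm hy) (hp.map_homog hx), hp.defect_ker_coe (hk y) (hm hy) (hp.map_homog hx)]
    simp
  · exact hp.defect_mem_of_ker (hk x) (hk y) (hm hx) (hm hy) t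

/-- Moving `x` through a defining relation reproduces that relation on the left of `x t`, up to
sign; by Jacobi the remaining terms are defects, already known to lie in `relIdeal`. -/
theorem preAct_rel_mul {i l m : ZMod 2} {x : L} {y y' z : n} (h : p x = 0)
    (hx : x ∈ homog k L i) (hy : (y : L) ∈ homog k L l)
    (hy' : (y' : L) ∈ homog k L m) (hz : (z : L) = sbr k (y : L) y')
    (t : TensorAlgebra k n) :
    preAct p χ x ((TensorAlgebra.ι k y * TensorAlgebra.ι k y' -
      superSign l m • (TensorAlgebra.ι k y' * TensorAlgebra.ι k y) - TensorAlgebra.ι k z) * t) =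
    hp.defect (i + l) m (sbr k x y) y' t + superSign i l • hp.defect l (i + m) y (sbr k x y') t +
      (superSign i l * superSign i m) • ((TensorAlgebra.ι k y * TensorAlgebra.ι k y' -
      superSign l m • (TensorAlgebra.ι k y' * TensorAlgebra.ι k y) - TensorAlgebra.ι k z) *
        preAct p χ x t) := by
  have hJ := LieSuperalgebra.br_jacobi (k := k) (y' : L) hx hy
  have hzm : (z : L) ∈ homog k L (l + m) := hz ▸ LieSuperalgebra.br_mem (k := k) hy hy'
  simp only [defect, sub_mul, smul_mul_assoc, mul_assoc, map_sub, map_zsmul]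
  rw [hp.preAct_ι_mul_of_ker h hx hy, hp.preAct_ι_mul_of_ker h hx hy',
    hp.preAct_ι_mul_of_ker h hx hzm, hp.preAct_ι_mul_of_ker h hx hy',
    hp.preAct_ι_mul_of_ker h hx hy, hp.preAct_coe, hp.preAct_coe, hp.preAct_coe, hp.preAct_coe, hz]
  simp only [sbr] at hJ ⊢
  rw [hJ, map_add, map_zsmul, superSign_add_right, superSign_add_right, superSign_add_left,
    superSign_comm l i]
  simp only [LinearMap.add_apply, LinearMap.smul_apply, mul_add, mul_smul_comm]
  rcases superSign_eq i l with e | e <;> rcases superSign_eq i m with e' | e' <;>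
    rcases superSign_eq l m with e'' | e'' <;> rw [e, e', e''] <;> simp <;> abel

theorem preAct_mem_relIdeal (x : L) {r : TensorAlgebra k n} (hr : r ∈ relIdeal n) :
    preAct p χ x r ∈ relIdeal n := by
  have hk : ∀ x, p (kerProj p x) = 0 := fun x => by
    rw [kerProj_apply, map_sub, hp.proj, sub_self]
  have e : ∀ x, x = (p x : L) + kerProj p x := fun x => by rw [kerProj_apply]; abel
  have hm : ∀ {i x}, x ∈ homog k L i → kerProj p x ∈ homog k L i :=
    fun hx => sub_mem hx (hp.map_homog hx)
  have key : ∀ (l m : ZMod 2) (y y' z : n), (y : L) ∈ homog k L l →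
      (y' : L) ∈ homog k L m → (z : L) = sbr k (y : L) y' → ∀ t s : TensorAlgebra k n,
      ∀ i x, p x = 0 → x ∈ homog k L i → preAct p χ x (s *
        (TensorAlgebra.ι k y * TensorAlgebra.ι k y' -
          superSign l m • (TensorAlgebra.ι k y' * TensorAlgebra.ι k y) - TensorAlgebra.ι k z) * t) ∈
        relIdeal n := by
    intro l m y y' z hy hy' hz t s
    induction s using tensorAlgebra_induction_left with
    | h1 =>
      intro i x h hx
      rw [one_mul, hp.preAct_rel_mul h hx hy hy' hz]
      refine add_mem (add_mem (hp.defect_mem (LieSuperalgebra.br_mem hx hy) hy' t)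
        (zsmul_mem (hp.defect_mem hy (LieSuperalgebra.br_mem hx hy') t) _)) (zsmul_mem ?_ _)
      exact Submodule.subset_span ⟨l, m, y, y', z, 1, _, hy, hy', hz, by rw [one_mul]⟩
    | hadd s s' hs hs' =>
      intro i x h hx
      rw [add_mul, add_mul, map_add]
      exact add_mem (hs i x h hx) (hs' i x h hx)
    | hsmul c s hs =>
      intro i x h hx
      rw [smul_mul_assoc, smul_mul_assoc, map_smul]
      exact Submodule.smul_mem _ _ (hs i x h hx)
    | hι a s hs =>
      intro i x h hx
      have step : ∀ {j : ZMod 2} {a : n}, (a : L) ∈ homog k L j →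
          preAct p χ x (TensorAlgebra.ι k a * s *
            (TensorAlgebra.ι k y * TensorAlgebra.ι k y' -
            superSign l m • (TensorAlgebra.ι k y' * TensorAlgebra.ι k y) -
            TensorAlgebra.ι k z) * t) ∈ relIdeal n := by
        intro j a ha
        rw [mul_assoc, mul_assoc, hp.preAct_ι_mul_of_ker h hx ha, ← mul_assoc]
        refine add_mem ?_ (zsmul_mem (mul_mem_relIdeal _ (hs i x h hx)) _)
        -- The bracket `[x, a]` splits into an `n`-part, which multiplies the ideal from the left,
        -- and a kernel part, to which the induction hypothesis for the shorter prefix `s` applies.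
        rw [e (sbr k x (a : L)), map_add, LinearMap.add_apply, hp.preAct_coe]
        refine add_mem (mul_mem_relIdeal _ ?_) (hs _ _ (hk _) (hm (LieSuperalgebra.br_mem hx ha)))
        exact Submodule.subset_span ⟨l, m, y, y', z, s, t, hy, hy', hz, rfl⟩
      obtain ⟨b, c, hb, hc, rfl⟩ := hp.exists_homog a
      rw [map_add, add_mul, add_mul, add_mul, map_add]
      exact add_mem (step hb) (step hc)
  rw [e x, map_add, LinearMap.add_apply, hp.preAct_coe]
  refine add_mem (mul_mem_relIdeal _ hr) ?_
  obtain ⟨x0, h0, x1, h1, hx⟩ := SuperSpace.exists_eq_add (k := k) x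
  have hxk : kerProj p x = kerProj p x0 + kerProj p x1 := by rw [hx, map_add]
  rw [hxk, map_add, LinearMap.add_apply]
  induction hr using Submodule.span_induction with
  | mem r hr =>
    obtain ⟨l, m, y, y', z, s, t, hy, hy', hz, rfl⟩ := hr
    exact add_mem (key l m y y' z hy hy' hz t s 0 _ (hk _) (hm h0))
      (key l m y y' z hy hy' hz t s 1 _ (hk _) (hm h1))
  | zero => simp
  | add r s _ _ hr hs =>
    rw [map_add, map_add, add_add_add_comm]
    exact add_mem hr hs
  | smul c r _ hr =>
    rw [map_smul, map_smul, ← smul_add]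
    exact Submodule.smul_mem _ _ hr

/-- The action on the induced module. -/
noncomputable def inducedρ : L →ₗ[k] Module.End k (TensorAlgebra k n ⧸ relIdeal n) where
  toFun x := (relIdeal n).mapQ (relIdeal n) (preAct p χ x) fun _ hr => hp.preAct_mem_relIdeal x hr
  map_add' x y := by
    refine LinearMap.ext fun m => ?_
    obtain ⟨t, rfl⟩ := (relIdeal n).mkQ_surjective m
    simp
  map_smul' c x := by
    refine LinearMap.ext fun m => ?_
    obtain ⟨t, rfl⟩ := (relIdeal n).mkQ_surjective m
    simp

theorem isSuperHom_inducedρ : IsSuperHom hp.inducedρ := by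
  intro i j x y hx hy
  refine LinearMap.ext fun m => ?_
  obtain ⟨t, rfl⟩ := (relIdeal n).mkQ_surjective m
  have h := hp.defect_mem hx hy t
  rw [← Submodule.Quotient.mk_eq_zero, defect, sub_sub, Submodule.Quotient.mk_sub, sub_eq_zero] at h
  exact h

theorem inducedρ_mk_one {x : L} (hx : p x = 0) :
    hp.inducedρ x ((relIdeal n).mkQ 1) = χ x • (relIdeal n).mkQ 1 := by
  change (relIdeal n).mkQ (preAct p χ x 1) = _
  rw [preAct_one_of_ker hx, map_smul]

omit hp in
theorem mkQ_one_ne_zero : (relIdeal n).mkQ (1 : TensorAlgebra k n) ≠ 0 := by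
  rw [Submodule.mkQ_apply, Ne, Submodule.Quotient.mk_eq_zero]
  exact one_not_mem_relIdeal

end IsTriangularPair

end Induced

/-! ### Consequences of the triangular decomposition -/

section Parity

variable {k L : Type*} [Field k] [AddCommGroup L] [Module k L] [LieSuperalgebra k L]

theorem SuperSpace.parity_sbr (x y : L) : SuperSpace.parity k L (sbr k x y) =
    sbr k (SuperSpace.parity k L x) (SuperSpace.parity k L y) := by
  have key : ∀ (i j : ZMod 2) (x y : L), x ∈ homog k L i → y ∈ homog k L j →
      SuperSpace.parity k L (sbr k x y) =
        sbr k (SuperSpace.parity k L x) (SuperSpace.parity k L y) := by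
    intro i j x y hx hy
    have h := LieSuperalgebra.br_mem (k := k) hx hy
    rcases SuperRep.zmod2_cases i with rfl | rfl <;> rcases SuperRep.zmod2_cases j with rfl | rfl
    · rw [add_zero] at h
      rw [parity_even hx, parity_even hy, parity_even h]
    · rw [zero_add] at h
      rw [parity_even hx, parity_odd hy, parity_odd h]; simp [sbr]
    · rw [add_zero] at h
      rw [parity_odd hx, parity_even hy, parity_odd h]; simp [sbr]
    · rw [show (1 + 1 : ZMod 2) = 0 from rfl] at h
      rw [parity_odd hx, parity_odd hy, parity_even h]; simp [sbr]
  obtain ⟨a, ha, b, hb, rfl⟩ := SuperSpace.exists_eq_add (k := k) x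
  obtain ⟨c, hc, d, hd, rfl⟩ := SuperSpace.exists_eq_add (k := k) y
  rw [map_add, map_add, add_sbr, sbr_add, sbr_add, add_sbr, sbr_add, sbr_add, map_add, map_add,
    map_add, key _ _ _ _ ha hc, key _ _ _ _ ha hd, key _ _ _ _ hb hc, key _ _ _ _ hb hd]

theorem mem_homog_zero_of_parity [CharZero k] {V : Type*} [AddCommGroup V] [Module k V]
    [SuperSpace k V] {x : V} (h : SuperSpace.parity k V x = x) : x ∈ homog k V 0 := by
  obtain ⟨a, ha, b, hb, rfl⟩ := SuperSpace.exists_eq_add (k := k) x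
  rw [map_add, SuperSpace.parity_even ha, SuperSpace.parity_odd hb, add_right_inj,
    neg_eq_iff_add_eq_zero, ← two_smul k, smul_eq_zero] at h
  rw [h.resolve_left two_ne_zero, add_zero]
  exact ha

theorem mem_homog_one_of_parity [CharZero k] {V : Type*} [AddCommGroup V] [Module k V]
    [SuperSpace k V] {x : V} (h : SuperSpace.parity k V x = -x) : x ∈ homog k V 1 := by
  obtain ⟨a, ha, b, hb, rfl⟩ := SuperSpace.exists_eq_add (k := k) x
  rw [map_add, SuperSpace.parity_even ha, SuperSpace.parity_odd hb, neg_add, add_left_inj,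
    ← add_eq_zero_iff_eq_neg, ← two_smul k, smul_eq_zero] at h
  rw [h.resolve_left two_ne_zero, zero_add]
  exact hb

end Parity

namespace TriangularDecomposition

variable {k g : Type*} [Field k] [CharZero k] [AddCommGroup g] [Module k g] [LieSuperalgebra k g]
  (T : TriangularDecomposition k g)

variable {T}

theorem IsRootVector.br {p q : ZMod 2} {d e : ℤ} {α β : Module.Dual k T.h} {x y : g}
    (hx : T.IsRootVector p d α x) (hy : T.IsRootVector q e β y) :
    T.IsRootVector (p + q) (d + e) (α + β) (sbr k x y) := by
  refine ⟨LieSuperalgebra.br_mem hx.mem_homog hy.mem_homog,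
    T.distinguished.br_mem d e x hx.degree y hy.degree, fun t => ?_⟩
  have h := LieSuperalgebra.br_jacobi (k := k) y (t : homog k g 0).2 hx.mem_homog
  have h1 := hx.weight t
  have h2 := hy.weight t
  simp only [sbr] at h h1 h2 ⊢
  rw [h, h1, h2]
  simp [superSign, add_smul]

theorem nil_induction (ε : ℤ) {P : g → Prop} (h0 : P 0) (hadd : ∀ x y, P x → P y → P (x + y))
    (hs : ∀ (c : k) (x : g), P x → P (c • x))
    (hroot : ∀ p d α x, T.IsRootVector p d α x → (0 < ε * d ∨ (d = 0 ∧ 0 < ε * T.ht α)) → P x)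
    {x : g} (hx : x ∈ nilSubspace T.gr T.h T.ht ε) : P x := by
  induction hx using Submodule.span_induction with
  | mem x hx =>
    obtain ⟨p, d, α, h1, h2, h3, h4⟩ := hx
    exact hroot p d α x ⟨h1, h2, h3⟩ h4
  | zero => exact h0
  | add x y _ _ hx hy => exact hadd x y hx hy
  | smul c x _ hx => exact hs c x hx

theorem sbr_mem_nilSubspace {ε : ℤ} {x y : g} (hx : x ∈ nilSubspace T.gr T.h T.ht ε)
    (hy : y ∈ nilSubspace T.gr T.h T.ht ε) : sbr k x y ∈ nilSubspace T.gr T.h T.ht ε := by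
  refine nil_induction ε (P := fun x => sbr k x y ∈ nilSubspace T.gr T.h T.ht ε) ?_ ?_ ?_ ?_ hx
  · rw [zero_sbr]; exact zero_mem _
  · intro a b ha hb; rw [add_sbr]; exact add_mem ha hb
  · intro c a ha; rw [smul_sbr]; exact Submodule.smul_mem _ _ ha
  intro p d α x hx h
  refine nil_induction ε (P := fun y => sbr k x y ∈ nilSubspace T.gr T.h T.ht ε) ?_ ?_ ?_ ?_ hy
  · rw [sbr_zero]; exact zero_mem _
  · intro a b ha hb; rw [sbr_add]; exact add_mem ha hb
  · intro c a ha; rw [sbr_smul]; exact Submodule.smul_mem _ _ ha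
  intro q e β y hy h'
  have hxy := hx.br hy
  refine Submodule.subset_span ⟨_, _, _, hxy.mem_homog, hxy.degree, hxy.weight, ?_⟩
  rcases h with h | ⟨rfl, h⟩ <;> rcases h' with h' | ⟨rfl, h'⟩
  · left; rw [mul_add]; omega
  · left; simpa using h
  · left; simpa using h'
  · right; rw [map_add, mul_add]; exact ⟨rfl, by linarith⟩

theorem parity_mem_nilSubspace {ε : ℤ} {x : g} (hx : x ∈ nilSubspace T.gr T.h T.ht ε) :
    SuperSpace.parity k g x ∈ nilSubspace T.gr T.h T.ht ε := by
  refine nil_induction ε (P := fun x => SuperSpace.parity k g x ∈ nilSubspace T.gr T.h T.ht ε)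
    ?_ ?_ ?_ ?_ hx
  · rw [map_zero]; exact zero_mem _
  · intro a b ha hb; rw [map_add]; exact add_mem ha hb
  · intro c a ha; rw [map_smul]; exact Submodule.smul_mem _ _ ha
  intro p d α x hx h
  have hm : x ∈ nilSubspace T.gr T.h T.ht ε :=
    Submodule.subset_span ⟨_, _, _, hx.mem_homog, hx.degree, hx.weight, h⟩
  have hp := hx.mem_homog
  rcases SuperRep.zmod2_cases p with rfl | rfl
  · rwa [SuperSpace.parity_even hp]
  · rw [SuperSpace.parity_odd hp]; exact neg_mem hm

theorem sbr_cartan_mem_nilSubspace {ε : ℤ} (t : T.h) {x : g}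
    (hx : x ∈ nilSubspace T.gr T.h T.ht ε) :
    sbr k ((t : homog k g 0) : g) x ∈ nilSubspace T.gr T.h T.ht ε := by
  refine nil_induction ε
    (P := fun x => sbr k ((t : homog k g 0) : g) x ∈ nilSubspace T.gr T.h T.ht ε) ?_ ?_ ?_ ?_ hx
  · rw [sbr_zero]; exact zero_mem _
  · intro a b ha hb; rw [sbr_add]; exact add_mem ha hb
  · intro c a ha; rw [sbr_smul]; exact Submodule.smul_mem _ _ ha
  intro p d α x hx h
  rw [hx.weight t]
  exact Submodule.smul_mem _ _
    (Submodule.subset_span ⟨_, _, _, hx.mem_homog, hx.degree, hx.weight, h⟩)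

variable (T)

theorem exists_decomposition (x : g) : ∃ y ∈ nilSubspace T.gr T.h T.ht (-1), ∃ t : T.h,
    ∃ z ∈ nilSubspace T.gr T.h T.ht 1, x = y + (((t : homog k g 0) : g) + z) := by
  have hx : x ∈ nilSubspace T.gr T.h T.ht (-1) ⊔
      (cartanSubspace T.h ⊔ nilSubspace T.gr T.h T.ht 1) := by
    rw [T.isCompl.sup_eq_top]; trivial
  obtain ⟨y, hy, _, hb, rfl⟩ := Submodule.mem_sup.1 hx
  obtain ⟨_, ⟨t, ht, rfl⟩, z, hz, rfl⟩ := Submodule.mem_sup.1 hb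
  exact ⟨y, hy, ⟨t, ht⟩, z, hz, rfl⟩

theorem coe_mem_cartanSubspace (t : T.h) : ((t : homog k g 0) : g) ∈ cartanSubspace T.h :=
  ⟨t, t.2, rfl⟩

/-- The projection of `g` onto `h` along `n⁻ ⊕ n⁺`. -/
theorem exists_cartanProj : ∃ q : g →ₗ[k] T.h, (∀ t : T.h, q ((t : homog k g 0) : g) = t) ∧
    ∀ ε : ℤ, (ε = 1 ∨ ε = -1) → ∀ x ∈ nilSubspace T.gr T.h T.ht ε, q x = 0 := by
  have hd : Disjoint (cartanSubspace T.h)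
      (nilSubspace T.gr T.h T.ht 1 ⊔ nilSubspace T.gr T.h T.ht (-1)) :=
    T.disjoint.disjoint_sup_right_of_disjoint_sup_left T.isCompl.disjoint.symm
  have hc : IsCompl (cartanSubspace T.h)
      (nilSubspace T.gr T.h T.ht 1 ⊔ nilSubspace T.gr T.h T.ht (-1)) := by
    refine ⟨hd, codisjoint_iff.2 ?_⟩
    rw [← sup_assoc, sup_comm]
    exact T.isCompl.sup_eq_top
  obtain ⟨f, hf⟩ := LinearMap.exists_leftInverse_of_injective
    ((homog k g 0).subtype ∘ₗ T.h.toSubmodule.subtype)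
    (LinearMap.ker_eq_bot.2 (Subtype.val_injective.comp Subtype.val_injective))
  refine ⟨f ∘ₗ (cartanSubspace T.h).projection _ hc, fun t => ?_, fun ε hε x hx => ?_⟩
  · rw [LinearMap.comp_apply, Submodule.projection_apply_of_mem_left _ (T.coe_mem_cartanSubspace t)]
    exact LinearMap.congr_fun hf t
  · have hx' : x ∈ nilSubspace T.gr T.h T.ht 1 ⊔ nilSubspace T.gr T.h T.ht (-1) := by
      rcases hε with rfl | rfl
      · exact Submodule.mem_sup_left hx
      · exact Submodule.mem_sup_right hx
    rw [LinearMap.comp_apply, Submodule.projection_apply,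
      Submodule.projectionOnto_apply_of_mem_right _ hx']
    simp

/-- The projection of `g` onto `n⁻` along `h ⊕ n⁺`. -/
theorem exists_negProj : ∃ p : g →ₗ[k] g, (∀ x, p x ∈ nilSubspace T.gr T.h T.ht (-1)) ∧
    (∀ x ∈ nilSubspace T.gr T.h T.ht (-1), p x = x) ∧
    (∀ x ∈ cartanSubspace T.h ⊔ nilSubspace T.gr T.h T.ht 1, p x = 0) ∧
    (∀ x, x - p x ∈ cartanSubspace T.h ⊔ nilSubspace T.gr T.h T.ht 1) := by
  have h1 : ∀ x ∈ nilSubspace T.gr T.h T.ht (-1), (nilSubspace T.gr T.h T.ht (-1)).projection _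
      T.isCompl x = x := fun x hx => Submodule.projection_apply_of_mem_left _ hx
  have h2 : ∀ x ∈ cartanSubspace T.h ⊔ nilSubspace T.gr T.h T.ht 1,
      (nilSubspace T.gr T.h T.ht (-1)).projection _ T.isCompl x = 0 := fun x hx => by
    rw [Submodule.projection_apply, Submodule.projectionOnto_apply_of_mem_right _ hx]; simp
  refine ⟨(nilSubspace T.gr T.h T.ht (-1)).projection _ T.isCompl, fun x => ?_, h1, h2, fun x => ?_⟩
  · rw [Submodule.projection_apply]; exact SetLike.coe_mem _
  · obtain ⟨y, hy, t, z, hz, rfl⟩ := T.exists_decomposition x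
    have hb : ((t : homog k g 0) : g) + z ∈ cartanSubspace T.h ⊔ nilSubspace T.gr T.h T.ht 1 :=
      Submodule.add_mem_sup (T.coe_mem_cartanSubspace t) hz
    rw [map_add, h1 y hy, h2 _ hb, add_zero, add_sub_cancel_left]
    exact hb

theorem parity_coe (t : T.h) :
    SuperSpace.parity k g ((t : homog k g 0) : g) = ((t : homog k g 0) : g) :=
  SuperSpace.parity_even (t : homog k g 0).2

theorem parity_mem_borel {x : g} (hx : x ∈ cartanSubspace T.h ⊔ nilSubspace T.gr T.h T.ht 1) :
    SuperSpace.parity k g x ∈ cartanSubspace T.h ⊔ nilSubspace T.gr T.h T.ht 1 := by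
  obtain ⟨_, ⟨t, ht, rfl⟩, z, hz, rfl⟩ := Submodule.mem_sup.1 hx
  rw [map_add]
  exact Submodule.add_mem_sup (by
    rw [Submodule.subtype_apply, SuperSpace.parity_even t.2]; exact ⟨t, ht, rfl⟩)
    (parity_mem_nilSubspace hz)

section MapAlgebra

variable {A : Type*} [CommRing A] [Algebra k A]

theorem coe_sbr (s t : T.h) :
    sbr k ((s : homog k g 0) : g) ((t : homog k g 0) : g) = ((⁅s, t⁆ : T.h) : homog k g 0) := rfl

/-- If `h` is abelian, every linear form on `h ⊗ A` is the weight of a nonzero vector killed by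
`n⁺ ⊗ A` in some representation of `g ⊗ A`. -/
theorem exists_singular_vector (hab : ∀ s t : T.h, ⁅s, t⁆ = 0) (ψ : Module.Dual k (T.h ⊗[k] A)) :
    ∃ (n : Submodule k (g ⊗[k] A))
      (ρ : g ⊗[k] A →ₗ[k] Module.End k (TensorAlgebra k n ⧸ relIdeal n))
      (v : TensorAlgebra k n ⧸ relIdeal n), IsSuperHom ρ ∧ v ≠ 0 ∧
      (∀ x ∈ T.nPos, ∀ a : A, ρ (x ⊗ₜ a) v = 0) ∧
      ∀ t : T.h ⊗[k] A, ρ (T.inclCartan A t) v = ψ t • v := by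
  obtain ⟨q, hq, hq0⟩ := T.exists_cartanProj
  obtain ⟨p, hp1, hp2, hp3, hp4⟩ := T.exists_negProj
  have hpp : ∀ x, p (SuperSpace.parity k g x) = SuperSpace.parity k g (p x) := by
    intro x
    have e : SuperSpace.parity k g x =
        SuperSpace.parity k g (p x) + SuperSpace.parity k g (x - p x) := by
      rw [← map_add, add_sub_cancel]
    rw [e, map_add, hp2 _ (parity_mem_nilSubspace (hp1 x)), hp3 _ (T.parity_mem_borel (hp4 x)),
      add_zero]
  have hph : ∀ {i : ZMod 2} {x : g}, x ∈ homog k g i → p x ∈ homog k g i := by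
    intro i x hx
    rcases SuperRep.zmod2_cases i with rfl | rfl
    · exact mem_homog_zero_of_parity (by rw [← hpp, SuperSpace.parity_even hx])
    · exact mem_homog_one_of_parity (by rw [← hpp, SuperSpace.parity_odd hx, map_neg])
  have hqp : ∀ x, q (SuperSpace.parity k g x) = q x := by
    intro x
    obtain ⟨y, hy, t, z, hz, rfl⟩ := T.exists_decomposition x
    simp only [map_add]
    rw [T.parity_coe, hq0 (-1) (Or.inr rfl) _ hy, hq0 1 (Or.inl rfl) _ hz,
      hq0 (-1) (Or.inr rfl) _ (parity_mem_nilSubspace hy),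
      hq0 1 (Or.inl rfl) _ (parity_mem_nilSubspace hz)]
  have hqo : ∀ x ∈ homog k g 1, q x = 0 := by
    intro x hx
    have h := hqp x
    rw [SuperSpace.parity_odd hx, map_neg, neg_eq_iff_add_eq_zero, ← two_smul k, smul_eq_zero] at h
    exact h.resolve_left two_ne_zero
  -- Commutativity of `h` puts all brackets of the Borel subalgebra into `n⁺`. Hence any linear form
  -- on `h ⊗ A`, extended by zero, is a character of the Borel subalgebra tensored with `A`.
  have hbb : ∀ x ∈ cartanSubspace T.h ⊔ nilSubspace T.gr T.h T.ht 1,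
      ∀ y ∈ cartanSubspace T.h ⊔ nilSubspace T.gr T.h T.ht 1,
      sbr k x y ∈ nilSubspace T.gr T.h T.ht 1 := by
    intro x hx y hy
    obtain ⟨_, ⟨s, hs, rfl⟩, z, hz, rfl⟩ := Submodule.mem_sup.1 hx
    obtain ⟨_, ⟨t, ht, rfl⟩, w, hw, rfl⟩ := Submodule.mem_sup.1 hy
    have h1 : sbr k ((homog k g 0).subtype s) ((homog k g 0).subtype t) = 0 := by
      have h := T.coe_sbr ⟨s, hs⟩ ⟨t, ht⟩
      rw [hab] at h
      exact h
    have h2 : sbr k z ((homog k g 0).subtype t) ∈ nilSubspace T.gr T.h T.ht 1 := by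
      rw [Submodule.subtype_apply, sbr_even_right z t.2]
      exact neg_mem (T.sbr_cartan_mem_nilSubspace ⟨t, ht⟩ hz)
    rw [add_sbr, sbr_add, sbr_add, h1, zero_add]
    exact add_mem (T.sbr_cartan_mem_nilSubspace ⟨s, hs⟩ hw) (add_mem h2 (sbr_mem_nilSubspace hz hw))
  set n : Submodule k (g ⊗[k] A) :=
    Submodule.map₂ (TensorProduct.mk k g A) (nilSubspace T.gr T.h T.ht (-1)) ⊤ with hn
  set b : Submodule k (g ⊗[k] A) :=
    Submodule.map₂ (TensorProduct.mk k g A) (cartanSubspace T.h ⊔ nilSubspace T.gr T.h T.ht 1) ⊤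
  have hPmem : ∀ x, LinearMap.rTensor A p x ∈ n := by
    intro x
    induction x with
    | zero => simp
    | add x y hx hy => rw [map_add]; exact add_mem hx hy
    | tmul x a => exact Submodule.apply_mem_map₂ _ (hp1 x) trivial
  have hPid : ∀ x ∈ n, LinearMap.rTensor A p x = x := fun x hx =>
    Submodule.map₂_mk_induction (P := fun x => LinearMap.rTensor A p x = x)
      (fun m hm a _ => by rw [LinearMap.rTensor_tmul, hp2 m hm])
      (fun x y hx hy => by rw [map_add, hx, hy]) hx
  have hPsub : ∀ x, x - LinearMap.rTensor A p x ∈ b := by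
    intro x
    induction x with
    | zero => simp
    | add x y hx hy => rw [map_add, add_sub_add_comm]; exact add_mem hx hy
    | tmul x a =>
      rw [LinearMap.rTensor_tmul, ← TensorProduct.sub_tmul]
      exact Submodule.apply_mem_map₂ _ (hp4 x) trivial
  have hPb : ∀ x ∈ b, LinearMap.rTensor A p x = 0 := fun x hx =>
    Submodule.map₂_mk_induction (P := fun x => LinearMap.rTensor A p x = 0)
      (fun m hm a _ => by rw [LinearMap.rTensor_tmul, hp3 m hm, TensorProduct.zero_tmul])
      (fun x y hx hy => by rw [map_add, hx, hy, add_zero]) hx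
  set P : g ⊗[k] A →ₗ[k] n := LinearMap.codRestrict n (LinearMap.rTensor A p) hPmem with hP
  set χ : g ⊗[k] A →ₗ[k] k := ψ ∘ₗ LinearMap.rTensor A q with hχ
  have hPcoe : ∀ x, (P x : g ⊗[k] A) = LinearMap.rTensor A p x := fun x => rfl
  have hker : ∀ x, P x = 0 → x ∈ b := by
    intro x hx
    have h := hPsub x
    rwa [← hPcoe, hx, ZeroMemClass.coe_zero, sub_zero] at h
  have hbr : ∀ x ∈ b, ∀ y ∈ b, sbr k x y ∈
      Submodule.map₂ (TensorProduct.mk k g A) (nilSubspace T.gr T.h T.ht 1) ⊤ := by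
    intro x hx y hy
    refine Submodule.map₂_mk_induction (P := fun x => sbr k x y ∈
      Submodule.map₂ (TensorProduct.mk k g A) (nilSubspace T.gr T.h T.ht 1) ⊤)
      (fun m hm a _ => ?_) (fun x y hx hy => by rw [add_sbr]; exact add_mem hx hy) hx
    refine Submodule.map₂_mk_induction (P := fun y => sbr k (m ⊗ₜ[k] a) y ∈
      Submodule.map₂ (TensorProduct.mk k g A) (nilSubspace T.gr T.h T.ht 1) ⊤)
      (fun m' hm' a' _ => ?_) (fun x y hx hy => by rw [sbr_add]; exact add_mem hx hy) hy
    change mapBr k g A _ _ ∈ _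
    rw [mapBr_tmul]
    exact Submodule.apply_mem_map₂ _ (hbb m hm m' hm') trivial
  have hχ0 : ∀ x ∈ Submodule.map₂ (TensorProduct.mk k g A) (nilSubspace T.gr T.h T.ht 1) ⊤,
      χ x = 0 := fun x hx =>
    Submodule.map₂_mk_induction (P := fun x => χ x = 0)
      (fun m hm a _ => by
        rw [hχ, LinearMap.comp_apply, LinearMap.rTensor_tmul, hq0 1 (Or.inl rfl) m hm,
          TensorProduct.zero_tmul, map_zero])
      (fun x y hx hy => by rw [map_add, hx, hy, add_zero]) hx
  have hTP : IsTriangularPair n P χ :=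
    { proj := fun y => Subtype.ext (hPid y y.2)
      map_homog := by
        intro i x hx
        rw [hPcoe]
        exact mapPart_induction (P := fun x => LinearMap.rTensor A p x ∈ homog k (g ⊗[k] A) i)
          (by simp) (fun x y hx hy => by rw [map_add]; exact add_mem hx hy)
          (fun x hx a => tmul_mem_mapPart (hph hx) a) hx
      br_mem := by
        intro x hx y hy
        refine Submodule.map₂_mk_induction (P := fun x => sbr k x y ∈ n)
          (fun m hm a _ => ?_) (fun x y hx hy => by rw [add_sbr]; exact add_mem hx hy) hx
        refine Submodule.map₂_mk_induction (P := fun y => sbr k (m ⊗ₜ[k] a) y ∈ n)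
          (fun m' hm' a' _ => ?_) (fun x y hx hy => by rw [sbr_add]; exact add_mem hx hy) hy
        change mapBr k g A _ _ ∈ _
        rw [mapBr_tmul]
        exact Submodule.apply_mem_map₂ _ (sbr_mem_nilSubspace hm hm') trivial
      ker_br := fun x y hx hy => Subtype.ext (hPb _
        (Submodule.map₂_le_map₂_left le_sup_right (hbr x (hker x hx) y (hker y hy))))
      char_br := fun x y hx hy => hχ0 _ (hbr x (hker x hx) y (hker y hy))
      char_odd := by
        intro x hx
        exact mapPart_induction (P := fun x => χ x = 0) (by simp)
          (fun x y hx hy => by rw [map_add, hx, hy, add_zero])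
          (fun x hx a => by
            rw [hχ, LinearMap.comp_apply, LinearMap.rTensor_tmul, hqo x hx,
              TensorProduct.zero_tmul, map_zero]) hx }
  refine ⟨n, hTP.inducedρ, (relIdeal n).mkQ 1, hTP.isSuperHom_inducedρ,
    IsTriangularPair.mkQ_one_ne_zero, fun x hx a => ?_, fun t => ?_⟩
  · have hb : x ⊗ₜ[k] a ∈ b := Submodule.apply_mem_map₂ _ (Submodule.mem_sup_right hx) trivial
    rw [hTP.inducedρ_mk_one (Subtype.ext (hPb _ hb)),
      hχ0 (x ⊗ₜ a) (Submodule.apply_mem_map₂ _ hx trivial), zero_smul]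
  · have hb : T.inclCartan A t ∈ b ∧ χ (T.inclCartan A t) = ψ t := by
      induction t with
      | zero => simp
      | add x y hx hy =>
        rw [map_add, map_add, map_add, hx.2, hy.2]; exact ⟨add_mem hx.1 hy.1, rfl⟩
      | tmul t a =>
        rw [inclCartan, LinearMap.rTensor_tmul]
        refine ⟨Submodule.apply_mem_map₂ _ (Submodule.mem_sup_left (T.coe_mem_cartanSubspace t))
          trivial, ?_⟩
        rw [hχ, LinearMap.comp_apply, LinearMap.rTensor_tmul]
        exact congrArg (fun s => ψ (s ⊗ₜ a)) (hq t)
    rw [hTP.inducedρ_mk_one (Subtype.ext (hPb _ hb.1)), hb.2]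

end MapAlgebra

end TriangularDecomposition

/-! ### The Cartan subalgebra is abelian -/

section Perfect

variable (k g : Type*) [Field k] [AddCommGroup g] [Module k g] [LieSuperalgebra k g]

/-- The span of the brackets. -/
def derivedSpan : Submodule k g := Submodule.span k {z | ∃ x y : g, z = sbr k x y}

/-- The elements annihilated by all the operators `[x, ·]`. -/
def centralSpan : Submodule k g where
  carrier := {z | ∀ x : g, sbr k x z = 0}
  add_mem' := by intro a b ha hb x; rw [sbr_add, ha, hb, add_zero]
  zero_mem' := sbr_zero
  smul_mem' := by intro c a ha x; rw [sbr_smul, ha, smul_zero]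

variable {k g}

theorem mem_centralSpan {z : g} : z ∈ centralSpan k g ↔ ∀ x : g, sbr k x z = 0 := Iff.rfl

end Perfect

namespace TriangularDecomposition

variable {k g : Type*} [Field k] [CharZero k] [AddCommGroup g] [Module k g] [LieSuperalgebra k g]
  (T : TriangularDecomposition k g)

/-- If `h` lies in the sum of the derived algebra and the center, then `h` is abelian. -/
theorem cartan_abelian_of_le [FiniteDimensional k g]
    (hT : cartanSubspace T.h ≤ derivedSpan k g ⊔ centralSpan k g) (s t : T.h) : ⁅s, t⁆ = 0 := by
  obtain ⟨q, hq, hq0⟩ := T.exists_cartanProj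
  have hnil : LieRing.IsNilpotent T.h := T.isCartan.nilpotent
  have hequiv : ∀ (s : T.h) (x : g), q (sbr k ((s : homog k g 0) : g) x) = ⁅s, q x⁆ := by
    intro s x
    obtain ⟨y, hy, t, z, hz, rfl⟩ := T.exists_decomposition x
    rw [sbr_add, sbr_add, map_add, map_add, map_add, map_add, T.coe_sbr, hq, hq,
      hq0 (-1) (Or.inr rfl) _ hy, hq0 1 (Or.inl rfl) _ hz,
      hq0 (-1) (Or.inr rfl) _ (sbr_cartan_mem_nilSubspace s hy),
      hq0 1 (Or.inl rfl) _ (sbr_cartan_mem_nilSubspace s hz)]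
    simp
  let D : Submodule k T.h := Submodule.span k {z | ∃ a b : T.h, z = ⁅a, b⁆}
  let Z : Submodule k T.h :=
    { carrier := {z | ∀ a : T.h, ⁅a, z⁆ = 0}
      add_mem' := by intro a b ha hb x; rw [lie_add, ha, hb, add_zero]
      zero_mem' := fun x => lie_zero x
      smul_mem' := by intro c a ha x; rw [lie_smul, ha, smul_zero] }
  -- The Cartan component of a weight vector satisfies the eigenvector equation for the nilpotent
  -- operator `[s, ·]` of `h`, so its bracket with `s` is zero.
  have heig : ∀ (μ : Module.Dual k T.h) (x : g), x ∈ rootSubspace T.h μ → q x ∈ Z := by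
    intro μ x hx s
    have h1 : ⁅s, q x⁆ = μ s • q x := by rw [← hequiv, hx s, map_smul]
    by_contra hne
    have hμ : μ s ≠ 0 := fun h => hne (by rw [h1, h, zero_smul])
    have hqx : q x ≠ 0 := fun h => hne (by rw [h, lie_zero])
    obtain ⟨n, hn⟩ := LieModule.isNilpotent_toEnd_of_isNilpotent k T.h (M := T.h) s
    have hpow : ∀ n : ℕ, ((LieModule.toEnd k T.h T.h s) ^ n) (q x) = (μ s) ^ n • q x := by
      intro n
      induction n with
      | zero => simp
      | succ n ih =>
        rw [pow_succ', Module.End.mul_apply, ih, map_smul, LieModule.toEnd_apply_apply, h1,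
          smul_smul, ← pow_succ]
    have := hpow n
    rw [hn, LinearMap.zero_apply] at this
    exact (smul_ne_zero (pow_ne_zero n hμ) hqx) this.symm
  have hroots : ∀ x y : g, (∃ ε : ℤ, (ε = 1 ∨ ε = -1) ∧ x ∈ nilSubspace T.gr T.h T.ht ε) →
      (∃ ε : ℤ, (ε = 1 ∨ ε = -1) ∧ y ∈ nilSubspace T.gr T.h T.ht ε) → q (sbr k x y) ∈ Z := by
    rintro x y ⟨ε, -, hx⟩ ⟨η, -, hy⟩
    refine nil_induction ε (P := fun x => q (sbr k x y) ∈ Z) ?_ ?_ ?_ ?_ hx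
    · rw [zero_sbr, map_zero]; exact zero_mem _
    · intro a b ha hb; rw [add_sbr, map_add]; exact add_mem ha hb
    · intro c a ha; rw [smul_sbr, map_smul]; exact Submodule.smul_mem _ _ ha
    intro p d α x hx _
    refine nil_induction η (P := fun y => q (sbr k x y) ∈ Z) ?_ ?_ ?_ ?_ hy
    · rw [sbr_zero, map_zero]; exact zero_mem _
    · intro a b ha hb; rw [sbr_add, map_add]; exact add_mem ha hb
    · intro c a ha; rw [sbr_smul, map_smul]; exact Submodule.smul_mem _ _ ha
    intro p' d' β y hy _
    exact heig _ _ (hx.br hy).weight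
  have hnilq : ∀ x : g, (∃ ε : ℤ, (ε = 1 ∨ ε = -1) ∧ x ∈ nilSubspace T.gr T.h T.ht ε) → q x = 0 :=
    fun x ⟨ε, hε, hx⟩ => hq0 ε hε x hx
  -- Brackets with a Cartan element project into `[h, h]`. Brackets of elements of `n⁻ + n⁺` are
  -- sums of weight vectors, whose Cartan components are central in `h`.
  have hbr : ∀ x y : g, q (sbr k x y) ∈ D ⊔ Z := by
    have hcart : ∀ (s : T.h) (y : g), q (sbr k ((s : homog k g 0) : g) y) ∈ D := fun s y => by
      rw [hequiv]; exact Submodule.subset_span ⟨_, _, rfl⟩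
    have hcart' : ∀ (s : T.h) (y : g), q (sbr k y ((s : homog k g 0) : g)) ∈ D := fun s y => by
      rw [sbr_even_right y (s : homog k g 0).2, map_neg]; exact neg_mem (hcart s y)
    intro x y
    obtain ⟨a, ha, s, b, hb, rfl⟩ := T.exists_decomposition x
    obtain ⟨c, hc, t, d, hd, rfl⟩ := T.exists_decomposition y
    have ha' : ∃ ε : ℤ, (ε = 1 ∨ ε = -1) ∧ a ∈ nilSubspace T.gr T.h T.ht ε := ⟨_, Or.inr rfl, ha⟩
    have hb' : ∃ ε : ℤ, (ε = 1 ∨ ε = -1) ∧ b ∈ nilSubspace T.gr T.h T.ht ε := ⟨_, Or.inl rfl, hb⟩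
    have hc' : ∃ ε : ℤ, (ε = 1 ∨ ε = -1) ∧ c ∈ nilSubspace T.gr T.h T.ht ε := ⟨_, Or.inr rfl, hc⟩
    have hd' : ∃ ε : ℤ, (ε = 1 ∨ ε = -1) ∧ d ∈ nilSubspace T.gr T.h T.ht ε := ⟨_, Or.inl rfl, hd⟩
    have e : sbr k (a + (((s : homog k g 0) : g) + b)) (c + (((t : homog k g 0) : g) + d)) =
        (sbr k a c + sbr k a d + sbr k b c + sbr k b d) +
        (sbr k ((s : homog k g 0) : g) (c + (((t : homog k g 0) : g) + d)) +
          sbr k (a + b) ((t : homog k g 0) : g)) := by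
      simp only [sbr, map_add, LinearMap.add_apply]
      abel
    rw [e, map_add]
    refine add_mem (Submodule.mem_sup_right ?_) (Submodule.mem_sup_left ?_)
    · rw [map_add, map_add, map_add]
      exact add_mem (add_mem (add_mem (hroots _ _ ha' hc') (hroots _ _ ha' hd'))
        (hroots _ _ hb' hc')) (hroots _ _ hb' hd')
    · rw [map_add]
      exact add_mem (hcart _ _) (hcart' _ _)
  have htop : ∀ t : T.h, t ∈ D ⊔ Z := by
    intro t
    obtain ⟨d, hd, c, hc, hdc⟩ := Submodule.mem_sup.1 (hT (T.coe_mem_cartanSubspace t))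
    rw [← hq t, ← hdc, map_add]
    refine add_mem ?_ (Submodule.mem_sup_right fun s => ?_)
    · have hle : derivedSpan k g ≤ (D ⊔ Z).comap q := by
        refine Submodule.span_le.2 ?_
        rintro _ ⟨x, y, rfl⟩
        exact hbr x y
      exact hle hd
    · rw [← hequiv, mem_centralSpan.1 hc, map_zero]
  obtain ⟨n, hn⟩ := (LieModule.isNilpotent_iff k T.h T.h).1 hnil
  -- From `h = [h, h] + Z(h)` follows `[h, h] = [h, [h, h]]`, so `[h, h]` lies in every term of a
  -- lower central series that reaches zero.
  have hlcs : ∀ n, D ≤ (LieModule.lowerCentralSeries k T.h T.h n).toSubmodule := by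
    intro n
    induction n with
    | zero => simp
    | succ n ih =>
      refine Submodule.span_le.2 ?_
      rintro _ ⟨a, b, rfl⟩
      obtain ⟨d, hd, z, hz, rfl⟩ := Submodule.mem_sup.1 (htop b)
      rw [lie_add, hz a, add_zero, LieModule.lowerCentralSeries_succ]
      exact LieSubmodule.lie_mem_lie (LieSubmodule.mem_top a) (ih hd)
  have hst : ⁅s, t⁆ ∈ D := Submodule.subset_span ⟨s, t, rfl⟩
  have := hlcs n hst
  rw [hn] at this
  simpa using this

end TriangularDecomposition

/-! ### The derived algebra and the center in the simple and the reductive case. -/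

section Cases

variable {k g : Type*} [Field k] [CharZero k] [AddCommGroup g] [Module k g] [LieSuperalgebra k g]

omit [CharZero k] in
theorem derivedSpan_parity {z : g} (hz : z ∈ derivedSpan k g) :
    SuperSpace.parity k g z ∈ derivedSpan k g := by
  induction hz using Submodule.span_induction with
  | mem z hz =>
    obtain ⟨x, y, rfl⟩ := hz
    rw [SuperSpace.parity_sbr]
    exact Submodule.subset_span ⟨_, _, rfl⟩
  | zero => simp
  | add x y _ _ hx hy => rw [map_add]; exact add_mem hx hy
  | smul c x _ hx => rw [map_smul]; exact Submodule.smul_mem _ _ hx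

theorem IsSimpleSuper.derivedSpan_eq_top (h : IsSimpleSuper k g) : derivedSpan k g = ⊤ := by
  refine (h.2 _ (SuperSpace.isGraded_of_parity_mem fun _ => derivedSpan_parity)
    (fun x y _ => Submodule.subset_span ⟨x, y, rfl⟩)).resolve_left fun hb => ?_
  obtain ⟨x, y, hxy⟩ := h.1
  have : sbr k x y ∈ derivedSpan k g := Submodule.subset_span ⟨x, y, rfl⟩
  rw [hb] at this
  exact hxy this

open LieAlgebra in
/-- A Lie algebra whose radical is its center is the sum of its derived algebra and its center. -/
theorem derived_sup_center_eq_top {L : Type*} [LieRing L] [LieAlgebra k L] [FiniteDimensional k L]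
    (h : radical k L = center k L) :
    (⁅(⊤ : LieIdeal k L), (⊤ : LieIdeal k L)⁆ : LieIdeal k L) ⊔ center k L = ⊤ := by
  set D : LieIdeal k L := ⁅(⊤ : LieIdeal k L), (⊤ : LieIdeal k L)⁆ with hD
  -- Cartan's criterion: the Killing orthogonal of the derived algebra is a solvable ideal, hence
  -- lies in the radical.
  have h1 : LieIdeal.killingCompl k L D ≤ center k L := by
    rw [← h, ← LieIdeal.solvable_iff_le_radical]
    refine LieIdeal.isSolvable_of_killingForm_apply_lie_eq_zero _ fun x hx y hy => ?_
    rw [LieModule.traceForm_comm]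
    exact (LieIdeal.mem_killingCompl k L D).1 hx y (LieSubmodule.mono_lie le_top le_top hy)
  set B := killingForm k L
  have hW : B.orthogonal (D ⊔ center k L : LieIdeal k L).toSubmodule ≤
      (center k L).toSubmodule := by
    intro x hx
    refine h1 ((LieIdeal.mem_killingCompl k L D).2 fun y hy => ?_)
    exact hx y (le_sup_left (b := center k L) hy)
  have hZ : (center k L).toSubmodule ≤ B.orthogonal ⊤ := by
    intro x hx y _
    have h0 : LieModule.toEnd k L L x = 0 := by
      ext z
      rw [LieModule.toEnd_apply_apply, ← lie_skew, (LieModule.mem_maxTrivSubmodule k L L x).1 hx z]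
      simp
    change killingForm k L y x = 0
    rw [killingForm_apply_apply]
    change LinearMap.trace k L (_ ∘ₗ LieModule.toEnd k L L x) = 0
    rw [h0]; simp
  have hrefl : B.IsRefl := (LieModule.traceForm_isSymm k L L).isRefl
  -- For `W = [L, L] + Z(L)` one has `dim W + dim W^⊥ = dim L + dim (W ∩ L^⊥)`, and `W^⊥ ⊆ Z(L) ⊆ W
  -- ∩ L^⊥`. So `dim W ≥ dim L`.
  have hfin := LinearMap.BilinForm.finrank_add_finrank_orthogonal hrefl
    (D ⊔ center k L : LieIdeal k L).toSubmodule
  have hle : (center k L).toSubmodule ≤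
      (D ⊔ center k L : LieIdeal k L).toSubmodule ⊓ B.orthogonal ⊤ :=
    le_inf (fun x hx => (le_sup_right : center k L ≤ D ⊔ center k L) hx) hZ
  have f1 := Submodule.finrank_mono hW
  have f2 := Submodule.finrank_mono hle
  rw [← LieSubmodule.toSubmodule_inj]
  apply Submodule.eq_top_of_finrank_eq
  have f3 := Submodule.finrank_le (D ⊔ center k L : LieIdeal k L).toSubmodule
  omega

theorem IsReductiveLie.derived_sup_central_eq_top (h : IsReductiveLie k g) :
    derivedSpan k g ⊔ centralSpan k g = ⊤ := by
  obtain ⟨hfin, h1, hrad⟩ := h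
  have h0 : homog k g 0 = ⊤ := by
    have := (SuperSpace.isCompl (k := k) (V := g)).sup_eq_top
    rwa [show SuperSpace.par 1 = (⊥ : Submodule k g) from h1, sup_bot_eq] at this
  have key := derived_sup_center_eq_top hrad
  rw [eq_top_iff]
  intro x _
  have hx : (⟨x, by rw [h0]; trivial⟩ : homog k g 0) ∈
      ((⁅(⊤ : LieIdeal k (homog k g 0)), (⊤ : LieIdeal k (homog k g 0))⁆ :
        LieIdeal k (homog k g 0)) ⊔ LieAlgebra.center k (homog k g 0)) := by
    rw [key]; exact LieSubmodule.mem_top _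
  obtain ⟨d, hd, c, hc, hdc⟩ := (LieSubmodule.mem_sup _ _ _).1 hx
  have hx' : x = (d : g) + (c : g) := by
    rw [← Submodule.coe_add, hdc]
  rw [hx']
  refine Submodule.add_mem_sup ?_ ?_
  · rw [← LieSubmodule.mem_toSubmodule, LieSubmodule.lieIdeal_oper_eq_linear_span'] at hd
    have hle : Submodule.span k {x : homog k g 0 | ∃ y ∈ (⊤ : LieIdeal k (homog k g 0)),
        ∃ z ∈ (⊤ : LieIdeal k (homog k g 0)), ⁅y, z⁆ = x} ≤
        (derivedSpan k g).comap (homog k g 0).subtype := by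
      refine Submodule.span_le.2 ?_
      rintro _ ⟨y, -, z, -, rfl⟩
      exact Submodule.subset_span ⟨_, _, rfl⟩
    exact hle hd
  · intro y
    have h := (LieModule.mem_maxTrivSubmodule k _ _ c).1 hc ⟨y, by rw [h0]; trivial⟩
    exact congrArg Subtype.val h

end Cases

/-! ### The Lie superalgebras `𝔰𝔩(n,n)` -/

section Sl

variable {k : Type*} [Field k]

/-- A subspace of matrices that contains all commutators contains all matrices of trace zero. -/
theorem Matrix.mem_of_trace_eq_zero {n : ℕ} (S : Submodule k (Matrix (Fin n) (Fin n) k))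
    (hS : ∀ X Y : Matrix (Fin n) (Fin n) k, X * Y - Y * X ∈ S)
    {e : Matrix (Fin n) (Fin n) k} (he : e.trace = 0) : e ∈ S := by
  rcases n with _ | n
  · rw [Subsingleton.elim e 0]; exact zero_mem _
  -- Shifting every diagonal entry to the corner `(0, 0)` subtracts the trace there, which is zero.
  -- Each summand is then a single commutator of matrix units.
  have h : e = ∑ i, ∑ j, (Matrix.single i j (e i j) -
      if i = j then Matrix.single 0 0 (e i i) else 0) := by
    have h1 : ∑ i : Fin (n + 1), Matrix.single (0 : Fin (n + 1)) (0 : Fin (n + 1)) (e i i) = 0 := by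
      have := map_sum (Matrix.singleAddMonoidHom (α := k) (0 : Fin (n + 1)) (0 : Fin (n + 1)))
        (fun i => e i i) Finset.univ
      refine this.symm.trans ?_
      change Matrix.single 0 0 e.trace = 0
      rw [he, Matrix.single_zero]
    simp only [Finset.sum_sub_distrib, Finset.sum_ite_eq, Finset.mem_univ, if_true]
    rw [h1, sub_zero]
    exact Matrix.matrix_eq_sum_single e
  rw [h]
  refine Submodule.sum_mem _ fun i _ => Submodule.sum_mem _ fun j _ => ?_
  split_ifs with hij
  · subst hij
    have := hS (Matrix.single i 0 (e i i)) (Matrix.single 0 i 1)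
    simpa using this
  · have := hS (Matrix.single i i 1) (Matrix.single i j (e i j))
    simpa [Matrix.single_mul_single_of_ne _ _ _ _ (Ne.symm hij)] using this

variable {g : Type*} [AddCommGroup g] [Module k g] [LieSuperalgebra k g]

theorem IsSl.finiteDimensional {n : ℕ} (h : IsSl k g n) : FiniteDimensional k g := by
  obtain ⟨φ, hφ, -⟩ := h
  exact FiniteDimensional.of_injective φ hφ

/-- Odd brackets suffice: they yield `diag(BC, CB)`, hence `diag(a, a)`, and by subtraction `diag(0,
XY - YX)`, hence `diag(0, e)` for every traceless `e`. Supertrace zero says that the diagonal blocks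
differ by a traceless matrix. -/
theorem IsSl.even_le_derivedSpan {n : ℕ} (h : IsSl k g n) : homog k g 0 ≤ derivedSpan k g := by
  obtain ⟨φ, hφ, hr, h0, h1, hbr⟩ := h
  set M : Submodule k (Matrix (Fin n ⊕ Fin n) (Fin n ⊕ Fin n) k) := (derivedSpan k g).map φ with hM
  have hodd : ∀ B C : Matrix (Fin n) (Fin n) k,
      ∃ x ∈ homog k g 1, φ x = Matrix.fromBlocks 0 B C 0 := by
    intro B C
    obtain ⟨x, hx⟩ := (hr (Matrix.fromBlocks 0 B C 0)).2 (by simp)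
    exact ⟨x, (h1 x).2 (by simp [hx]), hx⟩
  have hBC : ∀ B C : Matrix (Fin n) (Fin n) k, Matrix.fromBlocks (B * C) 0 0 (C * B) ∈ M := by
    intro B C
    obtain ⟨x, hx, ex⟩ := hodd B 0
    obtain ⟨y, hy, ey⟩ := hodd 0 C
    refine ⟨sbr k x y, Submodule.subset_span ⟨x, y, rfl⟩, ?_⟩
    rw [hbr 1 1 x hx y hy, ex, ey, Matrix.fromBlocks_multiply, Matrix.fromBlocks_multiply]
    simp [superSign, Matrix.fromBlocks_add]
  have hdiag : ∀ a : Matrix (Fin n) (Fin n) k, Matrix.fromBlocks a 0 0 a ∈ M := by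
    intro a
    simpa using hBC a 1
  have hlow : ∀ e : Matrix (Fin n) (Fin n) k, e.trace = 0 → Matrix.fromBlocks 0 0 0 e ∈ M := by
    intro e he
    let S : Submodule k (Matrix (Fin n) (Fin n) k) :=
      { carrier := {e | Matrix.fromBlocks 0 0 0 e ∈ M}
        add_mem' := by
          intro a b ha hb
          simpa [Matrix.fromBlocks_add] using M.add_mem ha hb
        zero_mem' := by simp
        smul_mem' := by
          intro c a ha
          simpa [Matrix.fromBlocks_smul] using M.smul_mem c ha }
    refine Matrix.mem_of_trace_eq_zero S (fun X Y => ?_) he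
    change Matrix.fromBlocks 0 0 0 (X * Y - Y * X) ∈ M
    have := sub_mem (hBC Y X) (hdiag (Y * X))
    rw [sub_eq_add_neg, Matrix.fromBlocks_neg, Matrix.fromBlocks_add] at this
    simpa [sub_eq_add_neg] using this
  intro x hx
  obtain ⟨e12, e21⟩ := (h0 x).1 hx
  have htr : (φ x).toBlocks₁₁.trace - (φ x).toBlocks₂₂.trace = 0 := (hr _).1 ⟨x, rfl⟩
  have hmem : φ x ∈ M := by
    have := add_mem (hdiag (φ x).toBlocks₁₁) (hlow ((φ x).toBlocks₂₂ - (φ x).toBlocks₁₁)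
      (by rw [Matrix.trace_sub, ← neg_sub, htr, neg_zero]))
    rw [Matrix.fromBlocks_add] at this
    rw [← Matrix.fromBlocks_toBlocks (φ x), e12, e21]
    simpa using this
  obtain ⟨d, hd, e⟩ := hmem
  rwa [← hφ e]

end Sl

section Admissible

variable {k g : Type*} [Field k] [CharZero k] [AddCommGroup g] [Module k g] [LieSuperalgebra k g]

theorem IsAdmissible.finiteDimensional (h : IsAdmissible k g) : FiniteDimensional k g := by
  rcases h with h | h | ⟨n, -, h⟩
  · exact h.1
  · exact h.1
  · exact h.finiteDimensional

theorem TriangularDecomposition.cartan_abelian (T : TriangularDecomposition k g)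
    (h : IsAdmissible k g) (s t : T.h) : ⁅s, t⁆ = 0 := by
  have := h.finiteDimensional
  refine T.cartan_abelian_of_le ?_ s t
  rcases h with h | h | ⟨n, -, h⟩
  · rw [h.derived_sup_central_eq_top]; exact le_top
  · rw [h.2.1.derivedSpan_eq_top, top_sup_eq]; exact le_top
  · refine le_sup_of_le_left (le_trans ?_ h.even_le_derivedSpan)
    rintro _ ⟨x, -, rfl⟩
    exact x.2

end Admissible

/-! ### Distinguished gradings are inner or of type I -/

section Grading

variable {k g : Type*} [Field k] [AddCommGroup g] [Module k g]

theorem DirectSum.IsInternal.exists_degree_map {gr : ℤ → Submodule k g}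
    (h : DirectSum.IsInternal gr) :
    ∃ D : g →ₗ[k] g, ∀ (d : ℤ), ∀ x ∈ gr d, D x = (d : k) • x := by
  let e : (DirectSum ℤ fun i => gr i) ≃ₗ[k] g :=
    LinearEquiv.ofBijective (DirectSum.coeLinearMap gr) h
  refine ⟨DirectSum.toModule k ℤ g (fun i => (i : k) • (gr i).subtype) ∘ₗ e.symm.toLinearMap,
    fun d x hx => ?_⟩
  have he : e.symm x = DirectSum.lof k ℤ (fun i => gr i) d ⟨x, hx⟩ := by
    rw [LinearEquiv.symm_apply_eq]
    exact (DirectSum.coeLinearMap_lof gr d ⟨x, hx⟩).symm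
  rw [LinearMap.comp_apply, LinearEquiv.coe_coe, he, DirectSum.toModule_lof]
  rfl

variable [LieSuperalgebra k g]

theorem IsDistinguished.exists_derivation [CharZero k] {gr : ℤ → Submodule k g}
    (h : IsDistinguished gr) :
    ∃ D : g →ₗ[k] g, (∀ (d : ℤ), ∀ x ∈ gr d, D x = (d : k) • x) ∧
      ∀ x y, D (sbr k x y) = sbr k (D x) y + sbr k x (D y) := by
  obtain ⟨D, hD⟩ := h.isInternal.exists_degree_map
  refine ⟨D, hD, fun x y => ?_⟩
  have hx : x ∈ iSup gr := by rw [h.isInternal.submodule_iSup_eq_top]; trivial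
  have hy : y ∈ iSup gr := by rw [h.isInternal.submodule_iSup_eq_top]; trivial
  induction hx using Submodule.iSup_induction' with
  | zero => simp [sbr]
  | add a b _ _ ha hb => rw [add_sbr, map_add, map_add, add_sbr, add_sbr, ha, hb]; abel
  | mem d x hx =>
    induction hy using Submodule.iSup_induction' with
    | zero => simp [sbr]
    | add a b _ _ ha hb => rw [sbr_add, map_add, map_add, sbr_add, sbr_add, ha, hb]; abel
    | mem e y hy =>
      rw [hD _ _ hx, hD _ _ hy, hD _ _ (h.br_mem _ _ _ hx _ hy), smul_sbr, sbr_smul, ← add_smul]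
      push_cast
      rfl

end Grading

/-! ### The odd part as a module over the even part; even derivations of simple superalgebras. -/

section OddModule

variable {k g : Type*} [Field k] [CharZero k] [AddCommGroup g] [Module k g] [LieSuperalgebra k g]

omit [CharZero k] in
theorem sbr_even_odd {x y : g} (hx : x ∈ homog k g 0) (hy : y ∈ homog k g 1) :
    sbr k x y ∈ homog k g 1 := by
  simpa using LieSuperalgebra.br_mem (k := k) hx hy

omit [CharZero k] in
theorem sbr_even_even {x y : g} (hx : x ∈ homog k g 0) (hy : y ∈ homog k g 0) :
    sbr k x y ∈ homog k g 0 := by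
  simpa using LieSuperalgebra.br_mem (k := k) hx hy

omit [CharZero k] in
theorem sbr_odd_odd {x y : g} (hx : x ∈ homog k g 1) (hy : y ∈ homog k g 1) :
    sbr k x y ∈ homog k g 0 :=
  LieSuperalgebra.br_mem (k := k) hx hy

omit [CharZero k] in
theorem sbr_even_leibniz {x : g} (hx : x ∈ homog k g 0) (y z : g) :
    sbr k x (sbr k y z) = sbr k (sbr k x y) z + sbr k y (sbr k x z) := by
  obtain ⟨a, ha, b, hb, rfl⟩ := SuperSpace.exists_eq_add (k := k) y
  have h1 := LieSuperalgebra.br_jacobi (k := k) z hx ha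
  have h2 := LieSuperalgebra.br_jacobi (k := k) z hx hb
  simp only [superSign, zero_ne_one, false_and, if_false, one_smul] at h1 h2
  simp only [sbr, map_add, LinearMap.add_apply] at *
  rw [h1, h2]
  abel

/-- The odd part is a module over the even part. -/
noncomputable instance oddLieRingModule : LieRingModule (homog k g 0) (homog k g 1) where
  bracket x y := ⟨sbr k (x : g) (y : g), sbr_even_odd x.2 y.2⟩
  add_lie _ _ _ := Subtype.ext (add_sbr _ _ _)
  lie_add _ _ _ := Subtype.ext (sbr_add _ _ _)
  leibniz_lie x _ _ := Subtype.ext (sbr_even_leibniz x.2 _ _)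

noncomputable instance oddLieModule : LieModule k (homog k g 0) (homog k g 1) where
  smul_lie _ _ _ := Subtype.ext (smul_sbr _ _ _)
  lie_smul _ _ _ := Subtype.ext (sbr_smul _ _ _)

omit [CharZero k] in
-- If all odd brackets vanished, the odd part would be a graded ideal; being nonzero it would be all
-- of `g`, which would then be abelian.
theorem IsSimpleSuper.exists_odd_sbr_ne_zero (hs : IsSimpleSuper k g) (h1 : homog k g 1 ≠ ⊥) :
    ∃ x ∈ homog k g 1, ∃ y ∈ homog k g 1, sbr k x y ≠ 0 := by
  by_contra! h
  rcases hs.2 (homog k g 1) (le_sup_of_le_right (le_inf le_rfl le_rfl)) (fun x y hy => by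
    obtain ⟨a, ha, b, hb, rfl⟩ := SuperSpace.exists_eq_add (k := k) x
    rw [add_sbr, h b hb y hy, add_zero]
    exact sbr_even_odd ha hy) with hb | ht
  · exact h1 hb
  · obtain ⟨x, y, hxy⟩ := hs.1
    exact hxy (h x (ht ▸ trivial) y (ht ▸ trivial))

/-- A derivation which vanishes on the even part and is a scalar on the odd part vanishes. -/
theorem IsSimpleSuper.scalar_eq_zero (hs : IsSimpleSuper k g) (h1 : homog k g 1 ≠ ⊥)
    {E : g →ₗ[k] g} (hE : ∀ x y, E (sbr k x y) = sbr k (E x) y + sbr k x (E y))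
    (h0 : ∀ x ∈ homog k g 0, E x = 0) {c : k} (hc : ∀ x ∈ homog k g 1, E x = c • x) : c = 0 := by
  obtain ⟨x, hx, y, hy, hxy⟩ := hs.exists_odd_sbr_ne_zero h1
  have h := hE x y
  rw [h0 _ (sbr_odd_odd hx hy), hc x hx, hc y hy, smul_sbr, sbr_smul, ← two_smul k, smul_smul]
    at h
  simpa [hxy] using h.symm

omit [CharZero k] in
-- The annihilator of the odd part in the even part is a graded ideal of `g`, and it is proper
-- because the odd part is nonzero.
theorem IsSimpleSuper.eq_zero_of_even (hs : IsSimpleSuper k g) (h1 : homog k g 1 ≠ ⊥) {x : g}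
    (hx : x ∈ homog k g 0) (h : ∀ y ∈ homog k g 1, sbr k x y = 0) : x = 0 := by
  let I : Submodule k g :=
    { carrier := {x | x ∈ homog k g 0 ∧ ∀ y ∈ homog k g 1, sbr k x y = 0}
      add_mem' := by
        rintro a b ⟨ha, ha'⟩ ⟨hb, hb'⟩
        exact ⟨add_mem ha hb, fun y hy => by rw [add_sbr, ha' y hy, hb' y hy, add_zero]⟩
      zero_mem' := ⟨zero_mem _, fun y _ => zero_sbr y⟩
      smul_mem' := by
        rintro c a ⟨ha, ha'⟩
        exact ⟨Submodule.smul_mem _ c ha, fun y hy => by rw [smul_sbr, ha' y hy, smul_zero]⟩ }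
  have hI : I ≤ homog k g 0 := fun x hx => hx.1
  rcases hs.2 I (le_sup_of_le_left (le_inf le_rfl hI)) (fun z x hx => by
    obtain ⟨a, ha, b, hb, rfl⟩ := SuperSpace.exists_eq_add (k := k) z
    rw [add_sbr, sbr_even_right b hx.1, hx.2 b hb, neg_zero, add_zero]
    refine ⟨sbr_even_even ha hx.1, fun y hy => ?_⟩
    have := sbr_even_leibniz ha x y
    rw [hx.2 y hy, hx.2 _ (sbr_even_odd ha hy), sbr_zero, add_zero] at this
    exact this.symm) with hb | ht
  · have : x ∈ I := ⟨hx, h⟩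
    rwa [hb, Submodule.mem_bot] at this
  · refine absurd ?_ h1
    rw [ht, top_le_iff] at hI
    have := (SuperSpace.isCompl (k := k) (V := g)).inf_eq_bot
    rwa [show SuperSpace.par 0 = (⊤ : Submodule k g) from hI, top_inf_eq] at this

theorem OddIsIrreducible.isIrreducible (h : OddIsIrreducible k g) :
    LieModule.IsIrreducible k (homog k g 0) (homog k g 1) := by
  have hne : Nontrivial (homog k g 1) := Submodule.nontrivial_iff_ne_bot.2 h.2.2.1
  refine LieModule.IsIrreducible.mk fun N hN => ?_
  have hst : EvenStable k g (N.toSubmodule.map (homog k g 1).subtype) := by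
    rintro x hx _ ⟨y, hy, rfl⟩
    exact ⟨⁅(⟨x, hx⟩ : homog k g 0), y⁆, N.lie_mem hy, rfl⟩
  rcases h.2.2.2 _ (Submodule.map_subtype_le _ _) hst with hb | ht
  · exact absurd ((LieSubmodule.toSubmodule_eq_bot N).1
      (Submodule.map_injective_of_injective
      (Submodule.subtype_injective _) (hb.trans (Submodule.map_bot _).symm))) hN
  · rw [← LieSubmodule.toSubmodule_eq_top]
    rw [eq_top_iff]
    intro y _
    have hy : (y : g) ∈ N.toSubmodule.map (homog k g 1).subtype := by rw [ht]; exact y.2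
    obtain ⟨z, hz, e⟩ := hy
    rwa [← Subtype.ext e]

variable [IsAlgClosed k]

open LieAlgebra in
-- The odd part is a faithful irreducible module, so the radical of the even part is central and
-- acts on it by scalars. The bracket with such a central element is a derivation killing the even
-- part and scalar on the odd part; the scalar must be zero, and faithfulness finishes.
theorem IsSimpleSuper.isKilling_even [FiniteDimensional k g] (hs : IsSimpleSuper k g)
    (h : OddIsIrreducible k g) : LieAlgebra.IsKilling k (homog k g 0) := by
  have hne : homog k g 1 ≠ ⊥ := h.2.2.1
  have := h.isIrreducible
  have hf : LieModule.IsFaithful k (homog k g 0) (homog k g 1) := by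
    refine (LieModule.isFaithful_iff' k _ _).2 fun x hx => ?_
    exact Subtype.ext (hs.eq_zero_of_even hne x.2 fun y hy => congrArg Subtype.val (hx ⟨y, hy⟩))
  obtain ⟨hc, hcen⟩ := hasCentralRadical_and_of_isIrreducible_of_isFaithful k (homog k g 0)
    (homog k g 1)
  have : HasTrivialRadical k (homog k g 0) := by
    rw [hasTrivialRadical_iff, (hasCentralRadical_iff k _).mp hc, LieSubmodule.eq_bot_iff]
    intro x hx
    obtain ⟨c, hc⟩ := Submodule.mem_span_singleton.1 ((hcen x).1 hx)
    have hodd : ∀ y ∈ homog k g 1, sbr k (x : g) y = c • y := fun y hy =>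
      (congrArg Subtype.val (LinearMap.congr_fun hc ⟨y, hy⟩)).symm
    have hc0 : c = 0 := by
      refine hs.scalar_eq_zero hne (E := LieSuperalgebra.br (k := k) (x : g))
        (fun y z => sbr_even_leibniz x.2 y z) (fun y hy => ?_) hodd
      have := congrArg Subtype.val ((LieModule.mem_maxTrivSubmodule k _ _ x).1 hx ⟨y, hy⟩)
      have h2 := sbr_even_right (k := k) (x : g) hy
      exact h2.trans (neg_eq_zero.2 this)
    refine Subtype.ext (hs.eq_zero_of_even hne x.2 fun y hy => ?_)
    rw [hodd y hy, hc0, zero_smul]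
  infer_instance

/-- An even derivation of a simple Lie superalgebra with irreducible odd part is inner. -/
theorem IsSimpleSuper.exists_eq_sbr [FiniteDimensional k g] (hs : IsSimpleSuper k g)
    (h : OddIsIrreducible k g) {D : g →ₗ[k] g}
    (hD : ∀ x y, D (sbr k x y) = sbr k (D x) y + sbr k x (D y))
    (h0 : ∀ x ∈ homog k g 0, D x ∈ homog k g 0) (h1 : ∀ x ∈ homog k g 1, D x ∈ homog k g 1) :
    ∃ z ∈ homog k g 0, ∀ x, D x = sbr k z x := by
  have hne : homog k g 1 ≠ ⊥ := h.2.2.1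
  have := hs.isKilling_even h
  let D₀ : LieDerivation k (homog k g 0) (homog k g 0) :=
    { toLinearMap := D.restrict h0
      leibniz' := fun a b => Subtype.ext <| by
        change D (sbr k (a : g) b) = sbr k (a : g) (D b) - sbr k (b : g) (D a)
        rw [hD, sbr_even_right (b : g) (h0 a a.2), sub_neg_eq_add, add_comm] }
  -- The restriction to the even part is inner because the Killing form there is nondegenerate. The
  -- difference `E` of `D` and `[z, ·]` kills the even part, so it commutes with its action on the
  -- odd part.
  obtain ⟨z, hz⟩ := LieDerivation.IsKilling.exists_eq_ad D₀
  have hz0 : ∀ x ∈ homog k g 0, D x = sbr k (z : g) x := by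
    intro x hx
    have e := LieDerivation.congr_fun hz ⟨x, hx⟩
    rw [LieDerivation.ad_apply_apply] at e
    exact (congrArg Subtype.val e).symm
  let E : g →ₗ[k] g := D - LieSuperalgebra.br (k := k) (z : g)
  have hEa : ∀ x, E x = D x - sbr k (z : g) x := fun x => rfl
  have hE : ∀ x y, E (sbr k x y) = sbr k (E x) y + sbr k x (E y) := by
    intro x y
    rw [hEa, hEa, hEa, hD, sbr_even_leibniz z.2, sub_sbr, sbr_sub]
    abel
  have hE0 : ∀ x ∈ homog k g 0, E x = 0 := fun x hx => by rw [hEa, hz0 x hx, sub_self]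
  have hE1 : ∀ x ∈ homog k g 1, E x ∈ homog k g 1 := fun x hx =>
    sub_mem (h1 x hx) (sbr_even_odd z.2 hx)
  have : Nontrivial (homog k g 1) := Submodule.nontrivial_iff_ne_bot.2 hne
  -- Schur's lemma: an eigenspace of `E` is stable under the even part, hence is the whole odd part.
  obtain ⟨c, hc⟩ := Module.End.exists_eigenvalue (E.restrict hE1)
  obtain ⟨y, hy, hy0⟩ := hc.exists_hasEigenvector
  have hy' : E y = c • (y : g) := congrArg Subtype.val (Module.End.mem_eigenspace_iff.1 hy)
  let W : Submodule k g := homog k g 1 ⊓ LinearMap.ker (E - c • LinearMap.id)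
  have hmem : ∀ x, x ∈ W ↔ x ∈ homog k g 1 ∧ E x = c • x := fun x => by
    simp [W, sub_eq_zero]
  have hW : W = homog k g 1 := by
    refine (h.2.2.2 W inf_le_left fun x hx w hw => ?_).resolve_left fun hb => ?_
    · rw [hmem] at hw ⊢
      refine ⟨sbr_even_odd hx hw.1, ?_⟩
      rw [hE, hE0 x hx, hw.2, zero_sbr, zero_add, sbr_smul]
    · have : (y : g) ∈ W := (hmem _).2 ⟨y.2, hy'⟩
      rw [hb, Submodule.mem_bot] at this
      exact hy0 (Subtype.ext this)
  have hEc : ∀ x ∈ homog k g 1, E x = c • x := fun x hx => ((hmem x).1 (hW ▸ hx)).2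
  have hc0 : c = 0 := hs.scalar_eq_zero hne hE hE0 hEc
  refine ⟨z, z.2, fun x => ?_⟩
  obtain ⟨a, ha, b, hb, rfl⟩ := SuperSpace.exists_eq_add (k := k) x
  have hb' := hEc b hb
  rw [hc0, zero_smul, hEa, sub_eq_zero] at hb'
  rw [map_add, sbr_add, hz0 a ha, hb']

end OddModule

/-! ### Every triangular decomposition is inner or of type I. -/

section Dichotomy

variable {k g : Type*} [Field k] [CharZero k] [AddCommGroup g] [Module k g] [LieSuperalgebra k g]

/-- The odd matrices with vanishing lower left block are stable under block diagonal matrices, and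
for `n ≥ 1` they are neither zero nor all odd matrices. -/
theorem IsSl.not_oddIsIrreducible {n : ℕ} (hn : 1 ≤ n) (h : IsSl k g n) :
    ¬ OddIsIrreducible k g := by
  rintro ⟨-, -, -, hirr⟩
  obtain ⟨φ, hφ, hr, h0, h1, hbr⟩ := h
  have : NeZero n := ⟨by omega⟩
  let W : Submodule k g :=
    { carrier := {x | x ∈ homog k g 1 ∧ (φ x).toBlocks₂₁ = 0}
      add_mem' := by
        rintro a b ⟨ha, ha'⟩ ⟨hb, hb'⟩
        refine ⟨add_mem ha hb, ?_⟩
        rw [map_add]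
        ext i j
        have e1 := congrFun (congrFun ha' i) j
        have e2 := congrFun (congrFun hb' i) j
        simp only [Matrix.toBlocks₂₁, Matrix.of_apply, Matrix.zero_apply, Matrix.add_apply] at *
        rw [e1, e2, add_zero]
      zero_mem' := ⟨zero_mem _, by ext i j; simp [Matrix.toBlocks₂₁]⟩
      smul_mem' := by
        rintro c a ⟨ha, ha'⟩
        refine ⟨Submodule.smul_mem _ c ha, ?_⟩
        rw [map_smul]
        ext i j
        have e1 := congrFun (congrFun ha' i) j
        simp only [Matrix.toBlocks₂₁, Matrix.of_apply, Matrix.zero_apply, Matrix.smul_apply] at *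
        rw [e1, smul_zero] }
  have hodd : ∀ B C : Matrix (Fin n) (Fin n) k,
      ∃ x ∈ homog k g 1, φ x = Matrix.fromBlocks 0 B C 0 := by
    intro B C
    obtain ⟨x, hx⟩ := (hr (Matrix.fromBlocks 0 B C 0)).2 (by simp)
    exact ⟨x, (h1 x).2 (by simp [hx]), hx⟩
  have hst : EvenStable k g W := by
    rintro x hx w ⟨hw, hw'⟩
    refine ⟨by simpa using LieSuperalgebra.br_mem (k := k) hx hw, ?_⟩
    obtain ⟨x1, x2⟩ := (h0 x).1 hx
    obtain ⟨w1, w2⟩ := (h1 w).1 hw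
    rw [hbr 0 1 x hx w hw, ← Matrix.fromBlocks_toBlocks (φ x), ← Matrix.fromBlocks_toBlocks (φ w),
      x1, x2, w1, w2, hw', Matrix.fromBlocks_multiply, Matrix.fromBlocks_multiply]
    ext i j
    simp [superSign, Matrix.toBlocks₂₁]
  rcases hirr W (fun x hx => hx.1) hst with hb | ht
  · obtain ⟨x, hx, ex⟩ := hodd 1 0
    have hxW : x ∈ W := ⟨hx, by rw [ex]; simp⟩
    rw [hb, Submodule.mem_bot] at hxW
    rw [hxW, map_zero] at ex
    have := congrFun (congrFun ex (Sum.inl 0)) (Sum.inr 0)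
    simp at this
  · obtain ⟨x, hx, ex⟩ := hodd 0 1
    have hxW : x ∈ W := by rw [ht]; exact hx
    have := hxW.2
    rw [ex, Matrix.toBlocks_fromBlocks₂₁] at this
    exact one_ne_zero this

variable [IsAlgClosed k]

/-- The irreducible odd case leaves only basic classical superalgebras, whose degree derivation is
the bracket with some even `z`. Since `h` has degree zero, `z` commutes with `h`, and a Cartan
subalgebra is its own normalizer, so `z ∈ h`. -/
theorem TriangularDecomposition.isInner_or_isTypeI (T : TriangularDecomposition k g)
    (hg : IsAdmissible k g) : T.IsInner ∨ T.IsTypeI := by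
  rcases T.distinguished.shape with ⟨-, ht⟩ | ⟨-, h0, h1, hb⟩ | ⟨hirr, h0, h1, hb⟩
  · refine Or.inl ⟨0, fun d α x hx _ hne => ?_⟩
    by_cases hd : d = 0
    · simp [hd]
    · have hdis := T.distinguished.isInternal.submodule_iSupIndep.pairwiseDisjoint hd
      refine absurd (Submodule.disjoint_def.1 hdis x hx ?_) hne
      rw [ht]; trivial
  · exact Or.inr ⟨h0, le_sup_left.trans h1.le, hb⟩
  · left
    rcases hg with hr | hbas | ⟨n, hn, hsl⟩
    · exact absurd hr.2.1 hirr.2.2.1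
    · have := hbas.1
      obtain ⟨D, hDgr, hD⟩ := T.distinguished.exists_derivation
      have hle : ∀ d : ℤ, T.gr d ≤ (T.gr d).comap D := fun d x hx => by
        rw [Submodule.mem_comap, hDgr d x hx]; exact Submodule.smul_mem _ _ hx
      have hsup : ∀ P Q : Submodule k g, P ≤ P.comap D → Q ≤ Q.comap D →
          P ⊔ Q ≤ (P ⊔ Q).comap D := fun P Q hP hQ =>
        sup_le (hP.trans (Submodule.comap_mono le_sup_left))
          (hQ.trans (Submodule.comap_mono le_sup_right))
      obtain ⟨z, hz, hDz⟩ := hbas.2.1.exists_eq_sbr hirr hD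
        (by rw [← h0]; exact hsup _ _ (hsup _ _ (hle _) (hle _)) (hle _))
        (by rw [← h1]; exact hsup _ _ (hle _) (hle _))
      have hzh : (⟨z, hz⟩ : homog k g 0) ∈ T.h := by
        rw [← T.isCartan.self_normalizing, LieSubalgebra.mem_normalizer_iff]
        intro t ht
        have : ⁅(⟨z, hz⟩ : homog k g 0), t⁆ = 0 := by
          refine Subtype.ext ?_
          change sbr k z (t : g) = 0
          rw [← hDz, hDgr 0 _ (T.h_le (T.coe_mem_cartanSubspace ⟨t, ht⟩))]
          simp
        rw [this]
        exact zero_mem _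
      refine ⟨⟨_, hzh⟩, fun d α x hx hα hne => ?_⟩
      have e := hα ⟨_, hzh⟩
      change sbr k z x = _ at e
      rw [← hDz, hDgr d x hx] at e
      exact (smul_left_injective k hne e).symm
    · exact absurd hirr (hsl.not_oddIsIrreducible hn)

end Dichotomy

/-! ### Highest weight modules -/

theorem tmul_ne_zero_of_ne_zero {k V W : Type*} [Field k] [AddCommGroup V] [Module k V]
    [AddCommGroup W] [Module k W] {x : V} {y : W} (hx : x ≠ 0) (hy : y ≠ 0) :
    x ⊗ₜ[k] y ≠ 0 := by
  intro h
  have hx' : ∃ f : Module.Dual k V, f x ≠ 0 := by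
    by_contra! hf; exact hx ((Module.forall_dual_apply_eq_zero_iff k x).1 hf)
  have hy' : ∃ f : Module.Dual k W, f y ≠ 0 := by
    by_contra! hf; exact hy ((Module.forall_dual_apply_eq_zero_iff k y).1 hf)
  obtain ⟨f, hf⟩ := hx'
  obtain ⟨f', hf'⟩ := hy'
  have := congrArg (LinearMap.mul' k k ∘ₗ TensorProduct.map f f') h
  simp [hf, hf'] at this

theorem SuperRep.isIrreducible_of_stable {k : Type u} {L : Type v} [Field k] [AddCommGroup L]
    [Module k L] [LieSuperalgebra k L] {V : SuperRep.{u, v, w} k L} {x : V.carrier} (hx : x ≠ 0)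
    (h : ∀ N : Submodule k V.carrier, StableUnder V.ρ N → N = ⊥ ∨ N = ⊤) : V.IsIrreducible :=
  ⟨⟨x, 0, hx⟩, fun N hN => h N hN.1⟩

theorem SuperRep.parity_quotient {k : Type u} {L : Type v} [Field k] [AddCommGroup L]
    [Module k L] [LieSuperalgebra k L] (V : SuperRep.{u, v, w} k L) {N : Submodule k V.carrier}
    (hN : V.IsSubrep N) (m : V.carrier) :
    SuperSpace.parity k (V.quotient N hN).carrier (N.mkQ m) =
      N.mkQ (SuperSpace.parity k V.carrier m) := by
  obtain ⟨a, ha, b, hb, rfl⟩ := SuperSpace.exists_eq_add (k := k) m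
  have ha' : N.mkQ a ∈ homog k (V.quotient N hN).carrier 0 := ⟨a, ha, rfl⟩
  have hb' : N.mkQ b ∈ homog k (V.quotient N hN).carrier 1 := ⟨b, hb, rfl⟩
  rw [map_add, map_add (SuperSpace.parity k V.carrier), SuperSpace.parity_even ha,
    SuperSpace.parity_odd hb, map_add, map_neg]
  refine (map_add (SuperSpace.parity k (V.quotient N hN).carrier) _ _).trans ?_
  exact congrArg₂ (· + ·) (SuperSpace.parity_even ha') (SuperSpace.parity_odd hb')

theorem SuperSpace.parity_tensor {k : Type u} {L : Type v} [Field k] [CharZero k] [AddCommGroup L]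
    [Module k L] [LieSuperalgebra k L] (V : SuperRep.{u, v, w₁} k L) (W : SuperRep.{u, v, w₂} k L)
    {x : V.carrier} {y : W.carrier} (hx : x ∈ homog k V.carrier 0) (hy : y ∈ homog k W.carrier 0) :
    x ⊗ₜ[k] y ∈ homog k (V.tensor W).carrier 0 := by
  change x ⊗ₜ[k] y ∈ involutionPart (SuperRep.tensorParity V W) 0
  rw [mem_involutionPart_zero, SuperRep.tensorParity, TensorProduct.map_tmul,
    SuperSpace.parity_even hx, SuperSpace.parity_even hy]

theorem SuperRep.tensorρ_apply_of_even {k : Type u} {L : Type v} [Field k] [AddCommGroup L]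
    [Module k L] [LieSuperalgebra k L] (V : SuperRep.{u, v, w₁} k L) (W : SuperRep.{u, v, w₂} k L)
    {x : V.carrier} (hx : x ∈ homog k V.carrier 0) (y : W.carrier) (z : L) :
    tensorρ V W z (x ⊗ₜ y) = V.ρ z x ⊗ₜ y + x ⊗ₜ W.ρ z y := by
  obtain ⟨a, ha, b, hb, rfl⟩ := SuperSpace.exists_eq_add (k := k) z
  rw [map_add, LinearMap.add_apply, tensorρ_even V W ha, tensorρ_odd V W hb,
    SuperSpace.parity_even hx, map_add, map_add, LinearMap.add_apply, LinearMap.add_apply,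
    TensorProduct.add_tmul, TensorProduct.tmul_add]
  abel

/-! ### Highest weight data, the induced module and its irreducible quotient. -/

section HighestWeight

variable {k : Type u} {g : Type v} {A : Type w} [Field k] [CharZero k] [AddCommGroup g]
  [Module k g] [LieSuperalgebra k g] [CommRing A] [Algebra k A] {T : TriangularDecomposition k g}

theorem TriangularDecomposition.IsHighestWeightVector.exists_hwData
    {V : SuperRep.{u, max v w, w'} k (g ⊗[k] A)} {x : V.carrier}
    (h : T.IsHighestWeightVector V x) :
    ∃ ψ : Module.Dual k (T.h ⊗[k] A), HWData T V.ρ x ψ := by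
  obtain ⟨hx, hpos, hcar, hgen⟩ := h
  choose c hc using hcar
  refine ⟨{ toFun := c, map_add' := fun s t => ?_, map_smul' := fun a t => ?_ },
    V.isSuperHom, hpos, hc, hgen⟩
  · refine smul_left_injective k hx ?_
    change c (s + t) • x = (c s + c t) • x
    rw [← hc, add_smul, ← hc, ← hc, map_add, map_add, LinearMap.add_apply]
  · refine smul_left_injective k hx ?_
    change c (a • t) • x = (a • c t) • x
    rw [← hc, smul_assoc, ← hc, map_smul, map_smul, LinearMap.smul_apply]

theorem HWData.quotient {V : SuperRep.{u, max v w, w'} k (g ⊗[k] A)} {x : V.carrier}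
    {ψ : Module.Dual k (T.h ⊗[k] A)} (H : HWData T V.ρ x ψ) {N : Submodule k V.carrier}
    (hN : V.IsSubrep N) : HWData T (V.quotient N hN).ρ (N.mkQ x) ψ where
  super := (V.quotient N hN).isSuperHom
  pos y hy a := by
    change N.mkQ (V.ρ (y ⊗ₜ a) x) = 0
    rw [H.pos y hy a, map_zero]
  cartan t := by
    change N.mkQ (V.ρ _ x) = ψ t • N.mkQ x
    rw [H.cartan t, map_smul]
  gen M hM hx := by
    have h : M.comap N.mkQ = ⊤ := H.gen _ (fun y m hm => hM y _ hm) hx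
    rw [eq_top_iff]
    intro m _
    obtain ⟨m, rfl⟩ := N.mkQ_surjective m
    have : m ∈ M.comap N.mkQ := by rw [h]; trivial
    exact this

variable (T)

omit [CharZero k] in
theorem SuperEnv.mem_of_mul_mem {L : Type*} [AddCommGroup L] [Module k L] [LieSuperalgebra k L]
    {N : Submodule k (SuperEnv k L)} (h : ∀ (x : L), ∀ m ∈ N, SuperEnv.ι k x * m ∈ N)
    (z : SuperEnv k L) : ∀ m ∈ N, z * m ∈ N := by
  obtain ⟨t, rfl⟩ : ∃ t, SuperEnv.mk k L t = z := Quotient.exists_rep z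
  induction t using TensorAlgebra.induction with
  | algebraMap c =>
    intro m hm
    rw [AlgHom.commutes, ← Algebra.smul_def]
    exact N.smul_mem c hm
  | ι x => exact h x
  | mul a b ha hb => intro m hm; rw [map_mul, mul_assoc]; exact ha _ (hb m hm)
  | add a b ha hb => intro m hm; rw [map_add, add_mul]; exact add_mem (ha m hm) (hb m hm)

namespace TriangularDecomposition

variable (ψ : Module.Dual k (T.h ⊗[k] A))

/-- The quotient map from the enveloping superalgebra to the induced module. -/
noncomputable def vermaMk : SuperEnv k (g ⊗[k] A) →ₗ[k] (T.verma ψ).carrier :=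
  Submodule.mkQ (M := (SuperEnv.regular k (g ⊗[k] A)).carrier) _

theorem vermaMk_surjective : Function.Surjective (T.vermaMk ψ) :=
  Submodule.mkQ_surjective (M := (SuperEnv.regular k (g ⊗[k] A)).carrier) _

theorem vermaMk_eq_zero {z : SuperEnv k (g ⊗[k] A)}
    (hz : z ∈ Submodule.span (SuperEnv k (g ⊗[k] A)) (T.vermaRelations ψ)) : T.vermaMk ψ z = 0 :=
  (Submodule.Quotient.mk_eq_zero (M := (SuperEnv.regular k (g ⊗[k] A)).carrier) _).2 hz

theorem verma_ρ (x : g ⊗[k] A) (z : SuperEnv k (g ⊗[k] A)) :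
    (T.verma ψ).ρ x (T.vermaMk ψ z) = T.vermaMk ψ (SuperEnv.ι k x * z) := rfl

/-- The generator of the induced module. -/
noncomputable def vermaGen : (T.verma ψ).carrier := T.vermaMk ψ 1

theorem hwData_vermaGen : HWData T (T.verma ψ).ρ (T.vermaGen ψ) ψ where
  super := (T.verma ψ).isSuperHom
  pos x hx a := by
    rw [vermaGen, verma_ρ, mul_one]
    exact T.vermaMk_eq_zero ψ (Submodule.subset_span (Or.inl ⟨x, hx, a, rfl⟩))
  cartan t := by
    rw [vermaGen, verma_ρ, mul_one, ← map_smul, ← sub_eq_zero, ← map_sub,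
      ← Algebra.algebraMap_eq_smul_one]
    exact T.vermaMk_eq_zero ψ (Submodule.subset_span (Or.inr ⟨t, rfl⟩))
  gen N hN h1 := by
    rw [eq_top_iff]
    intro m _
    obtain ⟨z, rfl⟩ := T.vermaMk_surjective ψ m
    have := SuperEnv.mem_of_mul_mem (N := N.comap (T.vermaMk ψ)) (fun x m hm => hN x _ hm) z 1 h1
    rwa [mul_one] at this

theorem vermaGen_even : T.vermaGen ψ ∈ homog k (T.verma ψ).carrier 0 := by
  refine ⟨(1 : SuperEnv k (g ⊗[k] A)), ?_, rfl⟩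
  change (1 : SuperEnv k (g ⊗[k] A)) ∈ involutionPart (SuperEnv.parity k).toLinearMap 0
  rw [mem_involutionPart_zero]
  exact map_one (SuperEnv.parity k)

/-- The evaluation at a vector `x` of an action, on the enveloping superalgebra, factors through
the induced module if `x` is singular of weight `ψ`. -/
theorem exists_verma_hom {ψ : Module.Dual k (T.h ⊗[k] A)} {E : Type*} [AddCommGroup E] [Module k E]
    {ρ : g ⊗[k] A →ₗ[k] Module.End k E} {x : E} (hρ : IsSuperHom ρ)
    (hpos : ∀ y ∈ T.nPos, ∀ a : A, ρ (y ⊗ₜ a) x = 0)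
    (hcar : ∀ t : T.h ⊗[k] A, ρ (T.inclCartan A t) x = ψ t • x) :
    ∃ f : (T.verma ψ).carrier →ₗ[k] E, f (T.vermaGen ψ) = x ∧
      ∀ y m, f ((T.verma ψ).ρ y m) = ρ y (f m) := by
  let F := SuperEnv.lift ρ hρ
  let J : Submodule (SuperEnv k (g ⊗[k] A)) (SuperEnv k (g ⊗[k] A)) :=
    { carrier := {z | F z x = 0}
      add_mem' := by
        intro a b ha hb
        change F (a + b) x = 0
        rw [map_add, LinearMap.add_apply, ha, hb, add_zero]
      zero_mem' := by
        change F 0 x = 0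
        rw [map_zero, LinearMap.zero_apply]
      smul_mem' := by
        intro c a ha
        change F (c * a) x = 0
        rw [map_mul, Module.End.mul_apply, ha, map_zero] }
  have hJ : Submodule.span (SuperEnv k (g ⊗[k] A)) (T.vermaRelations ψ) ≤ J := by
    refine Submodule.span_le.2 ?_
    rintro z (⟨y, hy, a, rfl⟩ | ⟨t, rfl⟩)
    · change F (SuperEnv.ι k (y ⊗ₜ[k] a)) x = 0
      rw [SuperEnv.lift_ι, hpos y hy a]
    · change F _ x = 0
      rw [map_sub, SuperEnv.lift_ι, AlgHom.commutes, LinearMap.sub_apply, hcar,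
        Module.algebraMap_end_apply, sub_self]
  refine ⟨Submodule.liftQ _ (LinearMap.applyₗ x ∘ₗ F.toLinearMap) fun z hz => hJ hz, ?_, ?_⟩
  · change F 1 x = x
    rw [map_one, Module.End.one_apply]
  · intro y m
    obtain ⟨z, rfl⟩ := T.vermaMk_surjective ψ m
    change F (SuperEnv.ι k y * z) x = ρ y (F z x)
    rw [map_mul, SuperEnv.lift_ι, Module.End.mul_apply]

/-- A homomorphism from the induced module sends the generator to the nonzero singular vector
constructed on the enveloping superalgebra of `n⁻ ⊗ A`. -/
theorem vermaGen_ne_zero (hab : ∀ s t : T.h, ⁅s, t⁆ = 0) : T.vermaGen ψ ≠ 0 := by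
  obtain ⟨n, ρ, x, hρ, hx, hpos, hcar⟩ := T.exists_singular_vector hab ψ
  obtain ⟨f, hf, -⟩ := T.exists_verma_hom hρ hpos hcar
  intro h
  rw [h, map_zero] at hf
  exact hx hf.symm

theorem isSubrep_maxSubrep : (T.verma ψ).IsSubrep (T.maxSubrep ψ) :=
  (T.verma ψ).isSubrep_sSup _ fun _ h => h.1

/-- The data of an irreducible module with an even highest weight vector of weight `ψ`. -/
structure IsIrreducibleHW (V : SuperRep.{u, max v w, w'} k (g ⊗[k] A))
    (ψ : Module.Dual k (T.h ⊗[k] A)) : Prop where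
  irreducible : V.IsIrreducible
  exists_hwData : ∃ x ∈ homog k V.carrier 0, x ≠ 0 ∧ HWData T V.ρ x ψ

/-! ### Characterisation of `V(ψ)` and its tensor products. -/

section Admissible

variable [IsAlgClosed k] (hg : IsAdmissible k g)
include hg

theorem isNilpotent_of_admissible {R : Type*} [Ring R] [Algebra k R] {ρ : g ⊗[k] A →ₗ[k] R}
    (hρ : IsSuperHom ρ) : ∀ w ∈ negZero T ρ, IsNilpotent w := by
  have := hg.finiteDimensional
  exact fun w hw => isNilpotent_of_mem_negZero (T.isInner_or_isTypeI hg) hρ hw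

/-- All proper submodules lie in the one subspace `properBound`, which misses the generator, so
their sum is still proper. -/
theorem maxSubrep_ne_top : T.maxSubrep ψ ≠ ⊤ := by
  have H := T.hwData_vermaGen ψ
  have hnil := T.isNilpotent_of_admissible hg H.super
  have hle : T.maxSubrep ψ ≤ H.properBound :=
    sSup_le fun N hN => HWData.le_properBound hnil H hN.1.1 hN.2
  intro ht
  refine HWData.not_mem_properBound hnil H (T.vermaGen_ne_zero ψ (T.cartan_abelian hg)) (hle ?_)
  rw [ht]; trivial

theorem isIrreducibleHW_irr : T.IsIrreducibleHW (T.irr ψ) ψ := by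
  have H := T.hwData_vermaGen ψ
  have hS := T.isSubrep_maxSubrep ψ
  have hne : (T.maxSubrep ψ).mkQ (T.vermaGen ψ) ≠ 0 := by
    rw [Submodule.mkQ_apply, Ne, Submodule.Quotient.mk_eq_zero]
    exact fun h => T.maxSubrep_ne_top ψ hg (H.gen _ hS.1 h)
  refine ⟨⟨⟨_, 0, hne⟩, fun N hN => ?_⟩, _, ⟨_, T.vermaGen_even ψ, rfl⟩, hne, H.quotient hS⟩
  have hcomap : (T.verma ψ).IsSubrep (N.comap (T.maxSubrep ψ).mkQ) := by
    refine ⟨fun y m hm => hN.1 y _ hm, SuperSpace.isGraded_of_parity_mem fun m hm => ?_⟩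
    have := SuperSpace.parity_mem_of_isGraded hN.2 hm
    change _ ∈ N
    rwa [← SuperRep.parity_quotient _ hS]
  by_cases ht : N.comap (T.maxSubrep ψ).mkQ = ⊤
  · right
    rw [eq_top_iff]
    intro m _
    obtain ⟨m, rfl⟩ := Submodule.mkQ_surjective _ m
    have : m ∈ N.comap (T.maxSubrep ψ).mkQ := by rw [ht]; trivial
    exact this
  · left
    rw [eq_bot_iff]
    intro m hm
    obtain ⟨m, rfl⟩ := Submodule.mkQ_surjective _ m
    have : m ∈ T.maxSubrep ψ := (le_sSup ⟨hcomap, ht⟩ : N.comap (T.maxSubrep ψ).mkQ ≤ T.maxSubrep ψ) hm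
    exact (Submodule.Quotient.mk_eq_zero _).2 this

variable {T ψ}

/-- An irreducible module with an even highest weight vector of weight `ψ` is isomorphic to
`V(ψ)`. -/
theorem IsIrreducibleHW.iso {V : SuperRep.{u, max v w, w'} k (g ⊗[k] A)}
    (h : T.IsIrreducibleHW V ψ) : (T.irr ψ).Iso V := by
  obtain ⟨x, hx0, hx, H⟩ := h.exists_hwData
  obtain ⟨f, hf1, hf⟩ := T.exists_verma_hom H.super H.pos H.cartan
  have hS := T.isSubrep_maxSubrep ψ
  -- The vectors on which `f` respects parity form a stable subspace containing the generator,
  -- because the generator and its image are both even.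
  have hpar : ∀ m, f (SuperSpace.parity k _ m) = SuperSpace.parity k _ (f m) := by
    have := (T.hwData_vermaGen ψ).gen
      (LinearMap.eqLocus (f ∘ₗ SuperSpace.parity k _) (SuperSpace.parity k _ ∘ₗ f))
      (fun y m hm => by
        replace hm : f (SuperSpace.parity k _ m) = SuperSpace.parity k _ (f m) := hm
        change f (SuperSpace.parity k _ _) = SuperSpace.parity k _ (f _)
        obtain ⟨a, ha, b, hb, rfl⟩ := SuperSpace.exists_eq_add (k := k) y
        rw [hf, map_add, map_add, LinearMap.add_apply, LinearMap.add_apply, map_add, map_add,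
          map_add, SuperRep.parity_ρ_even _ ha, SuperRep.parity_ρ_odd _ hb,
          SuperRep.parity_ρ_even _ ha, SuperRep.parity_ρ_odd _ hb, map_neg, hf, hf, hm])
      (by
        change f (SuperSpace.parity k _ _) = SuperSpace.parity k _ (f _)
        rw [SuperSpace.parity_even (T.vermaGen_even ψ), hf1, SuperSpace.parity_even hx0])
    intro m
    have hm : m ∈ LinearMap.eqLocus (f ∘ₗ SuperSpace.parity k _)
      (SuperSpace.parity k _ ∘ₗ f) := by rw [this]; trivial
    exact hm
  have hsurj : LinearMap.range f = ⊤ := by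
    refine H.gen _ ?_ ⟨_, hf1⟩
    rintro y _ ⟨m, rfl⟩
    exact ⟨_, hf y m⟩
  have hker : LinearMap.ker f ≤ T.maxSubrep ψ := by
    refine le_sSup ⟨⟨fun y m hm => ?_, SuperSpace.isGraded_of_parity_mem fun m hm => ?_⟩, ?_⟩
    · rw [LinearMap.mem_ker] at hm ⊢
      rw [hf, hm, map_zero]
    · rw [LinearMap.mem_ker] at hm ⊢
      rw [hpar, hm, map_zero]
    · intro ht
      have : T.vermaGen ψ ∈ LinearMap.ker f := by rw [ht]; trivial
      rw [LinearMap.mem_ker, hf1] at this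
      exact hx this
  -- The image is a submodule of an irreducible module. If it were everything, the maximal submodule
  -- together with the kernel, which it contains, would exhaust the induced module.
  have hmax : (T.maxSubrep ψ).map f = ⊥ := by
    refine (h.irreducible.2 _ ⟨?_, SuperSpace.isGraded_of_parity_mem ?_⟩).resolve_right fun ht => ?_
    · rintro y _ ⟨m, hm, rfl⟩
      exact ⟨_, hS.1 y m hm, hf y m⟩
    · rintro _ ⟨m, hm, rfl⟩
      exact ⟨_, SuperSpace.parity_mem_of_isGraded hS.2 hm, hpar m⟩
    · refine T.maxSubrep_ne_top ψ hg ?_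
      rw [← sup_eq_left.2 hker, ← Submodule.comap_map_eq, ht, Submodule.comap_top]
  have hle : T.maxSubrep ψ ≤ LinearMap.ker f := by
    intro m hm
    have : f m ∈ (T.maxSubrep ψ).map f := ⟨m, hm, rfl⟩
    rwa [hmax] at this
  let F : (T.irr ψ).carrier →ₗ[k] V.carrier := (T.maxSubrep ψ).liftQ f hle
  have hbij : Function.Bijective F := by
    constructor
    · rw [← LinearMap.ker_eq_bot]
      exact Submodule.ker_liftQ_eq_bot _ _ _ hker
    · intro y
      obtain ⟨m, rfl⟩ := LinearMap.range_eq_top.1 hsurj y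
      exact ⟨(T.maxSubrep ψ).mkQ m, rfl⟩
  refine ⟨LinearEquiv.ofBijective F hbij, ?_, ?_⟩
  · rintro i _ ⟨m, hm, rfl⟩
    change f m ∈ _
    rcases SuperRep.zmod2_cases i with rfl | rfl
    · exact mem_homog_zero_of_parity (by rw [← hpar, SuperSpace.parity_even hm])
    · exact mem_homog_one_of_parity (by rw [← hpar, SuperSpace.parity_odd hm, map_neg])
  · intro y m
    obtain ⟨m, rfl⟩ := Submodule.mkQ_surjective _ m
    exact hf y m

/-- Evenness of the highest weight vectors removes the signs, so the weights add and the tensor of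
the two vectors is again even. That it generates follows from irreducibility. -/
theorem IsIrreducibleHW.tensor {V : SuperRep.{u, max v w, w₁} k (g ⊗[k] A)}
    {W : SuperRep.{u, max v w, w₂} k (g ⊗[k] A)} {φ : Module.Dual k (T.h ⊗[k] A)}
    (hV : T.IsIrreducibleHW V ψ) (hW : T.IsIrreducibleHW W φ)
    (hd : Disjoint (support V) (support W)) : T.IsIrreducibleHW (V.tensor W) (ψ + φ) := by
  obtain ⟨x, hx0, hx, HV⟩ := hV.exists_hwData
  obtain ⟨y, hy0, hy, HW⟩ := hW.exists_hwData
  have hxy : x ⊗ₜ[k] y ≠ 0 := tmul_ne_zero_of_ne_zero hx hy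
  have hnV := T.isNilpotent_of_admissible hg HV.super
  have hsV := fun N hN => hV.irreducible.eq_bot_or_eq_top_of_stable (N := N) hx HV hnV hN
  have hsW := fun N hN => hW.irreducible.eq_bot_or_eq_top_of_stable (N := N) hy HW
    (T.isNilpotent_of_admissible hg HW.super) hN
  have hs : ∀ N : Submodule k (V.carrier ⊗[k] W.carrier), StableUnder (SuperRep.tensorρ V W) N →
      N = ⊥ ∨ N = ⊤ := fun N hN =>
    tensor_eq_bot_or_eq_top hsV (fun f hf => HWData.end_eq_smul hnV HV hsV hf) hsW hd hN
  refine ⟨SuperRep.isIrreducible_of_stable (V := V.tensor W) hxy hs, x ⊗ₜ y,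
    SuperSpace.parity_tensor V W hx0 hy0, hxy, ⟨(V.tensor W).isSuperHom, ?_, ?_, ?_⟩⟩
  · intro z hz a
    refine (SuperRep.tensorρ_apply_of_even V W hx0 y _).trans ?_
    rw [HV.pos z hz a, HW.pos z hz a, TensorProduct.zero_tmul, TensorProduct.tmul_zero]
    exact add_zero _
  · intro t
    refine (SuperRep.tensorρ_apply_of_even V W hx0 y _).trans ?_
    rw [HV.cartan t, HW.cartan t, TensorProduct.tmul_smul, ← TensorProduct.smul_tmul',
      ← add_smul]
    rfl
  · intro N hN hmem
    refine (hs N hN).resolve_left fun hb => hxy ?_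
    rw [hb] at hmem
    exact hmem

theorem isIrreducible_tensor {V : SuperRep.{u, max v w, w₁} k (g ⊗[k] A)}
    {W : SuperRep.{u, max v w, w₂} k (g ⊗[k] A)} (hV : V.IsIrreducible)
    (hV' : T.IsHighestWeight V) (hW : W.IsIrreducible) (hW' : T.IsHighestWeight W)
    (hd : Disjoint (support V) (support W)) : (V.tensor W).IsIrreducible := by
  obtain ⟨x, hx⟩ := hV'
  obtain ⟨y, hy⟩ := hW'
  obtain ⟨ψ, HV⟩ := hx.exists_hwData
  obtain ⟨φ, HW⟩ := hy.exists_hwData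
  have hnV := T.isNilpotent_of_admissible hg HV.super
  have hsV := fun N hN => hV.eq_bot_or_eq_top_of_stable (N := N) hx.1 HV hnV hN
  have hsW := fun N hN => hW.eq_bot_or_eq_top_of_stable (N := N) hy.1 HW
    (T.isNilpotent_of_admissible hg HW.super) hN
  exact SuperRep.isIrreducible_of_stable (V := V.tensor W) (tmul_ne_zero_of_ne_zero hx.1 hy.1)
    fun N hN =>
      tensor_eq_bot_or_eq_top hsV (fun f hf => HWData.end_eq_smul hnV HV hsV hf) hsW hd hN

/-- The bound on the support is carried through the induction because the next factor must have
support disjoint from that of the partial tensor product as a whole. -/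
theorem isIrreducibleHW_tensorFamily (n : ℕ) (ψ : Fin (n + 1) → Module.Dual k (T.h ⊗[k] A))
    (hd : Pairwise fun i j => Disjoint (support (T.irr (ψ i))) (support (T.irr (ψ j)))) :
    T.IsIrreducibleHW (SuperRep.tensorFamily n fun i => T.irr (ψ i)) (∑ i, ψ i) ∧
      support (SuperRep.tensorFamily n fun i => T.irr (ψ i)) ⊆ ⋃ i, support (T.irr (ψ i)) := by
  induction n with
  | zero =>
    simp only [Fin.sum_univ_succ, Finset.univ_eq_empty, Finset.sum_empty, add_zero]
    exact ⟨T.isIrreducibleHW_irr (ψ 0) hg, Set.subset_iUnion (fun i => support (T.irr (ψ i))) 0⟩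
  | succ n ih =>
    obtain ⟨h1, h2⟩ := ih (fun i => ψ i.castSucc) fun i j hij =>
      hd fun h => hij (Fin.castSucc_injective _ h)
    rw [Fin.sum_univ_castSucc]
    constructor
    · refine h1.tensor hg (T.isIrreducibleHW_irr (ψ (Fin.last (n + 1))) hg)
        (Set.disjoint_of_subset_left h2 ?_)
      rw [Set.disjoint_iUnion_left]
      exact fun i => hd (Fin.castSucc_lt_last i).ne
    · refine (support_tensor_subset _ _).trans (Set.union_subset (h2.trans ?_) ?_)
      · exact Set.iUnion_subset fun i =>
          Set.subset_iUnion (fun i => support (T.irr (ψ i))) i.castSucc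
      · exact Set.subset_iUnion (fun i => support (T.irr (ψ i))) _

end Admissible

end TriangularDecomposition

end HighestWeight

theorem mainTheorem10 {k : Type u} [Field k] [IsAlgClosed k] [CharZero k]
    {g : Type v} [AddCommGroup g] [Module k g] [LieSuperalgebra k g]
    (hg : IsAdmissible k g) (T : TriangularDecomposition k g)
    {A : Type w} [CommRing A] [Algebra k A] :
    (∀ (V : SuperRep.{u, max v w, w₁} k (g ⊗[k] A)) (W : SuperRep.{u, max v w, w₂} k (g ⊗[k] A)),
      V.IsIrreducible → T.IsHighestWeight V → W.IsIrreducible → T.IsHighestWeight W →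
      Disjoint (support V) (support W) →
      (V.tensor W).IsIrreducible) ∧
    (∀ (n : ℕ) (ψ : Fin (n + 1) → Module.Dual k (T.h ⊗[k] A)),
      Pairwise (fun i j => Disjoint (support (T.irr (ψ i))) (support (T.irr (ψ j)))) →
      (T.irr (∑ i, ψ i)).Iso (SuperRep.tensorFamily n fun i => T.irr (ψ i))) := by
  refine ⟨fun V W hV hV' hW hW' hd =>
    TriangularDecomposition.isIrreducible_tensor hg hV hV' hW hW' hd, fun n ψ hd => ?_⟩
  exact (TriangularDecomposition.isIrreducibleHW_tensorFamily hg n ψ hd).1.iso hg
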